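/- Let $F$ be a non-archimedean local field (of any characteristic) with ring of integers $\mathfrak o$, maximal ideal $\mathfrak p$ and a uniformizer $\pi$. Partitions. For a partition $\lambda=(\lambda_1\ge\lambda_2\ge\cdots)$ put $|\lambda|=\sum_i\lambda_i$. A finite $\mathfrak o$-module has type $\lambda$ if it is isomorphic to $\bigoplus_i\mathfrak o/\mathfrak p^{\lambda_i}$ (sums over the nonzero parts). Modules with pairings. An alternating $\mathfrak o$-module is a finite $\mathfrak o$-module $M$ with a perfect $\mathfrak o$-bilinear pairing $M\times M\to F/\mathfrak o$ with $\langle x,x\rangle=0$ for all $x$; it has type $\lambda$ if it is isometric to $\bigoplus_i(\mathfrak o/\mathfrak p^{\lambda_i})^2$ with $\langle x,y\rangle=x^TA^{-1}y$, where $A$ is block diagonal with blocks $\begin{pmatrix}0&\pi^{\lambda_i}\\-\pi^{\lambda_i}&0\end{pmatrix}$. In the Hermitian case, $F$ moreover carries an involution $*$ (a field automorphism of order $2$) with fixed field $F_0$ such that $F/F_0$ is unramified, and $\pi\in F_0$. A Hermitian $\mathfrak o$-module is a finite $\mathfrak o$-module with a perfect pairing into $F/\mathfrak o$ that is $*$-linear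 in the first variable, linear in the second, and satisfies $\langle y,x\rangle=\langle x,y\rangle^*$; it has type $\lambda$ if it is isometric to $\bigoplus_i\mathfrak o/\mathfrak p^{\lambda_i}$ with $\langle x,y\rangle=\sum_i x_i^*\pi^{-\lambda_i}y_i$. Write $M_\lambda$ for a module (without pairing, alternating, or Hermitian) of type $\lambda$, $\mathrm{Aut}$ for module automorphisms, and $\mathrm{Aut}^A$, $\mathrm{Aut}^H$ for the module automorphisms that preserve the pairing. Hall-Littlewood polynomials. For $n$ at least the length of $\lambda$, $$P_\lambda(x_1,\dots,x_n;t)=\frac1{V_\lambda(t)}\sum_{\sigma\in S_n}\sigma\Big(x_1^{\lambda_1}\cdots x_n^{\lambda_n}\prod_{1\le i<j\le n}\frac{x_i-tx_j}{x_i-x_j}\Big),\qquad V_\lambda(t)=\prod_{i\ge0}\prod_{k=1}^{m_i}\frac{1-t^k}{1-t},$$ where $m_i=\#\{1\le j\le n:\lambda_j=i\}$; this is a polynomial in $x_1,\dots,x_n$. For infinitely many real arguments, $P_\lambda(a_1,a_2,\dots;t)=\lim_{n\to\infty}P_\lambda(a_1,\dots,a_n;t)$. For two sequences $a,b$ we write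 $P_\lambda(a,b;t)=P_\lambda(a_1,b_1,a_2,b_2,\dots;t)$. Let $\nu=(\nu_1\ge\dots\ge\nu_n\ge1)$ be a partition, $M_\nu$ an $\mathfrak o$-module (without pairing) of type $\nu$, and let $\nu^2=(\nu_1,\nu_1,\dots,\nu_n,\nu_n)$. For an $\mathfrak o$-module $M$, with or without pairing, let $\mathrm{Hom}(M,M_\nu)$ be the set of all $\mathfrak o$-module homomorphisms. Let $u$ be a real number. 1. (No pairing) Let $q=\#(\mathfrak o/\mathfrak p)$ and $u>-1$. Then $$\mathbf P(u;\lambda)=\frac{q^{-u|\lambda|}}{\#\mathrm{Aut}(M_\lambda)}\prod_{j\ge1}(1-q^{-u-j})$$ is a probability distribution on partitions. If $M$ is a random finite $\mathfrak o$-module that has type $\lambda$ with probability $\mathbf P(u;\lambda)$ for every $\lambda$, then $\#\mathrm{Hom}(M,M_\nu)$ is integrable and $$\mathbb E[\#\mathrm{Hom}(M,M_\nu)]=\frac{P_\nu\big((q^{-k})_{k\ge0},(q^{-u-k})_{k\ge0};\,q^{-1}\big)}{P_\nu\big((q^{-k})_{k\ge0};\,q^{-1}\big)}.$$ 2. (Alternating)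 Let $q=\#(\mathfrak o/\mathfrak p)$ and $u>-\tfrac12$. Then $$\mathbf P^{\mathrm{alt}}(u;\lambda)=\frac{q^{-2u|\lambda|}\,\#M_\lambda}{\#\mathrm{Aut}^A(M_\lambda)}\prod_{j\ge1}(1-q^{-2u-2j+1})$$ is a probability distribution on partitions. If $M$ is a random alternating $\mathfrak o$-module that has type $\lambda$ with probability $\mathbf P^{\mathrm{alt}}(u;\lambda)$ for every $\lambda$, then $\#\mathrm{Hom}(M,M_\nu)$ is integrable and $$\mathbb E[\#\mathrm{Hom}(M,M_\nu)]=\frac{P_\nu\big((q^{-2k})_{k\ge0},(q^{1-2u-2k})_{k\ge0};\,q^{-2}\big)}{P_\nu\big((q^{-2k})_{k\ge0};\,q^{-2}\big)}.$$ 3. (Hermitian) Let $q^2=\#(\mathfrak o/\mathfrak p)$ and $u>-1$. Then $$\mathbf P^{\mathrm{her}}(u;\lambda)=\frac{q^{-u|\lambda|}}{\#\mathrm{Aut}^H(M_\lambda)}\prod_{j\ge1}\big(1-(-1)^{j-1}q^{-u-j}\big)$$ is a probability distribution on partitions. If $M$ is a random Hermitian $\mathfrak o$-module that has type $\lambda$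 with probability $\mathbf P^{\mathrm{her}}(u;\lambda)$ for every $\lambda$, then $\#\mathrm{Hom}(M,M_\nu)$ is integrable and $$\mathbb E[\#\mathrm{Hom}(M,M_\nu)]=\frac{P_{\nu^2}\big(((-1)^kq^{-k})_{k\ge0},((-1)^{k+1}q^{-u-k})_{k\ge0};\,-q^{-1}\big)}{P_{\nu^2}\big(((-1)^kq^{-k})_{k\ge0};\,-q^{-1}\big)}.$$ In all three cases the limits defining numerator and denominator exist and the denominator is nonzero. -/

import Mathlib

open scoped ValuativeRel

noncomputable section

section

open Finset

/-- The normalizing constant `V_μ(t) = ∏_{i ≥ 0} ∏_{k=1}^{m_i} (1 - t^k) / (1 - t)` in `n` variables,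
where `m_i` is the multiplicity of `i` in `(μ_1, …, μ_n)`, zeros included (this is the constant that
makes the polynomial monic). Partitions are Young diagrams: `μ_{i+1} = μ.rowLen i`, the length is
`μ.colLen 0` and `|μ| = μ.card`. -/
def hallLittlewoodNorm (n : ℕ) (μ : YoungDiagram) (t : ℝ) : ℝ :=
  ∏ i ∈ range (μ.rowLen 0 + 1),
    ∏ k ∈ range (#{j : Fin n | μ.rowLen j = i}), (1 - t ^ (k + 1)) / (1 - t)

/-- The symmetrized sum
`V_μ(t)⁻¹ ∑_σ σ (x_1^{μ_1} ⋯ x_n^{μ_n} ∏_{i<j} (x_i - t x_j) / (x_i - x_j))`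
in the field of rational functions in `n` variables (for `n` at least the length of `μ`). -/
def hallLittlewoodFrac (n : ℕ) (μ : YoungDiagram) (t : ℝ) :
    FractionRing (MvPolynomial (Fin n) ℝ) :=
  let x : Fin n → FractionRing (MvPolynomial (Fin n) ℝ) := fun i =>
    algebraMap (MvPolynomial (Fin n) ℝ) _ (MvPolynomial.X i)
  let c : ℝ → FractionRing (MvPolynomial (Fin n) ℝ) := fun r =>
    algebraMap (MvPolynomial (Fin n) ℝ) _ (MvPolynomial.C r)
  c (hallLittlewoodNorm n μ t)⁻¹ * ∑ σ : Equiv.Perm (Fin n),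
    (∏ i : Fin n, x (σ i) ^ μ.rowLen i) *
      ∏ i : Fin n, ∏ j ∈ Ioi i, (x (σ i) - c t * x (σ j)) / (x (σ i) - x (σ j))

/-- The Hall-Littlewood polynomial `P_μ(x_1, …, x_n; t)`: the polynomial that equals the rational
function `hallLittlewoodFrac n μ t` (see `algebraMap_hallLittlewood`). -/
def hallLittlewood (n : ℕ) (μ : YoungDiagram) (t : ℝ) : MvPolynomial (Fin n) ℝ :=
  Function.invFun (algebraMap (MvPolynomial (Fin n) ℝ) (FractionRing (MvPolynomial (Fin n) ℝ)))
    (hallLittlewoodFrac n μ t)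

theorem X_sub_X_dvd_iff {n : ℕ} (i j : Fin n) (p : MvPolynomial (Fin n) ℝ) :
    (MvPolynomial.X i - MvPolynomial.X j) ∣ p ↔
      MvPolynomial.rename (fun k => if k = i then j else k) p = 0 := by
  constructor
  · rintro ⟨q, rfl⟩
    by_cases h : j = i <;> simp [h]
  · intro h
    rw [← Ideal.mem_span_singleton, ← Ideal.Quotient.eq_zero_iff_mem]
    set I := Ideal.span {(MvPolynomial.X i - MvPolynomial.X j : MvPolynomial (Fin n) ℝ)}
    have hh : (Ideal.Quotient.mkₐ ℝ I).comp
        (MvPolynomial.rename (fun k => if k = i then j else k)) = Ideal.Quotient.mkₐ ℝ I := by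
      apply MvPolynomial.algHom_ext
      intro k
      simp only [AlgHom.comp_apply, MvPolynomial.rename_X, Ideal.Quotient.mkₐ_eq_mk]
      split_ifs with hk
      · subst hk
        refine (Ideal.Quotient.eq.2 ?_).symm
        exact Ideal.mem_span_singleton_self _
      · rfl
    have := congrArg (fun f => f p) hh
    simp only [AlgHom.comp_apply, h, map_zero] at this
    exact this.symm

theorem prime_X_sub_X {n : ℕ} {i j : Fin n} (hij : i < j) :
    Prime (MvPolynomial.X i - MvPolynomial.X j : MvPolynomial (Fin n) ℝ) := by
  have h0 : (MvPolynomial.X i - MvPolynomial.X j : MvPolynomial (Fin n) ℝ) ≠ 0 := by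
    rw [sub_ne_zero]
    exact fun h => hij.ne (MvPolynomial.X_injective h)
  refine ⟨h0, ?_, ?_⟩
  · intro h
    have := (X_sub_X_dvd_iff i j 1).1 h.dvd
    simp at this
  · intro a b hab
    rw [X_sub_X_dvd_iff, map_mul, mul_eq_zero] at hab
    rwa [X_sub_X_dvd_iff, X_sub_X_dvd_iff]

theorem prod_X_sub_X_dvd {n : ℕ} (p : MvPolynomial (Fin n) ℝ)
    (hp : ∀ i j : Fin n, i < j → MvPolynomial.rename (Equiv.swap i j) p = -p) :
    (∏ i : Fin n, ∏ j ∈ Ioi i, (MvPolynomial.X i - MvPolynomial.X j)) ∣ p := by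
  rw [Finset.prod_sigma']
  apply Finset.prod_dvd_of_isRelPrime
  · rintro ⟨i, j⟩ hij ⟨k, l⟩ hkl hne
    simp only [coe_sigma, Set.mem_sigma_iff, mem_coe, mem_univ, mem_Ioi, true_and] at hij hkl
    refine ((prime_X_sub_X hij).irreducible.isRelPrime_iff_not_dvd).2 ?_
    rw [X_sub_X_dvd_iff]
    simp only [map_sub, MvPolynomial.rename_X, sub_eq_zero]
    intro h
    have := MvPolynomial.X_injective h

    split_ifs at this with h1 h2 h2
    · subst h1; subst h2; exact hkl.ne rfl
    · subst h1; subst this; exact hne rfl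
    · subst this; subst h2; exact absurd (hkl.trans hij) (lt_irrefl _)
    · exact hkl.ne this
  · rintro ⟨i, j⟩ hij
    simp only [mem_sigma, mem_univ, mem_Ioi, true_and] at hij
    rw [X_sub_X_dvd_iff]
    have h1 := congrArg (MvPolynomial.rename (fun k => if k = i then j else k)) (hp i j hij)
    rw [MvPolynomial.rename_rename, map_neg] at h1
    have h2 : (fun k => if k = i then j else k) ∘ (Equiv.swap i j) =
        (fun k => if k = i then j else k) := by
      funext k
      simp only [Function.comp, Equiv.swap_apply_def]
      split_ifs <;> simp_all
    rw [h2] at h1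
    exact self_eq_neg.mp h1

theorem prod_X_sub_X_perm {n : ℕ} (σ : Equiv.Perm (Fin n)) :
    (∏ i : Fin n, ∏ j ∈ Ioi i, (MvPolynomial.X (σ i) - MvPolynomial.X (σ j) :
      MvPolynomial (Fin n) ℝ)) = (Equiv.Perm.sign σ : ℤ) •
      ∏ i : Fin n, ∏ j ∈ Ioi i, (MvPolynomial.X i - MvPolynomial.X j) := by
  have h : ∀ v : Fin n → MvPolynomial (Fin n) ℝ, (∏ i : Fin n, ∏ j ∈ Ioi i, (v i - v j)) =
      (∏ i : Fin n, ∏ j ∈ Ioi i, (-1)) * (Matrix.vandermonde v).det := by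
    intro v
    rw [Matrix.det_vandermonde, ← Finset.prod_mul_distrib]
    refine Finset.prod_congr rfl fun i _ => ?_
    rw [← Finset.prod_mul_distrib]
    exact Finset.prod_congr rfl fun j _ => by ring
  rw [h (fun i => MvPolynomial.X (σ i)), h (fun i => MvPolynomial.X i)]
  have : Matrix.vandermonde (fun i => (MvPolynomial.X (σ i) : MvPolynomial (Fin n) ℝ)) =
      (Matrix.vandermonde (fun i => MvPolynomial.X i)).submatrix σ id := rfl
  rw [this, Matrix.det_permute, zsmul_eq_mul]
  ring

/-- The rational function defining `P_μ(x_1, …, x_n; t)` is indeed a polynomial. -/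
theorem algebraMap_hallLittlewood (n : ℕ) (μ : YoungDiagram) (t : ℝ) :
    algebraMap _ _ (hallLittlewood n μ t) = hallLittlewoodFrac n μ t := by
  refine Function.invFun_eq ?_
  set g : MvPolynomial (Fin n) ℝ := (∏ i : Fin n, MvPolynomial.X i ^ μ.rowLen i) *
      ∏ i : Fin n, ∏ j ∈ Ioi i, (MvPolynomial.X i - MvPolynomial.C t * MvPolynomial.X j) with hg
  set D : MvPolynomial (Fin n) ℝ :=
    ∏ i : Fin n, ∏ j ∈ Ioi i, (MvPolynomial.X i - MvPolynomial.X j) with hD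
  have hD0 : D ≠ 0 := by
    refine Finset.prod_ne_zero_iff.2 fun i _ => Finset.prod_ne_zero_iff.2 fun j hj => ?_
    exact (prime_X_sub_X (Finset.mem_Ioi.1 hj)).ne_zero
  set N : MvPolynomial (Fin n) ℝ :=
    ∑ σ : Equiv.Perm (Fin n), (Equiv.Perm.sign σ : ℤ) • MvPolynomial.rename σ g with hN
  obtain ⟨q, hq⟩ : D ∣ N := by
    apply prod_X_sub_X_dvd
    intro i j hij
    rw [hN, map_sum, ← Finset.sum_neg_distrib]
    refine Fintype.sum_equiv (Equiv.mulLeft (Equiv.swap i j)) _ _ fun σ => ?_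
    rw [map_zsmul, MvPolynomial.rename_rename]
    simp [Equiv.Perm.sign_swap hij.ne, Equiv.Perm.coe_mul]
  refine ⟨MvPolynomial.C (hallLittlewoodNorm n μ t)⁻¹ * q, ?_⟩
  rw [map_mul, hallLittlewoodFrac]
  congr 1
  have hinj := IsFractionRing.injective (MvPolynomial (Fin n) ℝ)
    (FractionRing (MvPolynomial (Fin n) ℝ))
  have hDK : algebraMap (MvPolynomial (Fin n) ℝ) (FractionRing (MvPolynomial (Fin n) ℝ)) D ≠ 0 :=
    fun h => hD0 (hinj (by rw [h, map_zero]))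
  have hqq : algebraMap (MvPolynomial (Fin n) ℝ) (FractionRing (MvPolynomial (Fin n) ℝ)) q =
      algebraMap _ _ N / algebraMap _ _ D := by
    rw [hq, map_mul, mul_div_cancel_left₀ _ hDK]
  rw [hqq, hN, map_sum, Finset.sum_div]
  refine Finset.sum_congr rfl fun σ _ => ?_
  have h1 := congrArg
    (algebraMap (MvPolynomial (Fin n) ℝ) (FractionRing (MvPolynomial (Fin n) ℝ)))
    (prod_X_sub_X_perm σ)
  rw [← hD] at h1
  simp only [Finset.prod_div_distrib]
  simp only [map_prod, map_sub, map_zsmul] at h1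
  rw [h1, hg]
  simp only [map_mul, map_prod, map_sub, map_pow, map_zsmul, MvPolynomial.rename_X,
    MvPolynomial.rename_C]
  rcases Int.units_eq_one_or (Equiv.Perm.sign σ) with h | h <;> simp [h, mul_div_assoc, neg_div, div_neg]

end

/-- `P_μ(a_1, a_2, …; t) = L`, that is, `lim_{n → ∞} P_μ(a_1, …, a_n; t)` exists and equals `L`
(with `a_{i+1} = a i`). -/
def HasHallLittlewoodValue (μ : YoungDiagram) (t : ℝ) (a : ℕ → ℝ) (L : ℝ) : Prop :=
  Filter.Tendsto (fun n : ℕ => MvPolynomial.eval (fun i : Fin n => a i) (hallLittlewood n μ t))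
    Filter.atTop (nhds L)

/-- The sequence `a_1, b_1, a_2, b_2, …` listing the variables of both sequences. -/
def interleave (a b : ℕ → ℝ) : ℕ → ℝ := fun k => if Even k then a (k / 2) else b (k / 2)

/-- The partition `ν² = (ν_1, ν_1, ν_2, ν_2, …)`. -/
def doubleRows (ν : YoungDiagram) : YoungDiagram where
  cells := (ν.cells ×ˢ Finset.range 2).image fun c => (2 * c.1.1 + c.2, c.1.2)
  isLowerSet := by
    rintro ⟨i, j⟩ ⟨k, l⟩ hle h
    simp only [Finset.coe_image, Set.mem_image, Finset.mem_coe, Finset.mem_product,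
      Finset.mem_range, YoungDiagram.mem_cells, Prod.exists, Prod.mk.injEq] at h ⊢
    obtain ⟨a, b, r, ⟨hab, hr⟩, rfl, rfl⟩ := h
    obtain ⟨h1, h2⟩ := Prod.mk_le_mk.1 hle
    exact ⟨k / 2, l, k % 2, ⟨ν.up_left_mem (by omega) h2 hab, by omega⟩, by omega, rfl⟩

theorem rowLen_doubleRows (ν : YoungDiagram) (i : ℕ) :
    (doubleRows ν).rowLen i = ν.rowLen (i / 2) := by
  refine eq_of_forall_lt_iff fun j => ?_
  rw [← YoungDiagram.mem_iff_lt_rowLen, ← YoungDiagram.mem_iff_lt_rowLen, ← YoungDiagram.mem_cells]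
  simp only [doubleRows, Finset.mem_image, Finset.mem_product, Finset.mem_range,
    YoungDiagram.mem_cells, Prod.exists, Prod.mk.injEq]
  constructor
  · rintro ⟨a, b, r, ⟨hab, hr⟩, rfl, rfl⟩
    rwa [show (2 * a + r) / 2 = a by omega]
  · intro h
    exact ⟨i / 2, j, i % 2, ⟨h, by omega⟩, by omega, rfl⟩

section

open Polynomial

theorem exists_pow_eq_one_add {F : Type*} [Field F] [ValuativeRel F] [TopologicalSpace F]
    [IsNonarchimedeanLocalField F] (m : ℕ) (x : 𝒪[F]) (hx : x ∈ 𝓂[F]) :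
    ∃ y : 𝒪[F], y ^ (m * Nat.card 𝓀[F] + 1) = 1 + x := by
  let _ := IsTopologicalAddGroup.rightUniformSpace F
  have _ := isUniformAddGroup_of_addCommGroup (G := F)
  have : HenselianRing 𝒪[F] 𝓂[F] := inferInstance
  set n := m * Nat.card 𝓀[F] + 1 with hn
  have h0 : (n : 𝓀[F]) = 1 := by
    have _ := Fintype.ofFinite 𝓀[F]
    rw [hn, Nat.card_eq_fintype_card]
    push_cast
    rw [FiniteField.cast_card_eq_zero]
    simp
  obtain ⟨y, hy, -⟩ := HenselianRing.is_henselian (I := 𝓂[F]) (X ^ n - C (1 + x))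
    (monic_X_pow_sub_C _ (by omega)) 1 (by simpa using hx) (by
      have : (Ideal.Quotient.mk 𝓂[F]) (n : 𝒪[F]) = 1 := by
        rw [map_natCast]; exact h0
      simp [derivative_X_pow, this])
  refine ⟨y, ?_⟩
  have := hy.eq_zero
  simp only [eval_sub, eval_pow, eval_X, eval_C] at this
  exact sub_eq_zero.mp this

theorem mem_integer_or_inv {F : Type*} [Field F] [ValuativeRel F] (z : F) :
    z ∈ 𝒪[F] ∨ z⁻¹ ∈ 𝒪[F] := by
  simp only [Valuation.mem_integer_iff, map_inv₀]
  rcases le_total (ValuativeRel.valuation F z) 1 with h | h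
  · exact Or.inl h
  · exact Or.inr (inv_le_one_of_one_le₀ h)

/-- Every field automorphism of a local field maps the ring of integers to itself. -/
theorem map_mem_integer {F : Type*} [Field F] [ValuativeRel F] [TopologicalSpace F]
    [IsNonarchimedeanLocalField F] (σ : F ≃+* F)
    {x : F} (hx : x ∈ 𝒪[F]) : σ x ∈ 𝒪[F] := by
  have key : ∀ x : 𝒪[F], x ∈ 𝓂[F] → σ (1 + x : 𝒪[F]) ∈ 𝒪[F] := by
    intro x hx
    by_contra hcon
    have hz : (σ (1 + x : 𝒪[F]))⁻¹ ∈ 𝒪[F] := (mem_integer_or_inv _).resolve_left hcon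
    have hs0 : σ (1 + x : 𝒪[F]) ≠ 0 := fun h => hcon (h ▸ zero_mem _)
    have hmem : ∀ m : ℕ, (⟨_, hz⟩ : 𝒪[F]) ∈ 𝓂[F] ^ m := by
      intro m
      obtain ⟨y, hy⟩ := exists_pow_eq_one_add m x hx
      set n := m * Nat.card 𝓀[F] + 1 with hn
      have hmn : m ≤ n := by
        have : 0 < Nat.card 𝓀[F] := Nat.card_pos
        nlinarith
      have hyn : (σ (y : F)) ^ n = σ (1 + x : 𝒪[F]) := by rw [← hy]; simp
      have hw : (σ (y : F)) ∉ 𝒪[F] := fun h => hcon (hyn ▸ pow_mem h n)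
      have hw' := (mem_integer_or_inv (σ (y : F))).resolve_left hw
      have hwm : (⟨_, hw'⟩ : 𝒪[F]) ∈ 𝓂[F] := by
        rw [IsLocalRing.mem_maximalIdeal, mem_nonunits_iff]
        intro hu
        obtain ⟨b, hb⟩ := hu.exists_right_inv
        apply hw
        have hb' : (σ (y : F))⁻¹ * (b : F) = 1 := congrArg Subtype.val hb
        have : (b : F) = σ (y : F) := by
          have h0 : σ (y : F) ≠ 0 := fun h => hw (h ▸ zero_mem _)
          field_simp at hb'
          exact hb'
        rw [← this]; exact b.2
      have : (⟨_, hz⟩ : 𝒪[F]) = (⟨_, hw'⟩ : 𝒪[F]) ^ n := by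
        apply Subtype.ext
        simp only [SubmonoidClass.mk_pow, inv_pow, hyn]
      rw [this]
      exact Ideal.pow_le_pow_right hmn (Ideal.pow_mem_pow hwm n)
    have h0 : (⟨_, hz⟩ : 𝒪[F]) = 0 := by
      have := Ideal.iInf_pow_eq_bot_of_isLocalRing 𝓂[F] (Ideal.IsPrime.ne_top inferInstance)
      rw [← Ideal.mem_bot, ← this]
      exact (Submodule.mem_iInf _).2 hmem
    exact inv_ne_zero hs0 (congrArg Subtype.val h0)
  have key2 : ∀ x : 𝒪[F], x ∈ 𝓂[F] → σ x ∈ 𝒪[F] := by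
    intro x hx
    have h := sub_mem (key x hx) (one_mem 𝒪[F])
    simpa using h
  obtain ⟨π, hπ⟩ := IsDiscreteValuationRing.exists_irreducible 𝒪[F]
  have hπm : π ∈ 𝓂[F] := (IsLocalRing.mem_maximalIdeal _).2 hπ.not_isUnit
  by_contra hcon
  have hz := (mem_integer_or_inv _).resolve_left hcon
  have hx0 : σ x ≠ 0 := fun h => hcon (h ▸ zero_mem _)
  have hzm : (⟨_, hz⟩ : 𝒪[F]) ∈ 𝓂[F] := by
    rw [IsLocalRing.mem_maximalIdeal, mem_nonunits_iff]
    intro hu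
    obtain ⟨b, hb⟩ := hu.exists_right_inv
    apply hcon
    have hb' : (σ x)⁻¹ * (b : F) = 1 := congrArg Subtype.val hb
    have : (b : F) = σ x := by field_simp at hb'; exact hb'
    rw [← this]; exact b.2
  have hp := key2 π hπm
  have hmem : ∀ m : ℕ, (⟨_, hp⟩ : 𝒪[F]) ∈ 𝓂[F] ^ m := by
    intro m
    have h1 := key2 (π * (⟨x, hx⟩ : 𝒪[F]) ^ m) (Ideal.mul_mem_right _ _ hπm)
    have : (⟨_, hp⟩ : 𝒪[F]) = (⟨_, hz⟩ : 𝒪[F]) ^ m * ⟨_, h1⟩ := by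
      apply Subtype.ext
      simp
      field_simp
    rw [this]
    exact Ideal.mul_mem_right _ _ (Ideal.pow_mem_pow hzm m)
  have h0 : (⟨_, hp⟩ : 𝒪[F]) = 0 := by
    have := Ideal.iInf_pow_eq_bot_of_isLocalRing 𝓂[F] (Ideal.IsPrime.ne_top inferInstance)
    rw [← Ideal.mem_bot, ← this]
    exact (Submodule.mem_iInf _).2 hmem
  have : σ (π : F) = 0 := congrArg Subtype.val h0
  exact hπ.ne_zero (Subtype.ext (by simpa using this))

end

/-- The standard `𝔬`-module `𝔬/𝔭^{μ_1} ⊕ ⋯ ⊕ 𝔬/𝔭^{μ_n}` of type `μ`. -/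
abbrev CyclicSum (F : Type*) [Field F] [ValuativeRel F] [TopologicalSpace F]
    [IsNonarchimedeanLocalField F] (μ : YoungDiagram) : Type _ :=
  ∀ i : Fin (μ.colLen 0), 𝒪[F] ⧸ 𝓂[F] ^ μ.rowLen i

/-- The module `(𝔬/𝔭^{μ_1})² ⊕ ⋯ ⊕ (𝔬/𝔭^{μ_n})²` underlying the standard alternating
`𝔬`-module of type `μ`. -/
abbrev DoubledCyclicSum (F : Type*) [Field F] [ValuativeRel F] [TopologicalSpace F]
    [IsNonarchimedeanLocalField F] (μ : YoungDiagram) : Type _ :=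
  ∀ i : Fin (μ.colLen 0), (𝒪[F] ⧸ 𝓂[F] ^ μ.rowLen i) × (𝒪[F] ⧸ 𝓂[F] ^ μ.rowLen i)

/-- The `𝔬`-module `F/𝔬`. -/
abbrev FieldModInt (F : Type*) [Field F] [ValuativeRel F] : Type _ :=
  F ⧸ (1 : Submodule 𝒪[F] F)

section

variable {F : Type*} [Field F] [ValuativeRel F] [TopologicalSpace F]
  [IsNonarchimedeanLocalField F]

/-- An `𝔬`-module (without pairing) has type `μ`. -/
def HasType (F : Type*) [Field F] [ValuativeRel F] [TopologicalSpace F]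
    [IsNonarchimedeanLocalField F] (M : Type*) [AddCommGroup M] [Module 𝒪[F] M]
    (μ : YoungDiagram) : Prop :=
  Nonempty (M ≃ₗ[𝒪[F]] CyclicSum F μ)

/-- The map `𝔬/𝔭^k → F/𝔬`, `a ↦ π^{-k} a`, for a uniformizer `π`. -/
def divPow {π : 𝒪[F]} (hπ : Irreducible π) (k : ℕ) :
    (𝒪[F] ⧸ 𝓂[F] ^ k) →ₗ[𝒪[F]] FieldModInt F :=
  Submodule.liftQ _
    ((1 : Submodule 𝒪[F] F).mkQ.comp (LinearMap.toSpanSingleton 𝒪[F] F ((π : F) ^ k)⁻¹)) (by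
      intro a ha
      rw [hπ.maximalIdeal_eq, Ideal.span_singleton_pow, Ideal.mem_span_singleton] at ha
      obtain ⟨b, rfl⟩ := ha
      rw [LinearMap.mem_ker, LinearMap.comp_apply, Submodule.mkQ_apply,
        Submodule.Quotient.mk_eq_zero, Submodule.mem_one]
      refine ⟨b, ?_⟩
      have hπ0 : (π : F) ≠ 0 := fun h => hπ.ne_zero (Subtype.ext h)
      change (b : F) = ((π ^ k * b : 𝒪[F]) : F) * ((π : F) ^ k)⁻¹
      push_cast
      field_simp)

/-- The standard alternating pairing: the orthogonal sum of the pairings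
`⟨(x_1, x_2), (y_1, y_2)⟩ = π^{-μ_i} (x_2 y_1 - x_1 y_2)`, that is, `⟨x, y⟩ = xᵀ A⁻¹ y` for the block
diagonal matrix `A` with blocks `(0, π^{μ_i}; -π^{μ_i}, 0)`. -/
def stdAlternating {π : 𝒪[F]} (hπ : Irreducible π) (μ : YoungDiagram)
    (x y : DoubledCyclicSum F μ) : FieldModInt F :=
  ∑ i : Fin (μ.colLen 0), divPow hπ (μ.rowLen i) ((x i).2 * (y i).1 - (x i).1 * (y i).2)

/-- The restriction to `𝔬` of an automorphism of `F`. -/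
def conjInt (σ : F ≃+* F) : 𝒪[F] →+* 𝒪[F] :=
  (σ : F →+* F).restrict 𝒪[F] 𝒪[F] fun _ hx => map_mem_integer σ hx

/-- The map induced on `F/𝔬` by an automorphism of `F`. -/
def conjFieldModInt (σ : F ≃+* F) : FieldModInt F →ₛₗ[conjInt σ] FieldModInt F :=
  Submodule.mapQ (1 : Submodule 𝒪[F] F) (1 : Submodule 𝒪[F] F)
    { toFun := σ
      map_add' := map_add σ
      map_smul' := fun a x => map_mul σ (a : F) x } (by
      intro x hx
      obtain ⟨a, rfl⟩ := Submodule.mem_one.1 hx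
      exact Submodule.mem_one.2 ⟨conjInt σ a, rfl⟩)

theorem conjInt_mem_maximalIdeal (σ : F ≃+* F) {x : 𝒪[F]} (hx : x ∈ 𝓂[F]) :
    conjInt σ x ∈ 𝓂[F] := by
  rw [IsLocalRing.mem_maximalIdeal, mem_nonunits_iff] at hx ⊢
  refine fun hu => hx ?_
  have h := hu.map (conjInt σ.symm)
  have h2 : conjInt σ.symm (conjInt σ x) = x := Subtype.ext (σ.symm_apply_apply (x : F))
  rwa [h2] at h

/-- The map induced on `𝔬/𝔭^k` by an automorphism of `F`. -/
def conjQuot (σ : F ≃+* F) (k : ℕ) : (𝒪[F] ⧸ 𝓂[F] ^ k) →+* (𝒪[F] ⧸ 𝓂[F] ^ k) :=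
  Ideal.quotientMap (𝓂[F] ^ k) (conjInt σ) (by
    rw [← Ideal.map_le_iff_le_comap, Ideal.map_pow]
    refine Ideal.pow_right_mono (Ideal.map_le_iff_le_comap.2 fun x hx => ?_) k
    exact conjInt_mem_maximalIdeal σ hx)

/-- The standard Hermitian pairing `⟨x, y⟩ = ∑_i π^{-μ_i} x_i^* y_i`, where `x^* = σ x`. -/
def stdHermitian {π : 𝒪[F]} (hπ : Irreducible π) (σ : F ≃+* F) (μ : YoungDiagram)
    (x y : CyclicSum F μ) : FieldModInt F :=
  ∑ i : Fin (μ.colLen 0), divPow hπ (μ.rowLen i) (conjQuot σ (μ.rowLen i) (x i) * y i)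

/-- `M` with the `𝔬`-bilinear pairing `B` is an alternating `𝔬`-module: `B` is alternating and
perfect. -/
def IsAlternatingModule {M : Type*} [AddCommGroup M] [Module 𝒪[F] M]
    (B : M →ₗ[𝒪[F]] M →ₗ[𝒪[F]] FieldModInt F) : Prop :=
  (∀ x, B x x = 0) ∧ Function.Bijective B

/-- `M` with the sesquilinear pairing `B` is a Hermitian `𝔬`-module: `⟨y, x⟩ = ⟨x, y⟩^*` and the
pairing is perfect. -/
def IsHermitianModule (σ : F ≃+* F) {M : Type*} [AddCommGroup M] [Module 𝒪[F] M]
    (B : M →ₛₗ[conjInt σ] M →ₗ[𝒪[F]] FieldModInt F) : Prop :=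
  (∀ x y, B y x = conjFieldModInt σ (B x y)) ∧ Function.Bijective B

/-- An alternating `𝔬`-module has type `μ`: it is isometric to the standard one. -/
def HasAlternatingType {π : 𝒪[F]} (hπ : Irreducible π) {M : Type*} [AddCommGroup M]
    [Module 𝒪[F] M] (B : M →ₗ[𝒪[F]] M →ₗ[𝒪[F]] FieldModInt F) (μ : YoungDiagram) : Prop :=
  ∃ e : M ≃ₗ[𝒪[F]] DoubledCyclicSum F μ, ∀ x y, B x y = stdAlternating hπ μ (e x) (e y)

/-- A Hermitian `𝔬`-module has type `μ`: it is isometric to the standard one. -/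
def HasHermitianType {π : 𝒪[F]} (hπ : Irreducible π) (σ : F ≃+* F) {M : Type*} [AddCommGroup M]
    [Module 𝒪[F] M] (B : M →ₛₗ[conjInt σ] M →ₗ[𝒪[F]] FieldModInt F) (μ : YoungDiagram) : Prop :=
  ∃ e : M ≃ₗ[𝒪[F]] CyclicSum F μ, ∀ x y, B x y = stdHermitian hπ σ μ (e x) (e y)

/-- The Cohen-Lenstra `u`-probability
`P(u; μ) = q^{-u|μ|} / #Aut(M_μ) · ∏_{j ≥ 1} (1 - q^{-u-j})`, where
`q` is the order of the residue field. -/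
def cohenLenstraProb (F : Type*) [Field F] [ValuativeRel F] [TopologicalSpace F]
    [IsNonarchimedeanLocalField F] (u : ℝ) (μ : YoungDiagram) : ℝ :=
  (Nat.card 𝓀[F] : ℝ) ^ (-u * μ.card) / Nat.card (CyclicSum F μ ≃ₗ[𝒪[F]] CyclicSum F μ) *
    ∏' j : ℕ, (1 - (Nat.card 𝓀[F] : ℝ) ^ (-u - (j + 1)))

/-- Delaunay's alternating `u`-probability
`P^alt(u; μ) = q^{-2u|μ|} #M_μ / #Aut^A(M_μ) · ∏_{j ≥ 1} (1 - q^{-2u-2j+1})`, where `Aut^A(M_μ)` is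
the group of automorphisms preserving the pairing and `q` the order of the residue field. -/
def alternatingProb {π : 𝒪[F]} (hπ : Irreducible π) (u : ℝ) (μ : YoungDiagram) : ℝ :=
  (Nat.card 𝓀[F] : ℝ) ^ (-2 * u * μ.card) * Nat.card (DoubledCyclicSum F μ) /
      Nat.card {e : DoubledCyclicSum F μ ≃ₗ[𝒪[F]] DoubledCyclicSum F μ //
        ∀ x y, stdAlternating hπ μ (e x) (e y) = stdAlternating hπ μ x y} *
    ∏' j : ℕ, (1 - (Nat.card 𝓀[F] : ℝ) ^ (-2 * u - 2 * (j + 1) + 1))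

/-- The Hermitian `u`-probability
`P^her(u; μ) = q^{-u|μ|} / #Aut^H(M_μ) · ∏_{j ≥ 1} (1 - (-1)^{j-1} q^{-u-j})`, where `Aut^H(M_μ)` is
the group of automorphisms preserving the pairing. Here `q²` is the order of the residue field
of `F`. -/
def hermitianProb {π : 𝒪[F]} (hπ : Irreducible π) (σ : F ≃+* F) (q : ℕ) (u : ℝ)
    (μ : YoungDiagram) : ℝ :=
  (q : ℝ) ^ (-u * μ.card) /
      Nat.card {e : CyclicSum F μ ≃ₗ[𝒪[F]] CyclicSum F μ //
        ∀ x y, stdHermitian hπ σ μ (e x) (e y) = stdHermitian hπ σ μ x y} *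
    ∏' j : ℕ, (1 - (-1) ^ j * (q : ℝ) ^ (-u - (j + 1)))

end

end

/-! ### q-series: Gaussian binomials and the summation over a single column. -/

section QSeries

open Finset

/-! All three cases are instances of one identity with parameters `s`, `t = 1/s`, `z`, `κ`. These
are `(q, q⁻¹, q^{-u}, 1)` without pairing, `(q², q⁻², q^{1-2u}, q)` for alternating modules and
`(-q, -q⁻¹, -q^{-u}, -1)` for Hermitian ones. Write `μ'` for the column lengths of `μ`. In each case
the relevant automorphism group has order `κ^{|μ|} ∏_j s^{μ'_j²} (t;t)_{μ'_j - μ'_{j+1}}`, and the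
number of homomorphisms to `M_ν` is `s^{∑ μ'_j c_j}`. Here `c` is the sequence of column lengths of
`ν`, or of `ν²` in the Hermitian case, where `q² = s²` doubles the exponents. The moment is
therefore `∏_{j≥1} (1 - z t^j)` times the sum of `youngWeight` over all diagrams.

This sum is computed one column at a time. Summation over a column maps the functions `b ↦ 1 /
((t;t)_{b-k} (zt;t)_b)` to combinations of functions of the same kind, with matrix `z^j * colCoeff`
(`sum_column_basic`, a q-Vandermonde identity plus Pascal's rule). Iterating gives `∑_j z^j *
columnCoeff_j` (`hasSum_youngWeight`); for `c = 0` this is `1`, the total mass.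

On the other side, put the variables `1, t, …, t^{n-1}, z, zt, …, z t^{m-1}` into the
Hall-Littlewood polynomial. The factors `x_i - t x_j` kill every ordering that is not a shuffle of
the two chains, so the symmetrized sum satisfies a two-term recursion. The functions `stepBasis` of
`(n, m)` are adapted to it: adding a part `0` multiplies all of them by one common scalar
(`stepBasis_step`), and adding a full column acts by the same coefficients `colCoeff`
(`stepBasis_column`). Hence the value is a constant times `∑_j columnCoeff_j * stepBasis_j`
(`orderSum_geomSet`). As `n, m → ∞`, `stepBasis_j → z^j`; for `m = 0` only `j = 0` survives, with
coefficient `1`. So the quotient of the two limits is `∑_j z^j * columnCoeff_j`, which is the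
moment.

The group orders come from splitting off a summand of maximal exponent: a cyclic module, a
hyperbolic plane or a Hermitian line. The group of the whole module is counted by the split
embeddings of this summand times the group of its complement, whose isomorphism type is forced. The
recursion is solved by `youngDiagram_product_of_recursion`. -/

/-- The shifted factorial `∏_{k < n} (1 - z t^{k+1})`. -/
def qPoch (z t : ℝ) (n : ℕ) : ℝ := ∏ k ∈ range n, (1 - z * t ^ (k + 1))

/-- The Gaussian binomial coefficient in base `s`. -/
def gaussBinom (s : ℝ) : ℕ → ℕ → ℝ
  | _, 0 => 1
  | 0, _ + 1 => 0
  | n + 1, k + 1 => gaussBinom s n k + s ^ (k + 1) * gaussBinom s n (k + 1)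

@[simp] theorem gaussBinom_zero_right (s : ℝ) (n : ℕ) : gaussBinom s n 0 = 1 := by
  cases n <;> rfl

@[simp] theorem gaussBinom_zero_succ (s : ℝ) (k : ℕ) : gaussBinom s 0 (k + 1) = 0 := rfl

theorem gaussBinom_succ_succ (s : ℝ) (n k : ℕ) :
    gaussBinom s (n + 1) (k + 1) = gaussBinom s n k + s ^ (k + 1) * gaussBinom s n (k + 1) := rfl

theorem gaussBinom_eq_zero (s : ℝ) {n k : ℕ} (h : n < k) : gaussBinom s n k = 0 := by
  induction n generalizing k with
  | zero => obtain ⟨k, rfl⟩ := Nat.exists_eq_succ_of_ne_zero h.ne'; rfl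
  | succ n ih =>
    obtain ⟨k, rfl⟩ := Nat.exists_eq_succ_of_ne_zero (Nat.ne_of_gt (Nat.zero_lt_of_lt h))
    rw [Nat.succ_eq_add_one, gaussBinom_succ_succ, ih (by omega), ih (by omega)]; simp

/-- The second Pascal rule follows from the defining one by induction. The truncated exponent `n -
k` does no harm, because the binomial next to it vanishes when `n < k`. -/
theorem gaussBinom_succ_succ' (s : ℝ) (n k : ℕ) :
    gaussBinom s (n + 1) (k + 1) = gaussBinom s n (k + 1) + s ^ (n - k) * gaussBinom s n k := by
  induction n generalizing k with
  | zero => cases k <;> simp [gaussBinom_succ_succ]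
  | succ n ih =>
    cases k with
    | zero =>
      have h0 := ih 0
      have h1 := gaussBinom_succ_succ s n 0
      have h2 := gaussBinom_succ_succ s (n + 1) 0
      simp only [zero_add, gaussBinom_zero_right, Nat.sub_zero] at h0 h1 h2 ⊢
      linear_combination h2 - h1 + s * h0
    | succ k =>
      have h0 := ih k
      have h1 := ih (k + 1)
      have h2 := gaussBinom_succ_succ s n k
      have h3 := gaussBinom_succ_succ s n (k + 1)
      have h4 := gaussBinom_succ_succ s (n + 1) (k + 1)
      have h5 : s ^ (n - k) * s ^ (k + 1) * gaussBinom s n (k + 1) =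
          s ^ (k + 1 + 1) * s ^ (n - (k + 1)) * gaussBinom s n (k + 1) := by
        rcases le_or_gt n k with h | h
        · rw [gaussBinom_eq_zero s (show n < k + 1 by omega), mul_zero, mul_zero]
        · rw [← pow_add, ← pow_add]
          congr 2
          omega
      rw [show n + 1 - (k + 1) = n - k by omega]
      linear_combination h4 + h0 + s ^ (k + 1 + 1) * h1 - h3 - s ^ (n - k) * h2 - h5

/-- Cauchy's expansion of a power in Newton's basis `∏_{r < j} (v - s^r)`. -/
theorem sum_gaussBinom_mul_prod_sub (s v : ℝ) (b : ℕ) :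
    ∑ j ∈ range (b + 1), gaussBinom s b j * ∏ r ∈ range j, (v - s ^ r) = v ^ b := by
  induction b with
  | zero => simp
  | succ b ih =>
    rw [sum_range_succ', prod_range_zero, gaussBinom_zero_right, mul_one]
    -- Pascal's rule and the splitting of the last factor into `v` and `-s^j` give `v` times the sum
    -- for `b`; the other two terms telescope.
    have h1 : ∀ j, gaussBinom s (b + 1) (j + 1) * ∏ r ∈ range (j + 1), (v - s ^ r) =
        gaussBinom s b j * (∏ r ∈ range j, (v - s ^ r)) * v
        - s ^ j * gaussBinom s b j * (∏ r ∈ range j, (v - s ^ r))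
        + s ^ (j + 1) * gaussBinom s b (j + 1) * (∏ r ∈ range (j + 1), (v - s ^ r)) := by
      intro j
      rw [gaussBinom_succ_succ, prod_range_succ]; ring
    simp only [h1, sum_add_distrib, sum_sub_distrib, ← sum_mul]
    rw [ih]
    have h2 := sum_range_succ'
      (fun j => s ^ j * gaussBinom s b j * ∏ r ∈ range j, (v - s ^ r)) (b + 1)
    rw [sum_range_succ, gaussBinom_eq_zero s (Nat.lt_succ_self b)] at h2
    simp only [pow_zero, prod_range_zero, gaussBinom_zero_right] at h2
    linear_combination -h2

/-- The factorial formula in base `s`, with `s^{n-r}` written as `s^n t^r`. In this form no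
subtraction of naturals occurs, and the right-hand side vanishes by itself when `i > n`, through its
factor `r = n`. -/
theorem gaussBinom_mul_prod {s t : ℝ} (hst : s * t = 1) (n i : ℕ) :
    gaussBinom s n i * ∏ r ∈ range i, (s ^ (r + 1) - 1) = ∏ r ∈ range i, (s ^ n * t ^ r - 1) := by
  induction n generalizing i with
  | zero =>
    cases i with
    | zero => simp
    | succ i => rw [prod_range_succ']; simp [prod_range_succ' _ i]
  | succ n ih =>
    cases i with
    | zero => simp
    | succ i =>
      have e1 : ∏ r ∈ range (i + 1), (s ^ (n + 1) * t ^ r - 1) =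
          (∏ r ∈ range i, (s ^ n * t ^ r - 1)) * (s ^ (n + 1) - 1) := by
        rw [prod_range_succ', pow_zero, mul_one]
        congr 1
        refine prod_congr rfl fun r _ => ?_
        rw [pow_succ, pow_succ]
        linear_combination s ^ n * t ^ r * hst
      have h1 := ih i
      have h2 := ih (i + 1)
      rw [prod_range_succ _ i, prod_range_succ _ i] at h2
      rw [e1, gaussBinom_succ_succ, prod_range_succ _ i]
      have hp : s ^ i * t ^ i = 1 := by rw [← mul_pow, hst, one_pow]
      linear_combination (s ^ (i + 1) - 1) * h1 + s ^ (i + 1) * h2 +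
        (∏ r ∈ range i, (s ^ n * t ^ r - 1)) * s ^ (n + 1) * hp

theorem qPoch_succ (z t : ℝ) (n : ℕ) : qPoch z t (n + 1) = qPoch z t n * (1 - z * t ^ (n + 1)) :=
  prod_range_succ _ _

theorem qPoch_succ' (z t : ℝ) (n : ℕ) :
    qPoch z t (n + 1) = (1 - z * t) * qPoch (z * t) t n := by
  rw [qPoch, prod_range_succ', qPoch, mul_comm]
  congr 1
  · ring
  · exact prod_congr rfl fun k _ => by ring

theorem qPoch_add (z t : ℝ) (k n : ℕ) :
    qPoch z t (k + n) = qPoch z t k * qPoch (z * t ^ k) t n := by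
  rw [qPoch, prod_range_add, qPoch, qPoch]
  congr 1
  exact prod_congr rfl fun k _ => by ring

@[simp] theorem qPoch_zero (z t : ℝ) : qPoch z t 0 = 1 := prod_range_zero _

theorem one_sub_mul_pow_pos {z t : ℝ} (ht : |t| < 1) (hz : |z * t| < 1) (k : ℕ) :
    0 < 1 - z * t ^ (k + 1) := by
  have : |z * t ^ (k + 1)| < 1 := by
    rw [pow_succ', ← mul_assoc, abs_mul, abs_pow]
    exact mul_lt_one_of_nonneg_of_lt_one_left (abs_nonneg _) hz
      (pow_le_one₀ (abs_nonneg _) ht.le)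
  linarith [(abs_lt.1 this).2]

theorem qPoch_pos {z t : ℝ} (ht : |t| < 1) (hz : |z * t| < 1) (n : ℕ) : 0 < qPoch z t n :=
  prod_pos fun k _ => one_sub_mul_pow_pos ht hz k

theorem abs_mul_pow_mul_lt {z t : ℝ} (ht : |t| < 1) (hz : |z * t| < 1) (k : ℕ) :
    |z * t ^ k * t| < 1 := by
  rw [mul_right_comm, abs_mul, abs_pow]
  exact mul_lt_one_of_nonneg_of_lt_one_left (abs_nonneg _) hz (pow_le_one₀ (abs_nonneg _) ht.le)

theorem gaussBinom_mul_qPoch (t : ℝ) (a b : ℕ) :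
    gaussBinom t (a + b) a * (qPoch 1 t a * qPoch 1 t b) = qPoch 1 t (a + b) := by
  induction h : a + b generalizing a b with
  | zero => obtain ⟨rfl, rfl⟩ : a = 0 ∧ b = 0 := by omega
            simp
  | succ n ih =>
    cases a with
    | zero => obtain rfl : b = n + 1 := by omega
              simp
    | succ a =>
      rw [gaussBinom_succ_succ]
      cases b with
      | zero =>
        obtain rfl : a = n := by omega
        have := ih a 0 rfl
        rw [gaussBinom_eq_zero t (Nat.lt_succ_self a)]
        rw [qPoch_succ]
        linear_combination (1 - 1 * t ^ (a + 1)) * this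
      | succ b =>
        have h1 := ih a (b + 1) (by omega)
        have h2 := ih (a + 1) b (by omega)
        obtain rfl : n = a + b + 1 := by omega
        rw [qPoch_succ _ _ (a + b + 1)]
        rw [qPoch_succ 1 t a] at *
        rw [qPoch_succ 1 t b] at *
        linear_combination (1 - 1 * t ^ (a + 1)) * h1 + t ^ (a + 1) * (1 - 1 * t ^ (b + 1)) * h2

/-- A `q`-Vandermonde identity. -/
theorem sum_gaussBinom_div_qPoch {z t : ℝ} (ht : |t| < 1) (hz : |z * t| < 1) (a : ℕ) :
    ∑ c ∈ range (a + 1), gaussBinom t a c * (z ^ c * t ^ (c ^ 2)) / qPoch z t c =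
      1 / qPoch z t a := by
  induction a generalizing z with
  | zero => simp
  | succ a ih =>
    have hz' : |z * t * t| < 1 := by simpa using abs_mul_pow_mul_lt ht hz 1
    have hd : (1 - z * t) ≠ 0 := by simpa using (one_sub_mul_pow_pos ht hz 0).ne'
    -- Pascal's rule splits every term for `a + 1` in two. Regrouped, the two halves carrying the
    -- same binomial add up to a term of the sum for `a` with `zt` in place of `z`, divided by `1 -
    -- zt`.
    have e : ∀ c ∈ range (a + 1),
        gaussBinom t a c * ((z * t) ^ c * t ^ (c ^ 2)) / qPoch z t c +
        gaussBinom t a c * (z ^ (c + 1) * t ^ ((c + 1) ^ 2)) / qPoch z t (c + 1) =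
        (gaussBinom t a c * ((z * t) ^ c * t ^ (c ^ 2)) / qPoch (z * t) t c) / (1 - z * t) := by
      intro c _
      have h1 := (qPoch_pos ht hz c).ne'
      have h2 := (qPoch_pos ht hz (c + 1)).ne'
      have h3 := (qPoch_pos ht hz' c).ne'
      have h4 := qPoch_succ z t c
      have h5 := qPoch_succ' z t c
      have h6 : 1 / qPoch z t c = (1 - z * t ^ (c + 1)) / qPoch z t (c + 1) := by
        rw [h4, div_eq_div_iff h1 (h4 ▸ h2)]; ring
      rw [div_div, mul_comm (qPoch (z * t) t c), ← h5, div_eq_mul_one_div _ (qPoch z t c), h6]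
      field_simp
      ring
    rw [sum_range_succ']
    simp only [gaussBinom_succ_succ, gaussBinom_zero_right]
    have h1 : ∀ c, (gaussBinom t a c + t ^ (c + 1) * gaussBinom t a (c + 1)) *
        (z ^ (c + 1) * t ^ ((c + 1) ^ 2)) / qPoch z t (c + 1) =
        gaussBinom t a c * (z ^ (c + 1) * t ^ ((c + 1) ^ 2)) / qPoch z t (c + 1) +
        gaussBinom t a (c + 1) * ((z * t) ^ (c + 1) * t ^ ((c + 1) ^ 2)) / qPoch z t (c + 1) := by
      intro c; rw [← add_div]; congr 1; ring
    simp only [h1, sum_add_distrib]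
    have h2 := sum_range_succ'
      (fun c => gaussBinom t a c * ((z * t) ^ c * t ^ (c ^ 2)) / qPoch z t c) (a + 1)
    rw [sum_range_succ, gaussBinom_eq_zero t (Nat.lt_succ_self a)] at h2
    simp only [gaussBinom_zero_right] at h2
    have h3 := sum_congr rfl e
    rw [sum_add_distrib, ← sum_div, ih hz', div_div, mul_comm (qPoch _ _ _), ← qPoch_succ'] at h3
    rw [← h3]
    simp only [pow_zero, zero_pow two_ne_zero, qPoch_zero] at h2 ⊢
    linear_combination -h2

/-- `1 / ∏_{i ≤ a - k} (1 - t^i)`, and zero for `a < k`. -/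
noncomputable def invPoch (t : ℝ) (a k : ℕ) : ℝ := if k ≤ a then 1 / qPoch 1 t (a - k) else 0

theorem invPoch_of_lt (t : ℝ) {a k : ℕ} (h : a < k) : invPoch t a k = 0 := if_neg (by omega)

theorem invPoch_add (t : ℝ) (a k : ℕ) : invPoch t (k + a) k = 1 / qPoch 1 t a := by
  rw [invPoch, if_pos (by omega), Nat.add_sub_cancel_left]

theorem invPoch_self (t : ℝ) (k : ℕ) : invPoch t k k = 1 := by
  simp [invPoch]

/-- The factor `1 - t^{b-k}` cancels the last factor of `(t;t)_{b-k}`. A power of `t^b` is thus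
traded for a shift of `k`, which drives the induction in `sum_column_basic`. -/
theorem pow_mul_invPoch {t : ℝ} (ht : |t| < 1) (b k : ℕ) :
    t ^ b * invPoch t b k = t ^ k * (invPoch t b k - invPoch t b (k + 1)) := by
  rcases lt_trichotomy b k with h | rfl | h
  · rw [invPoch_of_lt t h, invPoch_of_lt t (show b < k + 1 by omega)]; ring
  · rw [invPoch_of_lt t (Nat.lt_succ_self b), sub_zero]
  · obtain ⟨d, rfl⟩ := Nat.exists_eq_add_of_lt h
    have h1 : |(1 : ℝ) * t| < 1 := by simpa using ht
    have h2 := (qPoch_pos ht h1 d).ne'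
    have h3 := (qPoch_pos ht h1 (d + 1)).ne'
    rw [add_assoc, invPoch_add, show k + (d + 1) = k + 1 + d by ring, invPoch_add]
    have := qPoch_succ 1 t d
    field_simp
    rw [this]
    ring

/-- The coefficient `[m-k choose j-k]_s s^{k(m-j)}`, and zero for `j < k`. -/
def colCoeff (s : ℝ) (m k j : ℕ) : ℝ :=
  if k ≤ j then gaussBinom s (m - k) (j - k) * s ^ (k * (m - j)) else 0

theorem colCoeff_of_lt (s : ℝ) {m k j : ℕ} (h : j < k) : colCoeff s m k j = 0 :=
  if_neg (by omega)

theorem colCoeff_self (s : ℝ) (m j : ℕ) : colCoeff s m m j = if j = m then 1 else 0 := by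
  unfold colCoeff
  rcases lt_trichotomy j m with h | rfl | h
  · rw [if_neg (by omega), if_neg (by omega)]
  · simp
  · rw [if_pos h.le, if_neg (by omega), gaussBinom_eq_zero s (by omega), zero_mul]

theorem colCoeff_eq_zero (s : ℝ) {m k j : ℕ} (hk : k ≤ m) (h : m < j) : colCoeff s m k j = 0 := by
  rw [colCoeff, if_pos (by omega), gaussBinom_eq_zero s (by omega), zero_mul]

/-- This is the second Pascal rule for `[m+1-k choose j-k]` with the powers of `s` absorbed. It has
exactly the shape of the recursion for the column sums. -/
theorem colCoeff_succ (s : ℝ) {m k : ℕ} (hk : k ≤ m) (j : ℕ) :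
    colCoeff s (m + 1) k j = s ^ k * colCoeff s m k j + colCoeff s (m + 1) (k + 1) j := by
  rcases lt_trichotomy j k with h | rfl | h
  · rw [colCoeff_of_lt s h, colCoeff_of_lt s h, colCoeff_of_lt s (show j < k + 1 by omega)]; simp
  · rw [colCoeff_of_lt s (Nat.lt_succ_self j), colCoeff, colCoeff, if_pos le_rfl, if_pos le_rfl,
      show j * (m + 1 - j) = j + j * (m - j) by rw [Nat.succ_sub hk, Nat.mul_succ, add_comm]]
    simp [pow_add]
  · obtain ⟨i, rfl⟩ := Nat.exists_eq_add_of_lt h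
    obtain ⟨n, rfl⟩ := Nat.exists_eq_add_of_le hk
    rw [colCoeff, colCoeff, colCoeff, if_pos (by omega), if_pos (by omega), if_pos (by omega)]
    rw [show k + n + 1 - k = n + 1 by omega, show k + i + 1 - k = i + 1 by omega,
      show k + n - k = n by omega, show k + n + 1 - (k + 1) = n by omega,
      show k + i + 1 - (k + 1) = i by omega, show k + n + 1 - (k + i + 1) = n - i by omega,
      gaussBinom_succ_succ', show k + n - (k + i + 1) = n - (i + 1) by omega]
    rcases le_or_gt n i with h' | h'
    · rw [gaussBinom_eq_zero s (show n < i + 1 by omega), Nat.sub_eq_zero_of_le h']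
      simp
    · obtain ⟨d, rfl⟩ := Nat.exists_eq_add_of_lt h'
      rw [show i + d + 1 - i = d + 1 by omega, show i + d + 1 - (i + 1) = d by omega]
      ring

theorem colCoeff_eq_one (s : ℝ) (m : ℕ) : colCoeff s m 0 0 = 1 := by simp [colCoeff]

/-- The effect of summing over the first column on the basic tail functions. -/
theorem sum_column_basic {z t s : ℝ} (hst : s * t = 1) (ht : |t| < 1) (hz : |z * t| < 1)
    (a : ℕ) {k m : ℕ} (hk : k ≤ m) :
    ∑ b ∈ range (a + 1), z ^ b * t ^ (b ^ 2) * s ^ (b * m) * invPoch t a b *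
        (invPoch t b k / qPoch z t b) =
      ∑ j ∈ range (m + 1), z ^ j * colCoeff s m k j * (invPoch t a j / qPoch z t a) := by
  obtain ⟨d, rfl⟩ := Nat.exists_eq_add_of_le hk
  induction d generalizing k with
  | zero =>
    simp only [Nat.add_zero, colCoeff_self]
    have e0 : ∑ j ∈ range (k + 1), z ^ j * (if j = k then 1 else 0) *
        (invPoch t a j / qPoch z t a) = z ^ k * (invPoch t a k / qPoch z t a) := by
      rw [sum_eq_single k (fun j _ hj => by simp [hj])
        (fun h => absurd (mem_range.2 (by omega)) h)]
      simp
    rw [e0]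
    rcases lt_or_ge a k with h | h
    · rw [invPoch_of_lt t h, zero_div, mul_zero]
      exact sum_eq_zero fun b hb => by
        rw [invPoch_of_lt t (show b < k by have := mem_range.1 hb; omega), zero_div, mul_zero]
    · obtain ⟨a, rfl⟩ := Nat.exists_eq_add_of_le h
      have hz' := abs_mul_pow_mul_lt ht hz k
      have h1 : |(1 : ℝ) * t| < 1 := by simpa using ht
      rw [show k + a + 1 = k + (a + 1) by ring, sum_range_add, sum_eq_zero, zero_add]
      · have h3 := (qPoch_pos ht hz' a).ne'
        have h4 := (qPoch_pos ht hz k).ne'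
        have h5 := (qPoch_pos ht h1 a).ne'
        -- For `m = k`, put `b = k + c`: the factor `s^{bk}` reduces `t^{b²}` to `t^{kc} t^{c²}`,
        -- and what remains is the q-Vandermonde sum with `z t^k` in place of `z`.
        have := sum_gaussBinom_div_qPoch ht hz' a
        rw [invPoch_add, qPoch_add]
        have e : z ^ k * (1 / qPoch 1 t a / (qPoch z t k * qPoch (z * t ^ k) t a)) =
            z ^ k / (qPoch 1 t a * qPoch z t k) * (1 / qPoch (z * t ^ k) t a) := by
          field_simp
        rw [e, ← this, mul_sum]
        refine sum_congr rfl fun c hc => ?_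
        obtain ⟨d, rfl⟩ := Nat.exists_eq_add_of_le (Nat.lt_succ_iff.1 (mem_range.1 hc))
        rw [← add_assoc, invPoch_add, invPoch_add, qPoch_add]
        have h6 := (qPoch_pos ht h1 d).ne'
        have h7 := (qPoch_pos ht h1 c).ne'
        have h8 := (qPoch_pos ht hz' c).ne'
        have h9 := gaussBinom_mul_qPoch t c d
        have h10 : t ^ ((k + c) ^ 2) * s ^ ((k + c) * k) = t ^ (k * c) * t ^ (c ^ 2) := by
          have : t ^ ((k + c) ^ 2) = t ^ ((k + c) * k) * (t ^ (k * c) * t ^ (c ^ 2)) := by ring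
          rw [this]
          have h11 : s ^ ((k + c) * k) * t ^ ((k + c) * k) = 1 := by
            rw [← mul_pow, hst, one_pow]
          linear_combination t ^ (k * c) * t ^ (c ^ 2) * h11
        rw [mul_assoc (z ^ (k + c)), h10, ← h9]
        have h12 : gaussBinom t (c + d) c ≠ 0 := by
          intro h0; rw [h0, zero_mul] at h9; exact h5 h9.symm
        field_simp
        ring
      · intro b hb
        rw [invPoch_of_lt t (mem_range.1 hb), zero_div, mul_zero]
  | succ d ih =>
    have i1 := ih (k := k) (by omega)
    have i2 := ih (k := k + 1) (by omega)
    rw [show k + 1 + d = k + (d + 1) by ring] at i2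
    have hs : s ^ k * t ^ k = 1 := by rw [← mul_pow, hst, one_pow]
    -- Raising `m` by one inserts `s^b`. By `pow_mul_invPoch` the sum for `(k, m+1)` is `s^k` times
    -- the sum for `(k, m)` plus the sum for `(k+1, m+1)`, and both of these have smaller `m - k`.
    have e1 : ∀ b ∈ range (a + 1), z ^ b * t ^ (b ^ 2) * s ^ (b * (k + (d + 1))) * invPoch t a b *
        (invPoch t b k / qPoch z t b) =
        s ^ k * (z ^ b * t ^ (b ^ 2) * s ^ (b * (k + d)) * invPoch t a b *
        (invPoch t b k / qPoch z t b)) +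
        z ^ b * t ^ (b ^ 2) * s ^ (b * (k + (d + 1))) * invPoch t a b *
        (invPoch t b (k + 1) / qPoch z t b) := by
      intro b _
      have h1 := pow_mul_invPoch ht b k
      have hb : s ^ b * t ^ b = 1 := by rw [← mul_pow, hst, one_pow]
      have h2 : s ^ (b * (k + (d + 1))) = s ^ (b * (k + d)) * s ^ b := by ring
      have h3 : s ^ k * invPoch t b k =
          s ^ b * (invPoch t b k - invPoch t b (k + 1)) := by
        linear_combination (-s ^ k * invPoch t b k) * hb + s ^ k * s ^ b * h1 +
          (s ^ b * (invPoch t b k - invPoch t b (k + 1))) * hs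
      rw [h2]
      linear_combination (-(z ^ b * t ^ (b ^ 2) * s ^ (b * (k + d)) * invPoch t a b) /
        qPoch z t b) * h3
    rw [sum_congr rfl e1, sum_add_distrib, ← mul_sum, i1, i2]
    have e2 : ∑ j ∈ range (k + d + 1), z ^ j * colCoeff s (k + d) k j *
        (invPoch t a j / qPoch z t a) = ∑ j ∈ range (k + (d + 1) + 1),
        z ^ j * colCoeff s (k + d) k j * (invPoch t a j / qPoch z t a) := by
      rw [← add_assoc, sum_range_succ _ (k + d + 1), colCoeff_eq_zero s (by omega) (by omega)]
      simp
    rw [e2, mul_sum, ← sum_add_distrib]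
    refine sum_congr rfl fun j _ => ?_
    rw [← add_assoc, colCoeff_succ s (show k ≤ k + d by omega)]
    ring

end QSeries


/-! ### Iterated column sums and their limit for many columns. -/

section ColumnSums

open Finset Filter Topology

/-- If `x_{n+1} = r x_n + ε_n` with `|r| < 1` and `ε_n → 0`, then `x_n → 0`. -/
theorem tendsto_zero_of_contraction {r : ℝ} (hr : |r| < 1) {x e : ℕ → ℝ}
    (h : ∀ n, x (n + 1) = r * x n + e n) (he : Tendsto e atTop (𝓝 0)) :
    Tendsto x atTop (𝓝 0) := by
  rw [Metric.tendsto_atTop] at he ⊢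
  intro ε hε
  have hr' : 0 < 1 - |r| := by linarith
  obtain ⟨N, hN⟩ := he (ε / 2 * (1 - |r|)) (by positivity)
  have key : ∀ n, |x (N + n)| ≤ |r| ^ n * |x N| + ε / 2 := by
    intro n
    induction n with
    | zero => simp; positivity
    | succ n ih =>
      rw [← add_assoc, h]
      have h1 := hN (N + n) (by omega)
      rw [Real.dist_eq, sub_zero] at h1
      calc |r * x (N + n) + e (N + n)| ≤ |r| * |x (N + n)| + |e (N + n)| := by
            rw [← abs_mul]; exact abs_add_le _ _
        _ ≤ |r| * (|r| ^ n * |x N| + ε / 2) + ε / 2 * (1 - |r|) := by gcongr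
        _ = |r| ^ (n + 1) * |x N| + ε / 2 := by ring
  have h2 : Tendsto (fun n : ℕ => |r| ^ n * |x N|) atTop (𝓝 0) := by
    simpa using (tendsto_pow_atTop_nhds_zero_of_lt_one (abs_nonneg r) hr).mul_const |x N|
  obtain ⟨K, hK⟩ := (Metric.tendsto_atTop.1 h2) (ε / 2) (by positivity)
  refine ⟨N + K, fun n hn => ?_⟩
  obtain ⟨d, rfl⟩ := Nat.exists_eq_add_of_le (show N ≤ n by omega)
  rw [Real.dist_eq, sub_zero]
  have h3 := hK d (by omega)
  rw [Real.dist_eq, sub_zero] at h3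
  linarith [key d, le_abs_self (|r| ^ d * |x N|)]

/-- The coefficients of the column expansion attached to columns `c 0 ≥ c 1 ≥ ⋯ ≥ c (r - 1)`. -/
noncomputable def columnCoeff (s z : ℝ) : (ℕ → ℕ) → ℕ → ℕ → ℝ
  | _, 0, j => if j = 0 then 1 else 0
  | c, r + 1, j => ∑ k ∈ range (c 0 + 1),
      z ^ k * colCoeff s (c 0) k j * columnCoeff s z (fun i => c (i + 1)) r k

theorem columnCoeff_eq_zero (s z : ℝ) {c : ℕ → ℕ} {r j : ℕ} (h : c 0 < j) :
    columnCoeff s z c r j = 0 := by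
  cases r with
  | zero => rw [columnCoeff, if_neg (by omega)]
  | succ r =>
    rw [columnCoeff]
    refine sum_eq_zero fun k hk => ?_
    rw [colCoeff_eq_zero s (by have := mem_range.1 hk; omega) h]
    simp

/-- Since `colCoeff s m k j` vanishes for `j < k`, only `k = 0` contributes to `j = 0`. This value
normalizes the denominator on the Hall-Littlewood side. -/
theorem columnCoeff_zero_right (s z : ℝ) (c : ℕ → ℕ) (r : ℕ) : columnCoeff s z c r 0 = 1 := by
  induction r generalizing c with
  | zero => rfl
  | succ r ih =>
    rw [columnCoeff, sum_range_succ', sum_eq_zero, ih, colCoeff_eq_one]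
    · simp
    · intro k _
      rw [colCoeff_of_lt s (by omega)]
      simp

/-- The sum over tuples `a ≥ b_0 ≥ b_1 ≥ ⋯ ≥ b_{r-1} ≥ 0` of
`∏ z^{b_i} t^{b_i^2} s^{b_i c_i} / ((t; t)_{a - b_0} (t; t)_{b_0 - b_1} ⋯ (t; t)_{b_{r-1}})`. -/
noncomputable def boxSum (s z t : ℝ) : (ℕ → ℕ) → ℕ → ℕ → ℝ
  | _, 0, a => invPoch t a 0
  | c, r + 1, a => ∑ b ∈ range (a + 1),
      z ^ b * t ^ (b ^ 2) * s ^ (b * c 0) * invPoch t a b * boxSum s z t (fun i => c (i + 1)) r b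

/-- By `sum_column_basic` with `k = m = 0`, the proposed limit is a fixed point of summation over a
column. The deviation from it is multiplied by `z^a t^{a²} = (zt)^a t^{a(a-1)}`, of absolute value
less than one for `a > 0`, up to errors coming from smaller `b`, which tend to zero by induction. -/
theorem tendsto_boxSum_zero {s z t : ℝ} (hst : s * t = 1) (ht : |t| < 1) (hz : |z * t| < 1)
    (a : ℕ) : Tendsto (fun r => boxSum s z t (fun _ => 0) r a) atTop
      (𝓝 (invPoch t a 0 / qPoch z t a)) := by
  have hfix : ∀ a, ∑ b ∈ range (a + 1), z ^ b * t ^ (b ^ 2) * s ^ (b * 0) * invPoch t a b *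
      (invPoch t b 0 / qPoch z t b) = invPoch t a 0 / qPoch z t a := by
    intro a
    rw [sum_column_basic hst ht hz a le_rfl]
    simp [colCoeff_eq_one]
  induction a using Nat.strong_induction_on with
  | _ a ih =>
    rw [← tendsto_sub_nhds_zero_iff]
    rcases Nat.eq_zero_or_pos a with rfl | ha
    · have : ∀ r, boxSum s z t (fun _ => 0) r 0 - invPoch t 0 0 / qPoch z t 0 = 0 := by
        intro r
        induction r with
        | zero => simp [boxSum]
        | succ r ihr =>
          rw [boxSum]
          simpa [invPoch_self] using ihr
      simp only [this]
      exact tendsto_const_nhds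
    · refine tendsto_zero_of_contraction (r := z ^ a * t ^ (a ^ 2))
        (e := fun r => ∑ b ∈ range a, z ^ b * t ^ (b ^ 2) * s ^ (b * 0) * invPoch t a b *
          (boxSum s z t (fun _ => 0) r b - invPoch t b 0 / qPoch z t b)) ?_ ?_ ?_
      · have : z ^ a * t ^ (a ^ 2) = (z * t) ^ a * t ^ (a * (a - 1)) := by
          rw [mul_pow, mul_assoc, ← pow_add]
          congr 2
          obtain ⟨b, rfl⟩ := Nat.exists_eq_succ_of_ne_zero ha.ne'
          simp; ring
        rw [this, abs_mul, abs_pow, abs_pow]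
        exact mul_lt_one_of_nonneg_of_lt_one_left (by positivity)
          (pow_lt_one₀ (abs_nonneg _) hz ha.ne') (pow_le_one₀ (abs_nonneg _) ht.le)
      · intro r
        rw [boxSum, ← hfix a, ← sum_sub_distrib, sum_range_succ, hfix a, add_comm]
        congr 1
        · rw [invPoch_self]; simp; ring
        · exact sum_congr rfl fun b _ => by ring
      · rw [show (0 : ℝ) = ∑ b ∈ range a, z ^ b * t ^ (b ^ 2) * s ^ (b * 0) * invPoch t a b * 0 by
          simp]
        refine tendsto_finsetSum _ fun b hb => Tendsto.const_mul _ ?_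
        exact tendsto_sub_nhds_zero_iff.2 (ih b (mem_range.1 hb))

/-- The columns from `r₀` on carry no extra weight and contribute the fixed point of the previous
lemma. Each of the first `r₀` columns then acts on the limit through `sum_column_basic`, and the
accumulated coefficients are `columnCoeff` by definition. -/
theorem tendsto_boxSum {s z t : ℝ} (hst : s * t = 1) (ht : |t| < 1) (hz : |z * t| < 1)
    (r₀ : ℕ) {c : ℕ → ℕ} (hc : Antitone c) (h0 : ∀ i, r₀ ≤ i → c i = 0) (a : ℕ) :
    Tendsto (fun r => boxSum s z t c r a) atTop
      (𝓝 (∑ j ∈ range (c 0 + 1), z ^ j * columnCoeff s z c r₀ j *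
        (invPoch t a j / qPoch z t a))) := by
  induction r₀ generalizing c a with
  | zero =>
    obtain rfl : c = fun _ => 0 := funext fun i => h0 i (Nat.zero_le i)
    simpa [columnCoeff] using tendsto_boxSum_zero hst ht hz a
  | succ r₀ ih =>
    rw [← tendsto_add_atTop_iff_nat 1]
    simp only [boxSum]
    have ih' := fun b => ih (c := fun i => c (i + 1)) (fun i j hij => hc (by omega))
      (fun i hi => h0 _ (by omega)) b
    have hlim := tendsto_finsetSum (range (a + 1)) fun b _ =>
      (ih' b).const_mul (z ^ b * t ^ (b ^ 2) * s ^ (b * c 0) * invPoch t a b)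
    convert hlim using 2
    have hc1 : c 1 ≤ c 0 := hc (by omega)
    have e : ∀ b, ∑ j ∈ range (c (0 + 1) + 1),
        z ^ j * columnCoeff s z (fun i => c (i + 1)) r₀ j * (invPoch t b j / qPoch z t b) =
        ∑ j ∈ range (c 0 + 1),
        z ^ j * columnCoeff s z (fun i => c (i + 1)) r₀ j * (invPoch t b j / qPoch z t b) := by
      intro b
      refine sum_subset (range_mono (by simp only [zero_add]; omega)) fun j _ hj => ?_
      rw [columnCoeff_eq_zero s z (by simpa using hj)]
      simp
    simp only [e, mul_sum]
    rw [sum_comm (s := range (a + 1))]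
    have e2 : ∀ k ∈ range (c 0 + 1), ∑ b ∈ range (a + 1),
        z ^ b * t ^ (b ^ 2) * s ^ (b * c 0) * invPoch t a b *
          (z ^ k * columnCoeff s z (fun i => c (i + 1)) r₀ k * (invPoch t b k / qPoch z t b)) =
        z ^ k * columnCoeff s z (fun i => c (i + 1)) r₀ k * ∑ j ∈ range (c 0 + 1),
          z ^ j * colCoeff s (c 0) k j * (invPoch t a j / qPoch z t a) := by
      intro k hk
      rw [← sum_column_basic hst ht hz a (by have := mem_range.1 hk; omega), mul_sum]
      exact sum_congr rfl fun b _ => by ring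
    rw [sum_congr rfl e2]
    simp only [mul_sum]
    rw [sum_comm (s := range (c 0 + 1)) (t := range (c 0 + 1))]
    refine sum_congr rfl fun j _ => ?_
    rw [columnCoeff, mul_sum, sum_mul]
    exact sum_congr rfl fun k _ => by ring

end ColumnSums

/-! ### Young diagrams in a box, built column by column. -/

section YoungBoxes

open Finset

namespace YoungDiagram

theorem ext_colLen {μ ν : YoungDiagram} (h : ∀ j, μ.colLen j = ν.colLen j) : μ = ν := by
  ext ⟨i, j⟩
  rw [mem_cells, mem_cells, mem_iff_lt_colLen, mem_iff_lt_colLen, h]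

/-- The diagram with its first column removed. -/
def tailCols (μ : YoungDiagram) : YoungDiagram where
  cells := (μ.cells.filter fun c => 0 < c.2).image fun c => (c.1, c.2 - 1)
  isLowerSet := by
    rintro ⟨i, j⟩ ⟨k, l⟩ hle h
    simp only [coe_image, Set.mem_image, mem_coe, mem_filter, mem_cells, Prod.exists,
      Prod.mk.injEq] at h ⊢
    obtain ⟨a, b, ⟨hab, hb⟩, rfl, rfl⟩ := h
    obtain ⟨h1, h2⟩ := Prod.mk_le_mk.1 hle
    exact ⟨k, l + 1, ⟨μ.up_left_mem h1 (by omega) hab, by omega⟩, rfl, rfl⟩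

theorem mem_tailCols {μ : YoungDiagram} {i j : ℕ} : (i, j) ∈ μ.tailCols ↔ (i, j + 1) ∈ μ := by
  rw [← mem_cells, ← mem_cells]
  simp only [tailCols, mem_image, mem_filter, mem_cells, Prod.exists, Prod.mk.injEq]
  constructor
  · rintro ⟨a, b, ⟨hab, hb⟩, rfl, rfl⟩
    rwa [Nat.sub_add_cancel hb]
  · intro h
    exact ⟨i, j + 1, ⟨h, by omega⟩, rfl, rfl⟩

theorem colLen_tailCols (μ : YoungDiagram) (j : ℕ) : μ.tailCols.colLen j = μ.colLen (j + 1) := by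
  refine eq_of_forall_lt_iff fun i => ?_
  rw [← mem_iff_lt_colLen, ← mem_iff_lt_colLen, mem_tailCols]

/-- The diagram obtained by adding a first column of length `b` (or longer, if necessary). -/
def consCol (b : ℕ) (μ : YoungDiagram) : YoungDiagram where
  cells := (range (max b (μ.colLen 0))).image (fun i => (i, 0)) ∪
    μ.cells.image fun c => (c.1, c.2 + 1)
  isLowerSet := by
    rintro ⟨i, j⟩ ⟨k, l⟩ hle h
    obtain ⟨h1, h2⟩ := Prod.mk_le_mk.1 hle
    simp only [coe_union, coe_image, Set.mem_union, Set.mem_image, mem_coe, mem_range, mem_cells,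
      Prod.exists, Prod.mk.injEq] at h ⊢
    rcases h with ⟨a, ha, rfl, rfl⟩ | ⟨a, b, hab, rfl, rfl⟩
    · exact Or.inl ⟨k, by omega, rfl, by omega⟩
    · rcases l with _ | l
      · have := mem_iff_lt_colLen.1 (μ.up_left_mem h1 (Nat.zero_le _) hab)
        exact Or.inl ⟨k, by omega, rfl, rfl⟩
      · exact Or.inr ⟨k, l, μ.up_left_mem h1 (by omega) hab, rfl, rfl⟩

theorem mem_consCol_zero {b : ℕ} {μ : YoungDiagram} {i : ℕ} :
    (i, 0) ∈ consCol b μ ↔ i < max b (μ.colLen 0) := by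
  rw [← mem_cells]
  simp [consCol]

theorem mem_consCol_succ {b : ℕ} {μ : YoungDiagram} {i j : ℕ} :
    (i, j + 1) ∈ consCol b μ ↔ (i, j) ∈ μ := by
  rw [← mem_cells, ← mem_cells]
  simp [consCol]

theorem colLen_consCol_zero {b : ℕ} {μ : YoungDiagram} (h : μ.colLen 0 ≤ b) :
    (consCol b μ).colLen 0 = b := by
  refine eq_of_forall_lt_iff fun i => ?_
  rw [← mem_iff_lt_colLen, mem_consCol_zero, max_eq_left h]

theorem colLen_consCol_succ (b : ℕ) (μ : YoungDiagram) (j : ℕ) :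
    (consCol b μ).colLen (j + 1) = μ.colLen j := by
  refine eq_of_forall_lt_iff fun i => ?_
  rw [← mem_iff_lt_colLen, ← mem_iff_lt_colLen, mem_consCol_succ]

theorem consCol_tailCols (μ : YoungDiagram) : consCol (μ.colLen 0) μ.tailCols = μ := by
  refine ext_colLen fun j => ?_
  cases j with
  | zero => exact colLen_consCol_zero (by rw [colLen_tailCols]; exact μ.colLen_anti _ _ (by omega))
  | succ j => rw [colLen_consCol_succ, colLen_tailCols]

theorem tailCols_consCol (b : ℕ) (μ : YoungDiagram) : (consCol b μ).tailCols = μ :=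
  ext_colLen fun j => by rw [colLen_tailCols, colLen_consCol_succ]

open Classical in
/-- The diagrams with at most `a` rows and at most `r` columns. -/
noncomputable def inBox : ℕ → ℕ → Finset YoungDiagram
  | _, 0 => {⊥}
  | a, r + 1 => (range (a + 1)).biUnion fun b => (inBox b r).image (consCol b)

theorem mem_inBox {a r : ℕ} {μ : YoungDiagram} :
    μ ∈ inBox a r ↔ μ.colLen 0 ≤ a ∧ μ.colLen r = 0 := by
  induction r generalizing a μ with
  | zero =>
    rw [inBox, mem_singleton]
    constructor
    · rintro rfl
      have : (⊥ : YoungDiagram).colLen 0 = 0 := by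
        by_contra h
        exact notMem_bot _ (mem_iff_lt_colLen.2 (Nat.pos_of_ne_zero h))
      exact ⟨by omega, this⟩
    · rintro ⟨-, h⟩
      ext ⟨i, j⟩
      rw [mem_cells, mem_cells]
      refine ⟨fun hm => ?_, fun hm => absurd hm (notMem_bot _)⟩
      have h1 := mem_iff_lt_colLen.1 hm
      have h2 := μ.colLen_anti 0 j (Nat.zero_le _)
      omega
  | succ r ih =>
    simp only [inBox, mem_biUnion, mem_range, mem_image]
    constructor
    · rintro ⟨b, hb, ν, hν, rfl⟩
      obtain ⟨h1, h2⟩ := ih.1 hν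
      rw [colLen_consCol_zero h1, colLen_consCol_succ]
      exact ⟨by omega, h2⟩
    · rintro ⟨h1, h2⟩
      refine ⟨μ.colLen 0, by omega, μ.tailCols, ih.2 ⟨?_, ?_⟩, consCol_tailCols μ⟩
      · rw [colLen_tailCols]; exact μ.colLen_anti _ _ (by omega)
      · rw [colLen_tailCols]; exact h2

/-- A diagram in the box is determined by the length `b ≤ a` of its first column and by its
remaining columns, which form a diagram with at most `b` rows. -/
theorem sum_inBox_succ {a r : ℕ} (f : YoungDiagram → ℝ) :
    ∑ μ ∈ inBox a (r + 1), f μ =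
      ∑ b ∈ range (a + 1), ∑ μ ∈ inBox b r, f (consCol b μ) := by
  classical
  rw [inBox, sum_biUnion]
  · refine sum_congr rfl fun b _ => ?_
    rw [sum_image]
    intro μ _ ν _ h
    rw [← tailCols_consCol b μ, h, tailCols_consCol]
  · intro b _ b' _ hne
    rw [Function.onFun, disjoint_left]
    rintro μ h1 h2
    obtain ⟨ν, hν, rfl⟩ := mem_image.1 h1
    obtain ⟨ν', hν', h⟩ := mem_image.1 h2
    apply hne
    rw [← colLen_consCol_zero (mem_inBox.1 hν).1, ← h, colLen_consCol_zero (mem_inBox.1 hν').1]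

end YoungDiagram

/-- The weight of a diagram in the box sums, relative to a bound `a` on the number of rows. -/
noncomputable def boxWeight (s z t : ℝ) (c : ℕ → ℕ) (r a : ℕ) (μ : YoungDiagram) : ℝ :=
  invPoch t a (μ.colLen 0) * ∏ j ∈ range r, (z ^ μ.colLen j * t ^ (μ.colLen j ^ 2) *
    s ^ (μ.colLen j * c j) * invPoch t (μ.colLen j) (μ.colLen (j + 1)))

theorem sum_boxWeight (s z t : ℝ) (c : ℕ → ℕ) (r a : ℕ) :
    ∑ μ ∈ YoungDiagram.inBox a r, boxWeight s z t c r a μ = boxSum s z t c r a := by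
  induction r generalizing c a with
  | zero =>
    have h := YoungDiagram.mem_inBox (a := 0) (r := 0) (μ := ⊥)
    have h0 : (⊥ : YoungDiagram).colLen 0 = 0 := by
      have := h.1 (by simp [YoungDiagram.inBox]); omega
    simp [YoungDiagram.inBox, boxWeight, boxSum, h0]
  | succ r ih =>
    rw [YoungDiagram.sum_inBox_succ, boxSum]
    refine sum_congr rfl fun b _ => ?_
    rw [← ih, mul_sum]
    refine sum_congr rfl fun μ hμ => ?_
    have h1 := (YoungDiagram.mem_inBox.1 hμ).1
    rw [boxWeight, boxWeight, prod_range_succ']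
    simp only [YoungDiagram.colLen_consCol_zero h1, YoungDiagram.colLen_consCol_succ]
    ring

end YoungBoxes


/-! ### The sum over all Young diagrams. -/

section YoungSum

open Finset Filter Topology

theorem tendsto_qPoch {z t : ℝ} (ht : |t| < 1) (hz : |z * t| < 1) :
    Tendsto (qPoch z t) atTop (𝓝 (∏' j : ℕ, (1 - z * t ^ (j + 1)))) ∧
      0 < ∏' j : ℕ, (1 - z * t ^ (j + 1)) := by
  have hs : Summable fun j : ℕ => ‖-(z * t ^ (j + 1))‖ := by
    have : (fun j : ℕ => ‖-(z * t ^ (j + 1))‖) = fun j : ℕ => |z * t| * |t| ^ j := by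
      funext j
      rw [norm_neg, Real.norm_eq_abs, pow_succ', ← mul_assoc, abs_mul, abs_pow]
    rw [this]
    exact (summable_geometric_of_lt_one (abs_nonneg t) ht).mul_left _
  have h1 : Multipliable fun j : ℕ => 1 + -(z * t ^ (j + 1)) := multipliable_one_add_of_summable hs
  have h2 : ∏' j : ℕ, (1 + -(z * t ^ (j + 1))) ≠ 0 := tprod_one_add_ne_zero_of_summable
    (fun j => by rw [← sub_eq_add_neg]; exact (one_sub_mul_pow_pos ht hz j).ne') hs
  have h3 := h1.hasProd.tendsto_prod_nat
  simp only [← sub_eq_add_neg] at h2 h3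
  exact ⟨h3, lt_of_le_of_ne (ge_of_tendsto' h3 fun n => (qPoch_pos ht hz n).le) h2.symm⟩

theorem tendsto_invPoch {t : ℝ} (ht : |t| < 1) (k : ℕ) :
    Tendsto (fun a => invPoch t a k) atTop (𝓝 (1 / ∏' j : ℕ, (1 - 1 * t ^ (j + 1)))) := by
  have h1 : |(1 : ℝ) * t| < 1 := by simpa using ht
  obtain ⟨h2, h3⟩ := tendsto_qPoch ht h1
  rw [← tendsto_add_atTop_iff_nat k]
  have : (fun a => invPoch t (a + k) k) = fun a => 1 / qPoch 1 t a := by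
    funext a; rw [add_comm, invPoch_add]
  rw [this]
  exact tendsto_const_nhds.div h2 h3.ne'

theorem invPoch_nonneg {t : ℝ} (ht : |t| < 1) (a k : ℕ) : 0 ≤ invPoch t a k := by
  unfold invPoch
  split_ifs
  · exact one_div_nonneg.2 (qPoch_pos ht (by simpa using ht) _).le
  · exact le_rfl

/-- A sequence of positive numbers with a positive limit is bounded away from zero and infinity. The
bounds provide the domination when the bound on the number of rows is removed. -/
theorem exists_qPoch_bounds {t : ℝ} (ht : |t| < 1) :
    ∃ lo hi : ℝ, 0 < lo ∧ 0 < hi ∧ ∀ n, lo ≤ qPoch 1 t n ∧ qPoch 1 t n ≤ hi := by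
  have h1 : |(1 : ℝ) * t| < 1 := by simpa using ht
  obtain ⟨h2, h3⟩ := tendsto_qPoch ht h1
  obtain ⟨hi, hhi⟩ := h2.bddAbove_range
  obtain ⟨lo, hlo⟩ := (h2.inv₀ h3.ne').bddAbove_range
  have hpos := fun n => qPoch_pos ht h1 n
  have hlo0 : 0 < lo := lt_of_lt_of_le (inv_pos.2 (hpos 0)) (hlo ⟨0, rfl⟩)
  refine ⟨lo⁻¹, hi, inv_pos.2 hlo0, lt_of_lt_of_le (hpos 0) (hhi ⟨0, rfl⟩), fun n =>
    ⟨?_, hhi ⟨n, rfl⟩⟩⟩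
  exact inv_le_of_inv_le₀ (hpos n) (hlo ⟨n, rfl⟩)

/-- The weight `∏_j z^{μ'_j} t^{μ'_j²} s^{μ'_j c_j} / (t; t)_{μ'_j - μ'_{j+1}}` of a diagram. -/
noncomputable def youngWeight (s z t : ℝ) (c : ℕ → ℕ) (μ : YoungDiagram) : ℝ :=
  ∏ j ∈ range (μ.rowLen 0), (z ^ μ.colLen j * t ^ (μ.colLen j ^ 2) *
    s ^ (μ.colLen j * c j) * invPoch t (μ.colLen j) (μ.colLen (j + 1)))

namespace YoungDiagram

theorem colLen_eq_zero_iff {μ : YoungDiagram} {j : ℕ} : μ.colLen j = 0 ↔ μ.rowLen 0 ≤ j := by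
  have h : (0, j) ∈ μ ↔ 0 < μ.colLen j := mem_iff_lt_colLen
  have h' : (0, j) ∈ μ ↔ j < μ.rowLen 0 := mem_iff_lt_rowLen
  rw [h] at h'
  omega

theorem rowLen_eq_zero_iff {μ : YoungDiagram} {i : ℕ} : μ.rowLen i = 0 ↔ μ.colLen 0 ≤ i := by
  have h : (i, 0) ∈ μ ↔ i < μ.colLen 0 := mem_iff_lt_colLen
  have h' : (i, 0) ∈ μ ↔ 0 < μ.rowLen i := mem_iff_lt_rowLen
  rw [h] at h'
  omega

end YoungDiagram

theorem boxWeight_eq {s z t : ℝ} {c : ℕ → ℕ} {r a : ℕ} {μ : YoungDiagram}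
    (h : μ ∈ YoungDiagram.inBox a r) :
    boxWeight s z t c r a μ = invPoch t a (μ.colLen 0) * youngWeight s z t c μ := by
  rw [boxWeight, youngWeight]
  congr 1
  have hr := YoungDiagram.colLen_eq_zero_iff.1 (YoungDiagram.mem_inBox.1 h).2
  refine (prod_subset (range_mono hr) fun j _ hj => ?_).symm
  have h1 : μ.colLen j = 0 := YoungDiagram.colLen_eq_zero_iff.2 (by simpa using hj)
  have h2 : μ.colLen (j + 1) = 0 :=
    YoungDiagram.colLen_eq_zero_iff.2 (by have := YoungDiagram.colLen_eq_zero_iff.1 h1; omega)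
  rw [h1, h2, invPoch_self]
  simp

/-- The sum over all Young diagrams of the weights `youngWeight`. -/
theorem hasSum_youngWeight {s z t : ℝ} (hst : s * t = 1) (ht : |t| < 1) (hz : |z * t| < 1)
    (r₀ : ℕ) {c : ℕ → ℕ} (hc : Antitone c) (h0 : ∀ i, r₀ ≤ i → c i = 0)
    (hnn : ∀ μ, 0 ≤ youngWeight s z t c μ) :
    HasSum (fun μ => youngWeight s z t c μ * ∏' j : ℕ, (1 - z * t ^ (j + 1)))
      (∑ j ∈ range (c 0 + 1), z ^ j * columnCoeff s z c r₀ j) := by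
  have h1 : |(1 : ℝ) * t| < 1 := by simpa using ht
  obtain ⟨lo, hi, hlo, hhi, hb⟩ := exists_qPoch_bounds ht
  -- `L a` is the limit over the number of columns for diagrams with at most `a` rows. The factor
  -- `invPoch t a (μ.colLen 0)` restricts to these diagrams and becomes independent of `μ` as `a →
  -- ∞`.
  set L : ℕ → ℝ := fun a => ∑ j ∈ range (c 0 + 1), z ^ j * columnCoeff s z c r₀ j *
        (invPoch t a j / qPoch z t a) with hL
  set f := youngWeight s z t c with hf
  set u : ℕ → YoungDiagram → ℝ := fun a μ => invPoch t a (μ.colLen 0) * f μ with hu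
  have hu0 : ∀ a μ, 0 ≤ u a μ := fun a μ => mul_nonneg (invPoch_nonneg ht _ _) (hnn μ)
  have hbox : ∀ a r, ∑ μ ∈ YoungDiagram.inBox a r, u a μ = boxSum s z t c r a := by
    intro a r
    rw [← sum_boxWeight]
    exact sum_congr rfl fun μ hμ => (boxWeight_eq hμ).symm
  have hmono : ∀ a, Monotone fun r => YoungDiagram.inBox a r := by
    intro a r r' h μ hμ
    rw [YoungDiagram.mem_inBox, YoungDiagram.colLen_eq_zero_iff] at hμ ⊢
    exact ⟨hμ.1, hμ.2.trans h⟩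
  have hle : ∀ a r, ∑ μ ∈ YoungDiagram.inBox a r, u a μ ≤ L a := by
    intro a r
    refine Monotone.ge_of_tendsto (f := fun r => ∑ μ ∈ YoungDiagram.inBox a r, u a μ) ?_ ?_ r
    · intro r r' h
      exact sum_le_sum_of_subset_of_nonneg (hmono a h) fun μ _ _ => hu0 a μ
    · simp only [hbox]
      exact tendsto_boxSum hst ht hz r₀ hc h0 a
  have hF : ∀ a (F : Finset YoungDiagram), ∑ μ ∈ F, u a μ ≤ L a := by
    intro a F
    have e : ∑ μ ∈ F, u a μ = ∑ μ ∈ F with μ.colLen 0 ≤ a, u a μ := by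
      rw [sum_filter]
      refine sum_congr rfl fun μ _ => ?_
      split_ifs with h
      · rfl
      · rw [hu]; simp only; rw [invPoch_of_lt t (by omega), zero_mul]
    rw [e]
    refine le_trans ?_ (hle a (F.sup fun μ => μ.rowLen 0))
    refine sum_le_sum_of_subset_of_nonneg (fun μ hμ => ?_) fun μ _ _ => hu0 a μ
    rw [mem_filter] at hμ
    rw [YoungDiagram.mem_inBox, YoungDiagram.colLen_eq_zero_iff]
    exact ⟨hμ.2, le_sup (f := fun μ : YoungDiagram => μ.rowLen 0) hμ.1⟩
  have hsu : ∀ a, Summable (u a) := fun a => summable_of_sum_le (hu0 a) (hF a)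
  have htsum : ∀ a, ∑' μ, u a μ = L a := by
    intro a
    refine le_antisymm (Real.tsum_le_of_sum_le (hu0 a) (hF a)) ?_
    refine le_of_tendsto' (tendsto_boxSum hst ht hz r₀ hc h0 a) fun r => ?_
    rw [← hbox]
    exact (hsu a).sum_le_tsum _ fun μ _ => hu0 a μ
  obtain ⟨hP, hP0⟩ := tendsto_qPoch ht hz
  obtain ⟨hg, hg0⟩ := tendsto_qPoch ht h1
  set P := ∏' j : ℕ, (1 - z * t ^ (j + 1))
  set g := ∏' j : ℕ, (1 - 1 * t ^ (j + 1))
  have hLlim : Tendsto L atTop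
      (𝓝 (∑ j ∈ range (c 0 + 1), z ^ j * columnCoeff s z c r₀ j * (1 / g / P))) :=
    tendsto_finsetSum _ fun j _ => ((tendsto_invPoch ht j).div hP hP0.ne').const_mul _
  -- For a finite set of diagrams choose `a` to bound all their numbers of rows. Then `f ≤ hi * u a`
  -- on this set, and the sums of `u a` are at most `L a`, which is bounded because it converges.
  have hsf : Summable f := by
    obtain ⟨B, hB⟩ := hLlim.bddAbove_range
    refine summable_of_sum_le (c := hi * B) hnn fun F => ?_
    set a := F.sup fun μ => μ.colLen 0
    have h2 : ∀ μ ∈ F, f μ ≤ hi * u a μ := by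
      intro μ hμ
      have h3 : μ.colLen 0 ≤ a := le_sup (f := fun μ : YoungDiagram => μ.colLen 0) hμ
      simp only [hu, invPoch, if_pos h3]
      rw [← mul_assoc, mul_one_div]
      have h4 := hb (a - μ.colLen 0)
      exact le_mul_of_one_le_left (hnn μ) ((one_le_div (hlo.trans_le h4.1)).2 h4.2)
    calc ∑ μ ∈ F, f μ ≤ ∑ μ ∈ F, hi * u a μ := sum_le_sum h2
      _ = hi * ∑ μ ∈ F, u a μ := by rw [mul_sum]
      _ ≤ hi * B := by
        have := (hF a F).trans (hB ⟨a, rfl⟩)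
        gcongr
  -- Letting `a → ∞`, each `invPoch` tends to `1/g`. Comparison with the limit of `L a`, in which
  -- the same `1/g` occurs, gives the sum of `f`.
  have hlim2 : Tendsto (fun a => ∑' μ, u a μ) atTop (𝓝 (∑' μ, 1 / g * f μ)) := by
    refine tendsto_tsum_of_dominated_convergence (bound := fun μ => 1 / lo * f μ)
      (hsf.mul_left _) (fun μ => (tendsto_invPoch ht _).mul_const _) ?_
    refine Eventually.of_forall fun a μ => ?_
    rw [Real.norm_eq_abs, abs_of_nonneg (hu0 a μ)]
    refine mul_le_mul_of_nonneg_right ?_ (hnn μ)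
    unfold invPoch
    split_ifs
    · exact one_div_le_one_div_of_le hlo (hb _).1
    · positivity
  simp only [htsum] at hlim2
  have heq := tendsto_nhds_unique hlim2 hLlim
  rw [tsum_mul_left, ← sum_mul] at heq
  have : ∑ j ∈ range (c 0 + 1), z ^ j * columnCoeff s z c r₀ j = (∑' μ, f μ) * P := by
    field_simp at heq
    linarith
  rw [this]
  exact hsf.hasSum.mul_right P

end YoungSum


/-! ### Evaluation of Hall-Littlewood polynomials at distinct points. -/

section HallLittlewoodEval

open Finset

/-- Multiplication by the Vandermonde product clears all denominators and turns the definition into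
an identity of polynomials. After evaluation one may divide by it again, because the points are
distinct. -/
theorem eval_hallLittlewood {n : ℕ} (μ : YoungDiagram) (t : ℝ) {a : Fin n → ℝ}
    (ha : Function.Injective a) :
    MvPolynomial.eval a (hallLittlewood n μ t) = (hallLittlewoodNorm n μ t)⁻¹ *
      ∑ σ : Equiv.Perm (Fin n), (∏ i, a (σ i) ^ μ.rowLen i) *
        ∏ i, ∏ j ∈ Ioi i, (a (σ i) - t * a (σ j)) / (a (σ i) - a (σ j)) := by
  set D : MvPolynomial (Fin n) ℝ :=
    ∏ i : Fin n, ∏ j ∈ Ioi i, (MvPolynomial.X i - MvPolynomial.X j) with hD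
  set g : MvPolynomial (Fin n) ℝ := (∏ i : Fin n, MvPolynomial.X i ^ μ.rowLen i) *
      ∏ i : Fin n, ∏ j ∈ Ioi i, (MvPolynomial.X i - MvPolynomial.C t * MvPolynomial.X j) with hg
  have hinj := IsFractionRing.injective (MvPolynomial (Fin n) ℝ)
    (FractionRing (MvPolynomial (Fin n) ℝ))
  have hne : ∀ σ : Equiv.Perm (Fin n), ∀ i, ∀ j ∈ Ioi i,
      algebraMap (MvPolynomial (Fin n) ℝ) (FractionRing (MvPolynomial (Fin n) ℝ))
        (MvPolynomial.X (σ i)) -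
        algebraMap (MvPolynomial (Fin n) ℝ) (FractionRing (MvPolynomial (Fin n) ℝ))
        (MvPolynomial.X (σ j)) ≠ 0 := by
    intro σ i j hj h
    have := MvPolynomial.X_injective (hinj (sub_eq_zero.1 h))
    exact (mem_Ioi.1 hj).ne (σ.injective this)
  have key : D * hallLittlewood n μ t = MvPolynomial.C (hallLittlewoodNorm n μ t)⁻¹ *
      ∑ σ : Equiv.Perm (Fin n), (Equiv.Perm.sign σ : ℤ) • MvPolynomial.rename σ g := by
    apply hinj
    rw [map_mul, map_mul, algebraMap_hallLittlewood, hallLittlewoodFrac, mul_left_comm]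
    congr 1
    rw [mul_sum, map_sum]
    refine sum_congr rfl fun σ _ => ?_
    have h1 := congrArg
      (algebraMap (MvPolynomial (Fin n) ℝ) (FractionRing (MvPolynomial (Fin n) ℝ)))
      (prod_X_sub_X_perm σ)
    rw [← hD] at h1
    simp only [map_prod, map_sub, map_zsmul] at h1
    have h2 : ∏ i : Fin n, ∏ j ∈ Ioi i,
        (algebraMap (MvPolynomial (Fin n) ℝ) (FractionRing (MvPolynomial (Fin n) ℝ))
        (MvPolynomial.X (σ i)) -
        algebraMap (MvPolynomial (Fin n) ℝ) (FractionRing (MvPolynomial (Fin n) ℝ))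
        (MvPolynomial.X (σ j))) ≠ 0 :=
      prod_ne_zero_iff.2 fun i _ => prod_ne_zero_iff.2 fun j hj => hne σ i j hj
    have h3 : algebraMap (MvPolynomial (Fin n) ℝ) (FractionRing (MvPolynomial (Fin n) ℝ)) D =
        (Equiv.Perm.sign σ : ℤ) • ∏ i : Fin n, ∏ j ∈ Ioi i,
        (algebraMap (MvPolynomial (Fin n) ℝ) (FractionRing (MvPolynomial (Fin n) ℝ))
        (MvPolynomial.X (σ i)) -
        algebraMap (MvPolynomial (Fin n) ℝ) (FractionRing (MvPolynomial (Fin n) ℝ))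
        (MvPolynomial.X (σ j))) := by
      rw [h1, smul_smul]
      rcases Int.units_eq_one_or (Equiv.Perm.sign σ) with h | h <;> simp [h]
    rw [h3]
    simp only [prod_div_distrib, hg, map_mul, map_prod, map_sub, map_pow, map_zsmul,
      MvPolynomial.rename_X, MvPolynomial.rename_C]
    rw [smul_mul_assoc, mul_div_assoc', mul_div_cancel₀ _ h2]
  have h := congrArg (MvPolynomial.eval a) key
  have hperm : ∀ σ : Equiv.Perm (Fin n), (∏ i : Fin n, ∏ j ∈ Ioi i, (a (σ i) - a (σ j))) =
      (Equiv.Perm.sign σ : ℤ) • ∏ i : Fin n, ∏ j ∈ Ioi i, (a i - a j) := by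
    intro σ
    have := congrArg (MvPolynomial.eval a) (prod_X_sub_X_perm σ)
    simpa [map_prod] using this
  have hD0 : ∏ i : Fin n, ∏ j ∈ Ioi i, (a i - a j) ≠ 0 :=
    prod_ne_zero_iff.2 fun i _ => prod_ne_zero_iff.2 fun j hj =>
      sub_ne_zero.2 fun h => (mem_Ioi.1 hj).ne (ha h)
  rw [map_mul, map_mul, map_sum, MvPolynomial.eval_C] at h
  have hDe : MvPolynomial.eval a D = ∏ i : Fin n, ∏ j ∈ Ioi i, (a i - a j) := by
    simp [hD, map_prod]
  rw [hDe] at h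
  apply mul_left_cancel₀ hD0
  rw [h, mul_left_comm]
  congr 1
  rw [mul_sum]
  refine sum_congr rfl fun σ _ => ?_
  have h2 := hperm σ
  simp only [prod_div_distrib, hg, map_mul, map_prod, map_sub, map_pow, map_zsmul,
      MvPolynomial.rename_X, MvPolynomial.rename_C, MvPolynomial.eval_X, MvPolynomial.eval_C]
  rw [h2]
  rcases Int.units_eq_one_or (Equiv.Perm.sign σ) with h | h <;> simp [h] <;> field_simp

/-- The sum over the orderings of the variables `a` (listed from the last one to the first one)
that occurs in the definition of the Hall-Littlewood polynomials. -/
noncomputable def orderSum (t : ℝ) {n : ℕ} (a : Fin n → ℝ) (ρ : Fin n → ℕ) : ℝ :=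
  ∑ σ : Equiv.Perm (Fin n), (∏ i, a (σ i) ^ ρ i) *
    ∏ i, ∏ j ∈ Ioi i, (a (σ j) - t * a (σ i)) / (a (σ j) - a (σ i))

/-- Reversing positions moves the smallest part to index `0`, where the recursion over `Fin (n + 1)`
can remove it. -/
theorem orderSum_rev (t : ℝ) {n : ℕ} (a : Fin n → ℝ) (ρ : Fin n → ℕ) :
    ∑ σ : Equiv.Perm (Fin n), (∏ i, a (σ i) ^ ρ i) *
      ∏ i, ∏ j ∈ Ioi i, (a (σ i) - t * a (σ j)) / (a (σ i) - a (σ j)) =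
    orderSum t a (fun i => ρ i.rev) := by
  rw [orderSum]
  refine Fintype.sum_equiv (Equiv.mulRight Fin.revPerm) _ _ fun σ => ?_
  congr 1
  · exact (Equiv.prod_comp Fin.revPerm (fun i => a (σ i) ^ ρ i)).symm
  · rw [prod_sigma', prod_sigma']
    refine prod_bij' (fun p _ => ⟨p.2.rev, p.1.rev⟩) (fun p _ => ⟨p.2.rev, p.1.rev⟩)
      ?_ ?_ ?_ ?_ ?_
    · rintro ⟨i, j⟩ h; simpa using h
    · rintro ⟨i, j⟩ h; simpa using h
    · rintro ⟨i, j⟩ _; simp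
    · rintro ⟨i, j⟩ _; simp
    · rintro ⟨i, j⟩ _; simp

theorem image_swap_succ {n : ℕ} (a : Fin (n + 1) → ℝ) (ha : Function.Injective a)
    (p : Fin (n + 1)) :
    univ.image (fun i : Fin n => a (Equiv.swap 0 p i.succ)) = (univ.image a).erase (a p) := by
  ext x
  simp only [mem_image, mem_univ, true_and, mem_erase]
  constructor
  · rintro ⟨i, rfl⟩
    refine ⟨fun h => ?_, _, rfl⟩
    have h1 := ha h
    rw [Equiv.swap_apply_eq_iff, Equiv.swap_apply_right] at h1
    exact Fin.succ_ne_zero i h1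
  · rintro ⟨hne, j, rfl⟩
    have hj : Equiv.swap 0 p j ≠ 0 := by
      intro h
      rw [Equiv.swap_apply_eq_iff, Equiv.swap_apply_left] at h
      exact hne (by rw [h])
    obtain ⟨i, hi⟩ := Fin.exists_succ_eq.2 hj
    exact ⟨i, by rw [hi, Equiv.swap_apply_self]⟩

theorem injective_swap_succ {n : ℕ} {a : Fin (n + 1) → ℝ} (ha : Function.Injective a)
    (p : Fin (n + 1)) : Function.Injective fun i : Fin n => a (Equiv.swap 0 p i.succ) :=
  fun _ _ h => Fin.succ_injective _ ((Equiv.swap 0 p).injective (ha h))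

/-- Orderings are grouped by the variable `a p` in the last place. Its exponent is zero, so it
contributes only the factors linking it to the other variables; `Equiv.swap 0 p` enumerates these.
-/
theorem orderSum_succ (t : ℝ) {n : ℕ} {a : Fin (n + 1) → ℝ} (ha : Function.Injective a)
    {ρ : Fin (n + 1) → ℕ} (hρ : ρ 0 = 0) :
    orderSum t a ρ = ∑ p, (∏ r ∈ (univ.image a).erase (a p), (r - t * a p) / (r - a p)) *
      orderSum t (fun i => a (Equiv.swap 0 p i.succ)) (fun i => ρ i.succ) := by
  rw [orderSum, ← Equiv.sum_comp Equiv.Perm.decomposeFin.symm, Fintype.sum_prod_type]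
  refine sum_congr rfl fun p _ => ?_
  rw [orderSum, mul_sum]
  refine sum_congr rfl fun e _ => ?_
  rw [Fin.prod_univ_succ, Fin.prod_univ_succ, hρ, pow_zero, one_mul, Fin.prod_Ioi_zero]
  simp only [Fin.prod_Ioi_succ, Equiv.Perm.decomposeFin_symm_apply_zero,
    Equiv.Perm.decomposeFin_symm_apply_succ]
  rw [mul_left_comm]
  congr 1
  rw [← image_swap_succ a ha p, prod_image (fun _ _ _ _ h => injective_swap_succ ha p h)]
  exact Equiv.prod_comp e fun i => (a (Equiv.swap 0 p i.succ) - t * a p) /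
    (a (Equiv.swap 0 p i.succ) - a p)

/-- Adding one to every exponent, that is, adding a full column, multiplies each summand by the
product of all variables. -/
theorem orderSum_add_one (t : ℝ) {n : ℕ} (a : Fin n → ℝ) (ρ : Fin n → ℕ) :
    orderSum t a (fun i => ρ i + 1) = (∏ i, a i) * orderSum t a ρ := by
  rw [orderSum, orderSum, mul_sum]
  refine sum_congr rfl fun σ _ => ?_
  rw [← mul_assoc]
  congr 1
  rw [← Equiv.prod_comp σ a, ← prod_mul_distrib]
  exact prod_congr rfl fun i _ => pow_succ' _ _

end HallLittlewoodEval


/-! ### Two geometric chains of variables: the recursion and its eigenfunctions. -/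

section GeometricEval

open Finset

/-- The variables `1, t, …, t^{n-1}` and `z, z t, …, z t^{m-1}`. -/
noncomputable def geomSet (t z : ℝ) (n m : ℕ) : Finset ℝ :=
  (range n).image (fun i => t ^ i) ∪ (range m).image (fun j => z * t ^ j)

theorem pow_injective_of_abs_lt_one {t : ℝ} (h0 : t ≠ 0) (ht : |t| < 1) :
    Function.Injective fun i : ℕ => t ^ i := by
  intro i j h
  have h1 : |t| ^ i = |t| ^ j := by rw [← abs_pow, ← abs_pow]; exact congrArg _ h
  exact pow_right_injective₀ (abs_pos.2 h0) ht.ne h1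

theorem mem_geomSet {t z : ℝ} {n m : ℕ} {x : ℝ} :
    x ∈ geomSet t z n m ↔ (∃ i < n, t ^ i = x) ∨ ∃ j < m, z * t ^ j = x := by
  simp [geomSet]

theorem erase_geomSet_left {t z : ℝ} (h0 : t ≠ 0) (ht : |t| < 1)
    (hg : ∀ i j : ℕ, z * t ^ i ≠ t ^ j) (n m : ℕ) :
    (geomSet t z (n + 1) m).erase (t ^ n) = geomSet t z n m := by
  ext x
  rw [mem_erase, mem_geomSet, mem_geomSet]
  constructor
  · rintro ⟨hx, ⟨i, hi, rfl⟩ | h⟩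
    · refine Or.inl ⟨i, ?_, rfl⟩
      have : i ≠ n := fun h => hx (by rw [h])
      omega
    · exact Or.inr h
  · rintro (⟨i, hi, rfl⟩ | ⟨j, hj, rfl⟩)
    · exact ⟨fun h => hi.ne (pow_injective_of_abs_lt_one h0 ht h), Or.inl ⟨i, by omega, rfl⟩⟩
    · exact ⟨hg _ _, Or.inr ⟨j, hj, rfl⟩⟩

theorem erase_geomSet_right {t z : ℝ} (h0 : t ≠ 0) (ht : |t| < 1) (hz : z ≠ 0)
    (hg : ∀ i j : ℕ, z * t ^ i ≠ t ^ j) (n m : ℕ) :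
    (geomSet t z n (m + 1)).erase (z * t ^ m) = geomSet t z n m := by
  ext x
  rw [mem_erase, mem_geomSet, mem_geomSet]
  constructor
  · rintro ⟨hx, h | ⟨i, hi, rfl⟩⟩
    · exact Or.inl h
    · refine Or.inr ⟨i, ?_, rfl⟩
      have : i ≠ m := fun h => hx (by rw [h])
      omega
  · rintro (⟨i, hi, rfl⟩ | ⟨j, hj, rfl⟩)
    · exact ⟨(hg _ _).symm, Or.inl ⟨i, hi, rfl⟩⟩
    · refine ⟨fun h => hj.ne ?_, Or.inr ⟨j, by omega, rfl⟩⟩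
      exact pow_injective_of_abs_lt_one h0 ht (mul_left_cancel₀ hz h)

theorem prod_geomSet {M : Type*} [CommMonoid M] {t z : ℝ} (h0 : t ≠ 0) (ht : |t| < 1) (hz : z ≠ 0)
    (hg : ∀ i j : ℕ, z * t ^ i ≠ t ^ j) (n m : ℕ) (f : ℝ → M) :
    ∏ x ∈ geomSet t z n m, f x =
      (∏ i ∈ range n, f (t ^ i)) * ∏ j ∈ range m, f (z * t ^ j) := by
  rw [geomSet, prod_union, prod_image, prod_image]
  · exact fun i _ j _ h => pow_injective_of_abs_lt_one h0 ht (mul_left_cancel₀ hz h)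
  · exact fun i _ j _ h => pow_injective_of_abs_lt_one h0 ht h
  · rw [disjoint_left]
    intro x h1 h2
    obtain ⟨i, -, rfl⟩ := mem_image.1 h1
    obtain ⟨j, -, h⟩ := mem_image.1 h2
    exact hg _ _ h

theorem sum_geomSet {t z : ℝ} (h0 : t ≠ 0) (ht : |t| < 1) (hz : z ≠ 0)
    (hg : ∀ i j : ℕ, z * t ^ i ≠ t ^ j) (n m : ℕ) (f : ℝ → ℝ) :
    ∑ x ∈ geomSet t z n m, f x =
      (∑ i ∈ range n, f (t ^ i)) + ∑ j ∈ range m, f (z * t ^ j) :=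
  prod_geomSet (M := Multiplicative ℝ) h0 ht hz hg n m f

/-- Along a chain, `y t^{j+1} - t x = t (y t^j - x)`, so each numerator is `t` times the preceding
denominator. -/
theorem prod_telescope {t x y : ℝ} (m : ℕ) (h : ∀ j < m, y * t ^ j ≠ x) :
    (∏ j ∈ range m, (y * t ^ j - t * x) / (y * t ^ j - x)) * (y * t ^ m - t * x) =
      t ^ m * (y - t * x) := by
  induction m with
  | zero => simp
  | succ m ih =>
    have h1 := ih fun j hj => h j (by omega)
    have h2 := sub_ne_zero.2 (h m (by omega))
    rw [prod_range_succ]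
    field_simp
    linear_combination t * (y * t ^ m - x) * h1

/-- The coefficient of removing the variable `t^{n-1}`. -/
noncomputable def stepLeft (t z : ℝ) (n m : ℕ) : ℝ :=
  (1 - t ^ n) / (1 - t) * ((z - t ^ n) * t ^ m / (z * t ^ m - t ^ n))

/-- The coefficient of removing the variable `z t^{m-1}`. -/
noncomputable def stepRight (t z : ℝ) (n m : ℕ) : ℝ :=
  (1 - t ^ m) / (1 - t) * ((1 - z * t ^ m) * t ^ n / (t ^ n - z * t ^ m))

theorem one_sub_pow_succ_ne_zero {t : ℝ} (ht : |t| < 1) (k : ℕ) : 1 - t ^ (k + 1) ≠ 0 := by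
  have := (one_sub_mul_pow_pos (z := 1) ht (by simpa using ht) k).ne'
  simpa using this

theorem prod_removal_left {t z : ℝ} (h0 : t ≠ 0) (ht : |t| < 1) (hz : z ≠ 0)
    (hg : ∀ i j : ℕ, z * t ^ i ≠ t ^ j) (n m : ℕ) :
    ∏ r ∈ (geomSet t z (n + 1) m).erase (t ^ n), (r - t * t ^ n) / (r - t ^ n) =
      stepLeft t z (n + 1) m := by
  rw [erase_geomSet_left h0 ht hg, prod_geomSet h0 ht hz hg, stepLeft]
  have h1 := prod_telescope (t := t) (x := t ^ n) (y := 1) n fun j hj => by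
    rw [one_mul]; exact fun h => hj.ne (pow_injective_of_abs_lt_one h0 ht h)
  have h2 := prod_telescope (t := t) (x := t ^ n) (y := z) m fun j _ => hg j n
  simp only [one_mul, ← pow_succ'] at h1 h2 ⊢
  have h3 : 1 - t ≠ 0 := by simpa using one_sub_pow_succ_ne_zero ht 0
  have h4 : z * t ^ m - t ^ (n + 1) ≠ 0 := sub_ne_zero.2 (hg _ _)
  have h5 : t ^ n ≠ 0 := pow_ne_zero _ h0
  congr 1
  · rw [eq_div_iff h3]
    apply mul_left_cancel₀ h5
    linear_combination h1
  · rw [eq_div_iff h4]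
    linear_combination h2

theorem prod_removal_right {t z : ℝ} (h0 : t ≠ 0) (ht : |t| < 1) (hz : z ≠ 0)
    (hg : ∀ i j : ℕ, z * t ^ i ≠ t ^ j) (n m : ℕ) :
    ∏ r ∈ (geomSet t z n (m + 1)).erase (z * t ^ m), (r - t * (z * t ^ m)) / (r - z * t ^ m) =
      stepRight t z n (m + 1) := by
  rw [erase_geomSet_right h0 ht hz hg, prod_geomSet h0 ht hz hg, stepRight]
  have h1 := prod_telescope (t := t) (x := z * t ^ m) (y := 1) n fun j _ => by
    rw [one_mul]; exact (hg _ _).symm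
  have h2 := prod_telescope (t := t) (x := z * t ^ m) (y := z) m fun j hj h =>
    hj.ne (pow_injective_of_abs_lt_one h0 ht (mul_left_cancel₀ hz h))
  have e : t * (z * t ^ m) = z * t ^ (m + 1) := by ring
  simp only [one_mul, e] at h1 h2 ⊢
  have h3 : 1 - t ≠ 0 := by simpa using one_sub_pow_succ_ne_zero ht 0
  have h4 : t ^ n - z * t ^ (m + 1) ≠ 0 := sub_ne_zero.2 (hg _ _).symm
  have h5 : z * t ^ m ≠ 0 := mul_ne_zero hz (pow_ne_zero _ h0)
  rw [mul_comm]
  congr 1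
  · rw [eq_div_iff h3]
    apply mul_left_cancel₀ h5
    linear_combination h2
  · rw [eq_div_iff h4]
    linear_combination h1

/-- Removing the last variable, when its exponent is zero. -/
theorem orderSum_extend {t z : ℝ} (h0 : t ≠ 0) (ht : |t| < 1) (hz : z ≠ 0)
    (hg : ∀ i j : ℕ, z * t ^ i ≠ t ^ j) {N : ℕ} {μ : ℕ → ℕ} (hμ : μ N = 0) {H : ℕ → ℕ → ℝ}
    (hH : ∀ n m, n + m = N → ∀ a : Fin N → ℝ, Function.Injective a →
      univ.image a = geomSet t z n m → orderSum t a (fun i => μ (N - 1 - i)) = H n m)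
    {n m : ℕ} (hnm : n + m = N + 1) {a : Fin (N + 1) → ℝ} (ha : Function.Injective a)
    (him : univ.image a = geomSet t z n m) :
    orderSum t a (fun i => μ (N + 1 - 1 - i)) =
      stepLeft t z n m * H (n - 1) m + stepRight t z n m * H n (m - 1) := by
  classical
  rw [orderSum_succ t ha (by simpa using hμ), him]
  -- Only the last variables of the two chains, `t^{n-1}` and `z t^{m-1}`, can stand in the last
  -- place; `G` records these two contributions.
  set G : ℝ → ℝ := fun x => if n ≠ 0 ∧ x = t ^ (n - 1) then stepLeft t z n m * H (n - 1) m else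
    if m ≠ 0 ∧ x = z * t ^ (m - 1) then stepRight t z n m * H n (m - 1) else 0 with hG
  have hterm : ∀ p, (∏ r ∈ (geomSet t z n m).erase (a p), (r - t * a p) / (r - a p)) *
      orderSum t (fun i => a (Equiv.swap 0 p i.succ)) (fun i => μ (N + 1 - 1 - i.succ)) =
      G (a p) := by
    intro p
    have hρ : (fun i : Fin N => μ (N + 1 - 1 - i.succ)) = fun i : Fin N => μ (N - 1 - i) := by
      funext i; congr 1; simp; omega
    have hinj := injective_swap_succ ha p
    have himp := image_swap_succ a ha p
    rw [him] at himp
    rw [hρ]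
    simp only [hG]
    split_ifs with h1 h2
    · obtain ⟨hn, hx⟩ := h1
      obtain ⟨n, rfl⟩ := Nat.exists_eq_succ_of_ne_zero hn
      simp only [Nat.succ_eq_add_one, Nat.add_sub_cancel] at hx ⊢
      rw [hx, Nat.succ_eq_add_one, erase_geomSet_left h0 ht hg] at himp
      rw [hH n m (by omega) _ hinj himp, hx, prod_removal_left h0 ht hz hg]
    · obtain ⟨hn, hx⟩ := h2
      obtain ⟨m, rfl⟩ := Nat.exists_eq_succ_of_ne_zero hn
      simp only [Nat.succ_eq_add_one, Nat.add_sub_cancel] at hx ⊢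
      rw [hx, Nat.succ_eq_add_one, erase_geomSet_right h0 ht hz hg] at himp
      rw [hH n m (by omega) _ hinj himp, hx, prod_removal_right h0 ht hz hg]
    -- If `a p` is not the end of its chain, then `t * a p` is one of the remaining variables and
    -- its factor `r - t * a p` is zero.
    · have hp : a p ∈ geomSet t z n m := him ▸ mem_image_of_mem a (mem_univ p)
      rw [prod_eq_zero (i := t * a p) ?_ (by simp), zero_mul]
      have hne : t * a p ≠ a p := by
        have : a p ≠ 0 := by
          rcases mem_geomSet.1 hp with ⟨i, _, h⟩ | ⟨j, _, h⟩
          · rw [← h]; exact pow_ne_zero _ h0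
          · rw [← h]; exact mul_ne_zero hz (pow_ne_zero _ h0)
        intro h
        have : t = 1 := mul_right_cancel₀ this (by rw [h, one_mul])
        rw [this] at ht; simp at ht
      rw [mem_erase]
      refine ⟨hne, mem_geomSet.2 ?_⟩
      rcases mem_geomSet.1 hp with ⟨i, hi, h⟩ | ⟨j, hj, h⟩
      · refine Or.inl ⟨i + 1, ?_, by rw [← h]; ring⟩
        by_contra hcon
        exact h1 ⟨by omega, by rw [← h]; congr 1; omega⟩
      · refine Or.inr ⟨j + 1, ?_, by rw [← h]; ring⟩
        by_contra hcon
        exact h2 ⟨by omega, by rw [← h]; congr 2; omega⟩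
  rw [sum_congr rfl fun p _ => hterm p, ← sum_image (f := G) fun _ _ _ _ h => ha h, him,
    sum_geomSet h0 ht hz hg]
  congr 1
  · cases n with
    | zero => simp [stepLeft]
    | succ n =>
      rw [sum_range_succ, sum_eq_zero, zero_add]
      · simp [hG]
      · intro i hi
        rw [hG]
        simp only
        rw [if_neg, if_neg]
        · rintro ⟨-, h⟩; exact hg _ _ h.symm
        · rintro ⟨-, h⟩
          have := pow_injective_of_abs_lt_one h0 ht h
          have := mem_range.1 hi
          omega
  · cases m with
    | zero => simp [stepRight]
    | succ m =>
      rw [sum_range_succ, sum_eq_zero, zero_add]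
      · rw [hG]
        simp only
        rw [if_neg, if_pos ⟨by omega, rfl⟩]
        rintro ⟨-, h⟩; exact hg _ _ h
      · intro i hi
        rw [hG]
        simp only
        rw [if_neg, if_neg]
        · rintro ⟨-, h⟩
          have := pow_injective_of_abs_lt_one h0 ht (mul_left_cancel₀ hz h)
          have := mem_range.1 hi
          omega
        · rintro ⟨-, h⟩; exact hg _ _ h

/-- The basic functions in which the symmetrized sums are expanded. -/
noncomputable def stepBasis (s t z : ℝ) (j n m : ℕ) : ℝ :=
  ∏ r ∈ range j, ((1 - t ^ m * s ^ r) * (z - t ^ n * s ^ r) / (1 - t ^ (n + m) * s ^ r))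

theorem one_sub_pow_mul_ne_zero {s t : ℝ} (hst : s * t = 1) (ht : |t| < 1) {N r : ℕ}
    (h : r < N) : 1 - t ^ N * s ^ r ≠ 0 := by
  obtain ⟨d, rfl⟩ := Nat.exists_eq_add_of_lt h
  have : t ^ (r + d + 1) * s ^ r = t ^ (d + 1) := by
    have h1 : s ^ r * t ^ r = 1 := by rw [← mul_pow, hst, one_pow]
    linear_combination t ^ (d + 1) * h1
  rw [this]
  exact one_sub_pow_succ_ne_zero ht d

theorem stepBasis_succ (s t z : ℝ) (j n m : ℕ) : stepBasis s t z (j + 1) n m =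
    stepBasis s t z j n m *
      ((1 - t ^ m * s ^ j) * (z - t ^ n * s ^ j) / (1 - t ^ (n + m) * s ^ j)) :=
  prod_range_succ _ _

theorem mul_div_cross_eq {x l y m g p q e f : ℝ} (he : e ≠ 0) (hf : f ≠ 0)
    (h : x * l * f = m * y * g) : x * (l * (p * q / e)) * e = m * (p * y / f) * q * g := by
  field_simp
  linear_combination p * q * h

/-- Because `st = 1`, lowering `n` by one is the same as shifting `r` by one in the factors `z - t^n
s^r` and `1 - t^{n+m} s^r`. Hence only the factors at the two ends change. The next lemma does the
same for `m`. -/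
theorem stepBasis_pred_left {s t z : ℝ} (hst : s * t = 1) (ht : |t| < 1) {n m j : ℕ}
    (hj : j ≤ n + m) :
    (z - t ^ (n + 1)) * stepBasis s t z j n m * (1 - t ^ (n + 1 + m) * s ^ j) =
      stepBasis s t z j (n + 1) m * (z - t ^ (n + 1) * s ^ j) * (1 - t ^ (n + 1 + m)) := by
  induction j with
  | zero => simp [stepBasis]
  | succ j ih =>
    have e1 : t ^ (n + 1) * s ^ (j + 1) = t ^ n * s ^ j := by
      linear_combination t ^ n * s ^ j * hst
    have e2 : t ^ (n + 1 + m) * s ^ (j + 1) = t ^ (n + m) * s ^ j := by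
      linear_combination t ^ (n + m) * s ^ j * hst
    rw [stepBasis_succ, stepBasis_succ, e1, e2]
    exact mul_div_cross_eq (one_sub_pow_mul_ne_zero hst ht (by omega))
      (one_sub_pow_mul_ne_zero hst ht (by omega)) (ih (by omega))

theorem stepBasis_pred_right {s t z : ℝ} (hst : s * t = 1) (ht : |t| < 1) {n m j : ℕ}
    (hj : j ≤ n + m) :
    (1 - t ^ (m + 1)) * stepBasis s t z j n m * (1 - t ^ (n + (m + 1)) * s ^ j) =
      stepBasis s t z j n (m + 1) * (1 - t ^ (m + 1) * s ^ j) * (1 - t ^ (n + (m + 1))) := by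
  induction j with
  | zero => simp [stepBasis]
  | succ j ih =>
    have e1 : t ^ (m + 1) * s ^ (j + 1) = t ^ m * s ^ j := by
      linear_combination t ^ m * s ^ j * hst
    have e2 : t ^ (n + (m + 1)) * s ^ (j + 1) = t ^ (n + m) * s ^ j := by
      linear_combination t ^ (n + m) * s ^ j * hst
    rw [stepBasis_succ, stepBasis_succ, e1, e2, mul_comm (1 - t ^ m * s ^ j),
      mul_comm (1 - t ^ (m + 1) * s ^ j) (z - _)]
    exact mul_div_cross_eq (one_sub_pow_mul_ne_zero hst ht (by omega))
      (one_sub_pow_mul_ne_zero hst ht (by omega)) (ih (by omega))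

/-- The functions `stepBasis` are eigenfunctions of the removal recursion, and the eigenvalue does
not depend on `j`. An expansion in them therefore keeps its coefficients when zero parts are added;
only the `t`-factorial in front grows. -/
theorem stepBasis_step {s t z : ℝ} (hst : s * t = 1) (ht : |t| < 1)
    (hg : ∀ i j : ℕ, z * t ^ i ≠ t ^ j) {n m N j : ℕ} (hN : n + m = N + 1) (hj : j ≤ N) :
    stepLeft t z n m * stepBasis s t z j (n - 1) m + stepRight t z n m * stepBasis s t z j n (m - 1)
      = (1 - t ^ (N + 1)) / (1 - t) * stepBasis s t z j n m := by
  have h3 : 1 - t ≠ 0 := by simpa using one_sub_pow_succ_ne_zero ht 0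
  have h4 := one_sub_pow_mul_ne_zero hst ht (N := N + 1) (r := j) (by omega)
  have h5 : z * t ^ m - t ^ n ≠ 0 := sub_ne_zero.2 (hg _ _)
  have h5' : t ^ n - z * t ^ m ≠ 0 := sub_ne_zero.2 (hg _ _).symm
  -- For `n = 0` the truncated `n - 1` does not matter because of the factor `1 - t^n`; likewise for
  -- `m` in the next step.
  have h6 : (1 - t ^ n) * (z - t ^ n) * stepBasis s t z j (n - 1) m * (1 - t ^ (N + 1) * s ^ j) =
      (1 - t ^ n) * (stepBasis s t z j n m * (z - t ^ n * s ^ j) * (1 - t ^ (N + 1))) := by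
    cases n with
    | zero => simp
    | succ n =>
      rw [← hN, Nat.add_sub_cancel]
      linear_combination (1 - t ^ (n + 1)) *
        stepBasis_pred_left (z := z) hst ht (n := n) (m := m) (j := j) (by omega)
  have h7 : (1 - t ^ m) * stepBasis s t z j n (m - 1) * (1 - t ^ (N + 1) * s ^ j) =
      stepBasis s t z j n m * (1 - t ^ m * s ^ j) * (1 - t ^ (N + 1)) := by
    cases m with
    | zero =>
      cases j with
      | zero => simp
      | succ j => simp [stepBasis, prod_range_succ']
    | succ m =>
      rw [← hN, Nat.add_sub_cancel]
      exact stepBasis_pred_right hst ht (by omega)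
  have hAB : t ^ (N + 1) = t ^ n * t ^ m := by rw [← hN, pow_add]
  rw [stepLeft, stepRight]
  have h8 : t ^ n - z * t ^ m = -(z * t ^ m - t ^ n) := by ring
  have h9 : (z * t ^ m - t ^ n) * (1 - t ^ (N + 1) * s ^ j) = t ^ m * (1 - t ^ n) *
      (z - t ^ n * s ^ j) - (1 - z * t ^ m) * t ^ n * (1 - t ^ m * s ^ j) := by
    rw [hAB]; ring
  rw [h8]
  generalize t ^ (N + 1) * s ^ j = w at *
  generalize t ^ (N + 1) = v at *
  generalize stepBasis s t z j n m = x at *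
  generalize stepBasis s t z j n (m - 1) = y at *
  generalize stepBasis s t z j (n - 1) m = y' at *
  generalize z * t ^ m - t ^ n = d at *
  have h10 : t ^ m * ((1 - t ^ n) * (z - t ^ n) * y') - (1 - z * t ^ m) * t ^ n *
      ((1 - t ^ m) * y) = (1 - v) * x * d := by
    apply mul_right_cancel₀ h4
    linear_combination t ^ m * h6 - (1 - z * t ^ m) * t ^ n * h7 - (1 - v) * x * h9
  field_simp
  linear_combination h10

end GeometricEval


/-! ### Closed formula for the symmetrized sum on two chains. -/

section SymmetrizedFormula

open Finset

/-- Both sides are compared through `gaussBinom_mul_prod`, using `s^N t^r - 1 = s^N t^r (1 - t^N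
s^r)`. This removes the denominators of `stepBasis` by passing from `[n+m choose i]` to `[m choose
i]`. -/
theorem gaussBinom_mul_prod_one_sub {s t : ℝ} (hst : s * t = 1) (ht : |t| < 1) (n m i : ℕ) :
    gaussBinom s (n + m) i * ∏ r ∈ range i, (1 - t ^ m * s ^ r) =
      gaussBinom s m i * s ^ (n * i) * ∏ r ∈ range i, (1 - t ^ (n + m) * s ^ r) := by
  have hQ : ∏ r ∈ range i, (s ^ (r + 1) - 1) ≠ 0 := by
    refine prod_ne_zero_iff.2 fun r _ h => one_sub_pow_succ_ne_zero ht r ?_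
    have h1 : s ^ (r + 1) * t ^ (r + 1) = 1 := by rw [← mul_pow, hst, one_pow]
    linear_combination t ^ (r + 1) * h - h1
  have h1 : ∀ N, ∏ r ∈ range i, (s ^ N * t ^ r - 1) =
      s ^ (N * i) * (∏ r ∈ range i, t ^ r) * ∏ r ∈ range i, (1 - t ^ N * s ^ r) := by
    intro N
    have : s ^ (N * i) = ∏ r ∈ range i, s ^ N := by simp [pow_mul]
    rw [this, ← prod_mul_distrib, ← prod_mul_distrib]
    refine prod_congr rfl fun r _ => ?_
    have h2 : s ^ N * t ^ N = 1 := by rw [← mul_pow, hst, one_pow]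
    have h3 : s ^ r * t ^ r = 1 := by rw [← mul_pow, hst, one_pow]
    linear_combination s ^ r * t ^ r * h2 + h3
  have h2 := gaussBinom_mul_prod hst (n + m) i
  have h3 := gaussBinom_mul_prod hst m i
  rw [h1] at h2 h3
  apply mul_right_cancel₀ hQ
  rw [add_mul, pow_add] at h2
  linear_combination (∏ r ∈ range i, (1 - t ^ m * s ^ r)) * h2 -
    s ^ (n * i) * (∏ r ∈ range i, (1 - t ^ (n + m) * s ^ r)) * h3

/-- Once the denominators are cancelled, this is Cauchy's expansion of `(z s^n)^m` in Newton's
basis. -/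
theorem sum_gaussBinom_mul_stepBasis {s t : ℝ} (hst : s * t = 1) (ht : |t| < 1) (z : ℝ)
    (n m : ℕ) : ∑ i ∈ range (n + m + 1), gaussBinom s (n + m) i * stepBasis s t z i n m =
      z ^ m * s ^ (n * m) := by
  have h1 : ∀ i ∈ range (n + m + 1), gaussBinom s (n + m) i * stepBasis s t z i n m =
      gaussBinom s m i * ∏ r ∈ range i, (z * s ^ n - s ^ r) := by
    intro i hi
    have hne : ∏ r ∈ range i, (1 - t ^ (n + m) * s ^ r) ≠ 0 := prod_ne_zero_iff.2 fun r hr =>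
      one_sub_pow_mul_ne_zero hst ht (by
        have := mem_range.1 hi; have := mem_range.1 hr; omega)
    have e : ∏ r ∈ range i, (z * s ^ n - s ^ r) =
        s ^ (n * i) * ∏ r ∈ range i, (z - t ^ n * s ^ r) := by
      have : s ^ (n * i) = ∏ r ∈ range i, s ^ n := by simp [pow_mul]
      rw [this, ← prod_mul_distrib]
      refine prod_congr rfl fun r _ => ?_
      have h2 : s ^ n * t ^ n = 1 := by rw [← mul_pow, hst, one_pow]
      linear_combination s ^ r * h2
    rw [stepBasis, prod_div_distrib, prod_mul_distrib, e, ← mul_div_assoc, div_eq_iff hne]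
    linear_combination (∏ r ∈ range i, (z - t ^ n * s ^ r)) *
      gaussBinom_mul_prod_one_sub hst ht n m i
  rw [sum_congr rfl h1, show n + m + 1 = (m + 1) + n by ring, sum_range_add,
    sum_gaussBinom_mul_prod_sub, sum_eq_zero (s := range n)]
  · ring
  · intro i _
    rw [gaussBinom_eq_zero s (by omega), zero_mul]

theorem stepBasis_eq_zero {s t : ℝ} (hst : s * t = 1) (z : ℝ) {j n m : ℕ} (h : m < j) :
    stepBasis s t z j n m = 0 := by
  refine prod_eq_zero (mem_range.2 h) ?_
  rw [← mul_pow, mul_comm t s, hst]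
  simp

/-- The factors with index `k + r` are those with index `r` for `m - k` in place of `m` and `z t^k`
in place of `z`, up to a power of `s`. This reduces the action of a column to
`sum_gaussBinom_mul_stepBasis`. -/
theorem stepBasis_add {s t : ℝ} (hst : s * t = 1) (z : ℝ) (k i n m : ℕ) :
    stepBasis s t z (k + i) n (k + m) =
      stepBasis s t z k n (k + m) * s ^ (k * i) * stepBasis s t (z * t ^ k) i n m := by
  have : s ^ (k * i) = ∏ r ∈ range i, s ^ k := by simp [pow_mul]
  rw [stepBasis, prod_range_add, mul_assoc, this, stepBasis, stepBasis, ← prod_mul_distrib]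
  congr 1
  refine prod_congr rfl fun r _ => ?_
  have h1 : s ^ k * t ^ k = 1 := by rw [← mul_pow, hst, one_pow]
  have e1 : t ^ (k + m) * s ^ (k + r) = t ^ m * s ^ r := by
    linear_combination t ^ m * s ^ r * h1
  have e2 : t ^ (n + (k + m)) * s ^ (k + r) = t ^ (n + m) * s ^ r := by
    linear_combination t ^ (n + m) * s ^ r * h1
  have e3 : z - t ^ n * s ^ (k + r) = s ^ k * (z * t ^ k - t ^ n * s ^ r) := by
    linear_combination -z * h1
  rw [e1, e2, e3]
  ring

/-- The effect of adding a column on the expansion in `stepBasis`. -/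
theorem stepBasis_column {s t : ℝ} (hst : s * t = 1) (ht : |t| < 1) (z : ℝ) {n m k : ℕ}
    (hk : k ≤ n + m) : z ^ m * s ^ (n * m) * stepBasis s t z k n m =
      z ^ k * ∑ j ∈ range (n + m + 1), colCoeff s (n + m) k j * stepBasis s t z j n m := by
  rcases lt_or_ge m k with h | h
  · rw [stepBasis_eq_zero hst z h, mul_zero, sum_eq_zero, mul_zero]
    intro j _
    rcases lt_or_ge j k with h' | h'
    · rw [colCoeff_of_lt s h', zero_mul]
    · rw [stepBasis_eq_zero hst z (by omega), mul_zero]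
  · obtain ⟨m, rfl⟩ := Nat.exists_eq_add_of_le h
    rw [show n + (k + m) + 1 = k + (n + m + 1) by ring, sum_range_add, sum_eq_zero, zero_add]
    -- Terms with `j < k` vanish. With `j = k + i`, the common factor `stepBasis s t z k` comes out
    -- and a full Gaussian sum with parameter `z t^k` remains.
    · have h1 : ∀ i ∈ range (n + m + 1), colCoeff s (n + (k + m)) k (k + i) *
          stepBasis s t z (k + i) n (k + m) = stepBasis s t z k n (k + m) * s ^ (k * (n + m)) *
          (gaussBinom s (n + m) i * stepBasis s t (z * t ^ k) i n m) := by
        intro i hi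
        rw [stepBasis_add hst, colCoeff, if_pos (by omega), Nat.add_sub_cancel_left,
          show n + (k + m) - k = n + m by omega,
          show n + (k + m) - (k + i) = n + m - i by omega]
        have : s ^ (k * (n + m)) = s ^ (k * (n + m - i)) * s ^ (k * i) := by
          rw [← pow_add, ← mul_add]
          congr 2
          have := mem_range.1 hi
          omega
        rw [this]
        ring
      rw [sum_congr rfl h1, ← mul_sum, sum_gaussBinom_mul_stepBasis hst ht]
      have h2 : s ^ (k * m) * t ^ (k * m) = 1 := by rw [← mul_pow, hst, one_pow]
      have e : (z * t ^ k) ^ m = z ^ m * t ^ (k * m) := by ring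
      rw [e]
      linear_combination (-z ^ (k + m) * s ^ (n * (k + m)) * stepBasis s t z k n (k + m)) * h2
    · intro j hj
      rw [colCoeff_of_lt s (mem_range.1 hj), zero_mul]

/-- The `i`-th row length of the diagram with columns `c 0, …, c (r - 1)`. -/
def rowOfCols (c : ℕ → ℕ) (r i : ℕ) : ℕ := ∑ k ∈ range r, if i < c k then 1 else 0

/-- The `t`-factorial `∏_{k=1}^N (1 - t^k) / (1 - t)`. -/
noncomputable def qFactorial (t : ℝ) (N : ℕ) : ℝ := ∏ k ∈ range N, (1 - t ^ (k + 1)) / (1 - t)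

theorem qFactorial_succ (t : ℝ) (N : ℕ) :
    qFactorial t (N + 1) = qFactorial t N * ((1 - t ^ (N + 1)) / (1 - t)) :=
  prod_range_succ _ _

theorem rowOfCols_eq_zero {c : ℕ → ℕ} (hc : Antitone c) {r i : ℕ} (h : c 0 ≤ i) :
    rowOfCols c r i = 0 :=
  sum_eq_zero fun k _ => if_neg (by have := hc (Nat.zero_le k); omega)

theorem rowOfCols_succ (c : ℕ → ℕ) (r : ℕ) {i : ℕ} (h : i < c 0) :
    rowOfCols c (r + 1) i = rowOfCols (fun k => c (k + 1)) r i + 1 := by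
  rw [rowOfCols, sum_range_succ', if_pos h, rowOfCols]

/-- The symmetrized sum at the variables `1, t, …, t^{n-1}, z, z t, …, z t^{m-1}`. -/
theorem orderSum_geomSet {s t z : ℝ} (hst : s * t = 1) (ht : |t| < 1) (hz : z ≠ 0)
    (hg : ∀ i j : ℕ, z * t ^ i ≠ t ^ j) (r : ℕ) {c : ℕ → ℕ} (hc : Antitone c) {N : ℕ}
    (hN : c 0 ≤ N) {n m : ℕ} (hnm : n + m = N) {a : Fin N → ℝ} (ha : Function.Injective a)
    (him : univ.image a = geomSet t z n m) :
    orderSum t a (fun i => rowOfCols c r (N - 1 - i)) = qFactorial t N *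
      t ^ (∑ k ∈ range r, ∑ i ∈ range (c k), i) *
      ∑ k ∈ range (c 0 + 1), columnCoeff s z c r k * stepBasis s t z k n m := by
  have h0 : t ≠ 0 := right_ne_zero_of_mul (hst ▸ one_ne_zero)
  -- The formula passes from `N₀` to all `N ≥ N₀` variables by adding zero parts. It remains to
  -- treat exactly `c 0` variables, where every row is nonempty and a full column can be taken off.
  have extend : ∀ (r : ℕ) (c : ℕ → ℕ), Antitone c → ∀ N₀, c 0 ≤ N₀ →
      (∀ n m, n + m = N₀ → ∀ a : Fin N₀ → ℝ, Function.Injective a →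
      univ.image a = geomSet t z n m →
      orderSum t a (fun i => rowOfCols c r (N₀ - 1 - i)) = qFactorial t N₀ *
      t ^ (∑ k ∈ range r, ∑ i ∈ range (c k), i) *
      ∑ k ∈ range (c 0 + 1), columnCoeff s z c r k * stepBasis s t z k n m) →
      ∀ N, N₀ ≤ N → ∀ n m, n + m = N → ∀ a : Fin N → ℝ, Function.Injective a →
      univ.image a = geomSet t z n m →
      orderSum t a (fun i => rowOfCols c r (N - 1 - i)) = qFactorial t N *
      t ^ (∑ k ∈ range r, ∑ i ∈ range (c k), i) *
      ∑ k ∈ range (c 0 + 1), columnCoeff s z c r k * stepBasis s t z k n m := by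
    intro r c hc N₀ hN₀ h N hN
    induction N, hN using Nat.le_induction with
    | base => exact h
    | succ N hN ih =>
      intro n m hnm a ha him
      rw [orderSum_extend h0 ht hz hg (rowOfCols_eq_zero hc (hN₀.trans hN)) ih hnm ha him]
      have e : ∑ k ∈ range (c 0 + 1), columnCoeff s z c r k * ((1 - t ^ (N + 1)) / (1 - t) *
          stepBasis s t z k n m) = ∑ k ∈ range (c 0 + 1), columnCoeff s z c r k *
          (stepLeft t z n m * stepBasis s t z k (n - 1) m +
            stepRight t z n m * stepBasis s t z k n (m - 1)) := by
        refine sum_congr rfl fun k hk => ?_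
        rw [stepBasis_step hst ht hg hnm (by have := mem_range.1 hk; omega)]
      rw [qFactorial_succ]
      have e2 : ∑ k ∈ range (c 0 + 1), columnCoeff s z c r k * ((1 - t ^ (N + 1)) / (1 - t) *
          stepBasis s t z k n m) = (1 - t ^ (N + 1)) / (1 - t) *
          ∑ k ∈ range (c 0 + 1), columnCoeff s z c r k * stepBasis s t z k n m := by
        rw [mul_sum]; exact sum_congr rfl fun k _ => by ring
      have e3 : ∑ k ∈ range (c 0 + 1), columnCoeff s z c r k *
          (stepLeft t z n m * stepBasis s t z k (n - 1) m +
            stepRight t z n m * stepBasis s t z k n (m - 1)) =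
          stepLeft t z n m *
          (∑ k ∈ range (c 0 + 1), columnCoeff s z c r k * stepBasis s t z k (n - 1) m) +
          stepRight t z n m *
          ∑ k ∈ range (c 0 + 1), columnCoeff s z c r k * stepBasis s t z k n (m - 1) := by
        rw [mul_sum, mul_sum, ← sum_add_distrib]; exact sum_congr rfl fun k _ => by ring
      rw [e2, e3] at e
      linear_combination -(qFactorial t N * t ^ (∑ k ∈ range r, ∑ i ∈ range (c k), i)) * e
  induction r generalizing c N n m with
  | zero =>
    have hz' : ∀ n m, ∑ k ∈ range (c 0 + 1), columnCoeff s z c 0 k * stepBasis s t z k n m = 1 := by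
      intro n m
      rw [sum_range_succ', sum_eq_zero]
      · simp [columnCoeff, stepBasis]
      · intro k _; simp [columnCoeff]
    have := extend 0 (fun _ => 0) (fun _ _ _ => le_rfl) 0 le_rfl (by
      intro n m _ a _ _
      simp [orderSum, qFactorial, columnCoeff, stepBasis]) N (Nat.zero_le N) n m hnm a ha him
    rw [hz']
    simpa [rowOfCols, columnCoeff, stepBasis] using this
  | succ r ih =>
    refine extend (r + 1) c hc (c 0) le_rfl ?_ N hN n m hnm a ha him
    clear hnm him ha a n m
    intro n m hnm a ha him
    have hc1 : c 1 ≤ c 0 := hc (by omega)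
    have h1 := ih (c := fun k => c (k + 1)) (fun i j h => hc (by omega)) (by simpa using hc1)
      hnm ha him
    have h2 : (fun i : Fin (c 0) => rowOfCols c (r + 1) (c 0 - 1 - i)) =
        fun i : Fin (c 0) => rowOfCols (fun k => c (k + 1)) r (c 0 - 1 - i) + 1 := by
      funext i
      exact rowOfCols_succ c r (by have := i.2; omega)
    rw [h2, orderSum_add_one, h1, ← prod_image (f := fun x => x) fun _ _ _ _ h => ha h, him,
      prod_geomSet h0 ht hz hg, prod_mul_distrib, prod_pow_eq_pow_sum, prod_pow_eq_pow_sum,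
      prod_const, card_range, sum_range_succ' (fun k => ∑ i ∈ range (c k), i), pow_add]
    -- The product of all variables is `z^m` times the first two powers of `t` here. The missing
    -- `t^{nm}` is compensated by the `s^{nm}` in `stepBasis_column`.
    have h3 : t ^ (∑ i ∈ range (c 0), i) =
        t ^ (∑ i ∈ range n, i) * t ^ (∑ i ∈ range m, i) * t ^ (n * m) := by
      rw [← hnm, sum_range_add, sum_add_distrib, sum_const, card_range, smul_eq_mul]
      ring
    have h4 : s ^ (n * m) * t ^ (n * m) = 1 := by rw [← mul_pow, hst, one_pow]
    have h5 : z ^ m * s ^ (n * m) * ∑ k ∈ range (c (0 + 1) + 1),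
        columnCoeff s z (fun k => c (k + 1)) r k * stepBasis s t z k n m =
        ∑ k ∈ range (c 0 + 1), columnCoeff s z c (r + 1) k * stepBasis s t z k n m := by
      have h6 : ∑ k ∈ range (c (0 + 1) + 1),
          columnCoeff s z (fun k => c (k + 1)) r k * stepBasis s t z k n m =
          ∑ k ∈ range (c 0 + 1),
          columnCoeff s z (fun k => c (k + 1)) r k * stepBasis s t z k n m := by
        refine sum_subset (range_mono (by simp only [zero_add]; omega)) fun k _ hk => ?_
        rw [columnCoeff_eq_zero s z (by simpa using hk), zero_mul]
      rw [h6, mul_sum]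
      simp only [columnCoeff, sum_mul]
      rw [sum_comm]
      refine sum_congr rfl fun k hk => ?_
      have h7 := stepBasis_column hst ht z (n := n) (m := m) (k := k)
        (by have := mem_range.1 hk; omega)
      rw [hnm] at h7
      rw [mul_left_comm, h7, mul_sum, mul_sum]
      exact sum_congr rfl fun j _ => by ring
    rw [← h5, h3]
    generalize ∑ k ∈ range (c (0 + 1) + 1),
      columnCoeff s z (fun k => c (k + 1)) r k * stepBasis s t z k n m = w
    generalize t ^ (∑ k ∈ range r, ∑ i ∈ range (c (k + 1)), i) = v
    generalize t ^ (∑ i ∈ range n, i) = v1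
    generalize t ^ (∑ i ∈ range m, i) = v2
    linear_combination (-v1 * v2 * v * qFactorial t (c 0) * w * z ^ m) * h4

end SymmetrizedFormula


/-! ### Infinitely many variables. -/

section HallLittlewoodLimit

open Finset Filter Topology

theorem rowOfCols_colLen (ν : YoungDiagram) (i : ℕ) :
    rowOfCols ν.colLen (ν.rowLen 0) i = ν.rowLen i := by
  have h : ∀ k, i < ν.colLen k ↔ k < ν.rowLen i := fun k => by
    rw [← YoungDiagram.mem_iff_lt_colLen, ← YoungDiagram.mem_iff_lt_rowLen]
  simp only [rowOfCols, h]
  rw [sum_boole]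
  have : ({k ∈ range (ν.rowLen 0) | k < ν.rowLen i} : Finset ℕ) = range (ν.rowLen i) := by
    ext k
    have := ν.rowLen_anti 0 i (Nat.zero_le _)
    simp only [mem_filter, mem_range]
    omega
  simp [this]

theorem hallLittlewoodNorm_eq (n : ℕ) (ν : YoungDiagram) (t : ℝ) :
    hallLittlewoodNorm n ν t =
      ∏ i ∈ range (ν.rowLen 0 + 1), qFactorial t #{j ∈ range n | ν.rowLen j = i} := by
  refine prod_congr rfl fun i _ => ?_
  rw [qFactorial]
  congr 2
  refine card_bij (fun j _ => (j : ℕ)) ?_ ?_ ?_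
  · intro j hj; simpa using hj
  · intro i _ j _ h; exact Fin.ext h
  · intro j hj
    rw [mem_filter, mem_range] at hj
    exact ⟨⟨j, hj.1⟩, by simpa using hj.2, rfl⟩

theorem qFactorial_eq (t : ℝ) (N : ℕ) : qFactorial t N = qPoch 1 t N / (1 - t) ^ N := by
  rw [qFactorial, prod_div_distrib, qPoch]
  simp

theorem qFactorial_ne_zero {t : ℝ} (ht : |t| < 1) (N : ℕ) : qFactorial t N ≠ 0 := by
  have h1 : (1 : ℝ) - t ≠ 0 := by simpa using one_sub_pow_succ_ne_zero ht 0
  exact prod_ne_zero_iff.2 fun k _ => div_ne_zero (one_sub_pow_succ_ne_zero ht k) h1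

/-- In the normalizing constant only the multiplicity `N - l` of the part `0` depends on `N`. The
quotient of the factorials of `N` and `N - l` tends to `(1 - t)^{-l}`. -/
theorem tendsto_qFactorial_div_norm {t : ℝ} (ht : |t| < 1) (ν : YoungDiagram) :
    ∃ L : ℝ, L ≠ 0 ∧
      Tendsto (fun N => (hallLittlewoodNorm N ν t)⁻¹ * qFactorial t N) atTop (𝓝 L) := by
  have h1 : |(1 : ℝ) * t| < 1 := by simpa using ht
  have h2 : (1 : ℝ) - t ≠ 0 := by simpa using one_sub_pow_succ_ne_zero ht 0
  obtain ⟨hg, hg0⟩ := tendsto_qPoch ht h1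
  set g := ∏' j : ℕ, (1 - 1 * t ^ (j + 1))
  set l := ν.colLen 0 with hl
  set V := ∏ i ∈ range (ν.rowLen 0), qFactorial t #{j ∈ range l | ν.rowLen j = i + 1} with hV
  have hV0 : V ≠ 0 := prod_ne_zero_iff.2 fun i _ => qFactorial_ne_zero ht _
  refine ⟨(1 - t)⁻¹ ^ l * V⁻¹, mul_ne_zero (pow_ne_zero _ (inv_ne_zero h2)) (inv_ne_zero hV0), ?_⟩
  rw [← tendsto_add_atTop_iff_nat l]
  have hnorm : ∀ N, hallLittlewoodNorm (N + l) ν t = V * qFactorial t N := by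
    intro N
    rw [hallLittlewoodNorm_eq, prod_range_succ']
    congr 1
    · refine prod_congr rfl fun i _ => ?_
      congr 2
      ext j
      simp only [mem_filter, mem_range]
      refine ⟨fun h => ⟨?_, h.2⟩, fun h => ⟨by omega, h.2⟩⟩
      by_contra hj
      have := YoungDiagram.rowLen_eq_zero_iff.2 (not_lt.1 hj)
      omega
    · congr 1
      have : ({j ∈ range (N + l) | ν.rowLen j = 0} : Finset ℕ) = Ico l (N + l) := by
        ext j
        rw [mem_filter, mem_range, mem_Ico, YoungDiagram.rowLen_eq_zero_iff]
        tauto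
      rw [this]; simp
  have hlim : Tendsto (fun N => (1 - t)⁻¹ ^ l * V⁻¹ * (qPoch 1 t (N + l) / qPoch 1 t N)) atTop
      (𝓝 ((1 - t)⁻¹ ^ l * V⁻¹ * (g / g))) :=
    ((((tendsto_add_atTop_iff_nat l).2 hg).div hg hg0.ne')).const_mul _
  rw [div_self hg0.ne', mul_one] at hlim
  refine hlim.congr fun N => ?_
  have h3 := (qPoch_pos ht h1 N).ne'
  have h4 : (1 - t) ^ N ≠ 0 := pow_ne_zero _ h2
  rw [hnorm, qFactorial_eq, qFactorial_eq, pow_add, inv_pow]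
  field_simp

/-- The variables `1, z, t, z t, t², …`. -/
theorem image_interleave (t z : ℝ) (N : ℕ) :
    univ.image (fun i : Fin N => interleave (fun k => t ^ k) (fun k => z * t ^ k) i) =
      geomSet t z ((N + 1) / 2) (N / 2) := by
  ext x
  simp only [mem_image, mem_univ, true_and, mem_geomSet, interleave]
  constructor
  · rintro ⟨i, rfl⟩
    have := i.2
    split_ifs with h
    · exact Or.inl ⟨i / 2, by rcases h with ⟨r, hr⟩; omega, rfl⟩
    · exact Or.inr ⟨i / 2, by rcases Nat.not_even_iff_odd.1 h with ⟨r, hr⟩; omega, rfl⟩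
  · rintro (⟨k, hk, rfl⟩ | ⟨k, hk, rfl⟩)
    · refine ⟨⟨2 * k, by omega⟩, ?_⟩
      simp
    · refine ⟨⟨2 * k + 1, by omega⟩, ?_⟩
      have : ¬ Even (2 * k + 1) := by simp
      simp only [this, if_false]
      congr 2
      omega

theorem injective_interleave {t z : ℝ} (h0 : t ≠ 0) (ht : |t| < 1) (hz : z ≠ 0)
    (hg : ∀ i j : ℕ, z * t ^ i ≠ t ^ j) :
    Function.Injective (interleave (fun k => t ^ k) (fun k => z * t ^ k)) := by
  intro i j h
  simp only [interleave] at h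
  split_ifs at h with h1 h2 h2
  · have := pow_injective_of_abs_lt_one h0 ht h
    rcases h1 with ⟨a, ha⟩; rcases h2 with ⟨b, hb⟩
    omega
  · exact absurd h.symm (hg _ _)
  · exact absurd h (hg _ _)
  · have := pow_injective_of_abs_lt_one h0 ht (mul_left_cancel₀ hz h)
    rcases Nat.not_even_iff_odd.1 h1 with ⟨a, ha⟩
    rcases Nat.not_even_iff_odd.1 h2 with ⟨b, hb⟩
    omega

/-- Only countably many `z` make two variables coincide or one of the second chain vanish. -/
theorem dense_generic {t : ℝ} (h0 : t ≠ 0) :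
    Dense {z : ℝ | z ≠ 0 ∧ ∀ i j : ℕ, z * t ^ i ≠ t ^ j} := by
  have h : {z : ℝ | z ≠ 0 ∧ ∀ i j : ℕ, z * t ^ i ≠ t ^ j} =
      (insert 0 (Set.range fun p : ℕ × ℕ => t ^ p.2 / t ^ p.1))ᶜ := by
    ext z
    simp only [Set.mem_ofPred_eq, Set.mem_compl_iff, Set.mem_insert_iff, Set.mem_range, Prod.exists,
      not_or, not_exists]
    refine and_congr_right fun _ => forall_congr' fun i => forall_congr' fun j => not_congr ?_
    rw [div_eq_iff (pow_ne_zero _ h0)]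
    exact eq_comm
  rw [h]
  exact ((Set.countable_range _).insert 0).dense_compl ℝ

theorem eval_hallLittlewood_geomSet {s t z : ℝ} (hst : s * t = 1) (ht : |t| < 1) (hz : z ≠ 0)
    (hg : ∀ i j : ℕ, z * t ^ i ≠ t ^ j) (ν : YoungDiagram) {N : ℕ} (hN : ν.colLen 0 ≤ N)
    {n m : ℕ} (hnm : n + m = N) {a : Fin N → ℝ} (ha : Function.Injective a)
    (him : univ.image a = geomSet t z n m) :
    MvPolynomial.eval a (hallLittlewood N ν t) = (hallLittlewoodNorm N ν t)⁻¹ * (qFactorial t N *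
      t ^ (∑ k ∈ range (ν.rowLen 0), ∑ i ∈ range (ν.colLen k), i) *
      ∑ k ∈ range (ν.colLen 0 + 1), columnCoeff s z ν.colLen (ν.rowLen 0) k *
        stepBasis s t z k n m) := by
  rw [eval_hallLittlewood ν t ha, orderSum_rev,
    ← orderSum_geomSet hst ht hz hg (ν.rowLen 0) (fun i j h => ν.colLen_anti i j h) hN hnm ha him]
  congr 2
  funext i
  rw [rowOfCols_colLen, Fin.val_rev]
  congr 1
  omega

theorem continuous_columnCoeff (s : ℝ) (c : ℕ → ℕ) (r j : ℕ) :
    Continuous fun z => columnCoeff s z c r j := by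
  induction r generalizing c j with
  | zero => exact continuous_const
  | succ r ih =>
    simp only [columnCoeff]
    exact continuous_finsetSum _ fun k _ =>
      ((continuous_pow k).mul continuous_const).mul (ih _ k)

theorem continuous_stepBasis (s t : ℝ) (j n m : ℕ) :
    Continuous fun z => stepBasis s t z j n m := by
  unfold stepBasis
  fun_prop

/-- Both sides are continuous in `z` and agree for generic `z`. This covers values such as `z = 1`,
where variables coincide and the quotients in the symmetrized sum are undefined. Of `N` interleaved
variables, `(N + 1) / 2` are powers of `t`. -/
theorem eval_hallLittlewood_interleave {s t : ℝ} (hst : s * t = 1) (ht : |t| < 1) (z : ℝ)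
    (ν : YoungDiagram) {N : ℕ} (hN : ν.colLen 0 ≤ N) :
    MvPolynomial.eval (fun i : Fin N => interleave (fun k => t ^ k) (fun k => z * t ^ k) i)
      (hallLittlewood N ν t) = (hallLittlewoodNorm N ν t)⁻¹ * (qFactorial t N *
      t ^ (∑ k ∈ range (ν.rowLen 0), ∑ i ∈ range (ν.colLen k), i) *
      ∑ k ∈ range (ν.colLen 0 + 1), columnCoeff s z ν.colLen (ν.rowLen 0) k *
        stepBasis s t z k ((N + 1) / 2) (N / 2)) := by
  have h0 : t ≠ 0 := right_ne_zero_of_mul (hst ▸ one_ne_zero)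
  have hc1 : Continuous fun z : ℝ => MvPolynomial.eval
      (fun i : Fin N => interleave (fun k => t ^ k) (fun k => z * t ^ k) i)
      (hallLittlewood N ν t) := by
    refine (MvPolynomial.continuous_eval _).comp (continuous_pi fun i => ?_)
    simp only [interleave]
    split_ifs <;> fun_prop
  have hc2 : Continuous fun z : ℝ => (hallLittlewoodNorm N ν t)⁻¹ * (qFactorial t N *
      t ^ (∑ k ∈ range (ν.rowLen 0), ∑ i ∈ range (ν.colLen k), i) *
      ∑ k ∈ range (ν.colLen 0 + 1), columnCoeff s z ν.colLen (ν.rowLen 0) k *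
        stepBasis s t z k ((N + 1) / 2) (N / 2)) :=
    continuous_const.mul (continuous_const.mul (continuous_finsetSum _ fun k _ =>
      (continuous_columnCoeff _ _ _ _).mul (continuous_stepBasis _ _ _ _ _)))
  refine congrFun (Continuous.ext_on (dense_generic h0) hc1 hc2 ?_) z
  rintro z ⟨hz, hg⟩
  exact eval_hallLittlewood_geomSet hst ht hz hg ν hN (by omega)
    (fun i j h => Fin.ext (injective_interleave h0 ht hz hg h)) (image_interleave t z N)

theorem tendsto_stepBasis {s t : ℝ} (ht : |t| < 1) (z : ℝ) (j : ℕ) {n m : ℕ → ℕ}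
    (hn : Tendsto n atTop atTop) (hm : Tendsto m atTop atTop) :
    Tendsto (fun N => stepBasis s t z j (n N) (m N)) atTop (𝓝 (z ^ j)) := by
  have hp := tendsto_pow_atTop_nhds_zero_of_abs_lt_one ht
  have h : ∀ r ∈ range j, Tendsto (fun N => (1 - t ^ (m N) * s ^ r) * (z - t ^ (n N) * s ^ r) /
      (1 - t ^ (n N + m N) * s ^ r)) atTop
      (𝓝 ((1 - 0 * s ^ r) * (z - 0 * s ^ r) / (1 - 0 * s ^ r))) := by
    intro r _
    refine Tendsto.div (Tendsto.mul ?_ ?_) ?_ (by simp)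
    · exact ((hp.comp hm).mul_const _).const_sub _
    · exact ((hp.comp hn).mul_const _).const_sub _
    · exact ((hp.comp (hn.atTop_add_nonneg fun N => Nat.zero_le (m N))).mul_const _).const_sub _
  have := tendsto_finsetProd _ h
  simpa [stepBasis] using this

/-- The values of `P_ν` at `1, z, t, z t, …` and at `1, t, t², …`. -/
theorem hasHallLittlewoodValue_geometric {s t : ℝ} (hst : s * t = 1) (ht : |t| < 1) (z : ℝ)
    (ν : YoungDiagram) : ∃ A C : ℝ,
      HasHallLittlewoodValue ν t (interleave (fun k => t ^ k) (fun k => z * t ^ k)) A ∧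
      HasHallLittlewoodValue ν t (fun k => t ^ k) C ∧ C ≠ 0 ∧
      A / C = ∑ j ∈ range (ν.colLen 0 + 1), z ^ j * columnCoeff s z ν.colLen (ν.rowLen 0) j := by
  have h0 : t ≠ 0 := right_ne_zero_of_mul (hst ▸ one_ne_zero)
  obtain ⟨L, hL0, hL⟩ := tendsto_qFactorial_div_norm ht ν
  set E := ∑ k ∈ range (ν.rowLen 0), ∑ i ∈ range (ν.colLen k), i
  have hE : t ^ E ≠ 0 := pow_ne_zero _ h0
  refine ⟨L * t ^ E * ∑ j ∈ range (ν.colLen 0 + 1),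
    columnCoeff s z ν.colLen (ν.rowLen 0) j * z ^ j, L * t ^ E, ?_, ?_, mul_ne_zero hL0 hE, ?_⟩
  · have hn : Tendsto (fun N : ℕ => (N + 1) / 2) atTop atTop :=
      tendsto_atTop.2 fun b => eventually_atTop.2 ⟨2 * b, fun N hN => by omega⟩
    have hm : Tendsto (fun N : ℕ => N / 2) atTop atTop :=
      tendsto_atTop.2 fun b => eventually_atTop.2 ⟨2 * b, fun N hN => by omega⟩
    have hlim := (hL.mul_const (t ^ E)).mul (tendsto_finsetSum (range (ν.colLen 0 + 1)) fun k _ =>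
      (tendsto_stepBasis (s := s) ht z k hn hm).const_mul
        (columnCoeff s z ν.colLen (ν.rowLen 0) k))
    refine hlim.congr' (eventually_atTop.2 ⟨ν.colLen 0, fun N hN => ?_⟩)
    simp only
    rw [eval_hallLittlewood_interleave hst ht z ν hN]
    ring
  -- The formula is used with `m = 0` and an arbitrary generic `w`. All `stepBasis` with positive
  -- index vanish, so the value does not depend on `w`.
  · obtain ⟨w, hw, hg⟩ := (dense_generic h0).nonempty
    refine (hL.mul_const (t ^ E)).congr' (eventually_atTop.2 ⟨ν.colLen 0, fun N hN => ?_⟩)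
    simp only
    rw [eval_hallLittlewood_geomSet (z := w) hst ht hw hg ν hN (Nat.add_zero N)
      (fun i j h => Fin.ext (pow_injective_of_abs_lt_one h0 ht h)) ?_]
    · have : ∑ k ∈ range (ν.colLen 0 + 1), columnCoeff s w ν.colLen (ν.rowLen 0) k *
          stepBasis s t w k N 0 = 1 := by
        rw [sum_range_succ', sum_eq_zero]
        · rw [columnCoeff_zero_right]
          simp [stepBasis]
        · intro k _
          rw [stepBasis_eq_zero hst _ (Nat.succ_pos k), mul_zero]
      rw [this]
      ring
    · ext x
      simp only [mem_image, mem_univ, true_and, mem_geomSet]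
      constructor
      · rintro ⟨i, rfl⟩; exact Or.inl ⟨i, i.2, rfl⟩
      · rintro (⟨i, hi, rfl⟩ | ⟨i, hi, _⟩)
        · exact ⟨⟨i, hi⟩, rfl⟩
        · omega
  · rw [mul_div_cancel_left₀ _ (mul_ne_zero hL0 hE)]
    exact sum_congr rfl fun j _ => mul_comm _ _

end HallLittlewoodLimit


/-! ### Counting torsion elements and homomorphisms. -/

section TorsionCard

variable {R : Type*} [CommRing R]

/-- The number of elements of a module that are annihilated by `π ^ k`. -/
noncomputable def torsionCard (π : R) (M : Type*) [AddCommGroup M] [Module R M] (k : ℕ) : ℕ :=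
  Nat.card {x : M // π ^ k • x = 0}

variable {M N : Type*} [AddCommGroup M] [Module R M] [AddCommGroup N] [Module R N]

theorem torsionCard_congr (π : R) (e : M ≃ₗ[R] N) (k : ℕ) :
    torsionCard π M k = torsionCard π N k := by
  refine Nat.card_congr (e.toEquiv.subtypeEquiv fun x => ?_)
  rw [LinearEquiv.coe_toEquiv, ← map_smul, LinearEquiv.map_eq_zero_iff]

theorem torsionCard_prod (π : R) (k : ℕ) :
    torsionCard π (M × N) k = torsionCard π M k * torsionCard π N k := by
  rw [torsionCard, torsionCard, torsionCard, ← Nat.card_prod]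
  refine Nat.card_congr (Equiv.trans (Equiv.subtypeEquivRight fun x => ?_)
    (Equiv.subtypeProdEquivProd))
  rw [Prod.ext_iff]; rfl

theorem torsionCard_pi (π : R) {n : ℕ} {M : Fin n → Type*} [∀ i, AddCommGroup (M i)]
    [∀ i, Module R (M i)] (k : ℕ) :
    torsionCard π (∀ i, M i) k = ∏ i, torsionCard π (M i) k := by
  simp only [torsionCard]
  rw [← Nat.card_pi]
  refine Nat.card_congr (Equiv.trans (Equiv.subtypeEquivRight fun x => ?_)
    (Equiv.subtypePiEquivPi (p := fun i (y : M i) => π ^ k • y = 0)))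
  rw [funext_iff]; rfl

theorem card_hom_pi {n : ℕ} {M : Fin n → Type*} [∀ i, AddCommGroup (M i)]
    [∀ i, Module R (M i)] :
    Nat.card ((∀ i, M i) →ₗ[R] N) = ∏ i, Nat.card (M i →ₗ[R] N) := by
  rw [← Nat.card_pi]
  exact Nat.card_congr (LinearMap.lsum R M R).symm.toEquiv

theorem linearMap_quotient_apply {I : Ideal R} (f : (R ⧸ I) →ₗ[R] N) (a : R) :
    f (Ideal.Quotient.mk I a) = a • f 1 := by
  rw [← map_smul]
  congr 1
  rw [← map_one (Ideal.Quotient.mk I), ← Ideal.Quotient.mk_eq_mk, ← Ideal.Quotient.mk_eq_mk,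
    ← Submodule.Quotient.mk_smul, smul_eq_mul, mul_one]

theorem linearMap_quotient_ext {I : Ideal R} {f g : (R ⧸ I) →ₗ[R] N} (h : f 1 = g 1) : f = g := by
  refine LinearMap.ext fun x => ?_
  obtain ⟨a, rfl⟩ := Ideal.Quotient.mk_surjective x
  rw [linearMap_quotient_apply, linearMap_quotient_apply, h]

end TorsionCard

/-! ### Cyclic modules over a discrete valuation ring. -/

section DVRModules

open IsLocalRing

variable {R : Type*} [CommRing R] [IsDomain R] [IsDiscreteValuationRing R]

theorem mem_maximalIdeal_pow {π : R} (hπ : Irreducible π) (k : ℕ) (a : R) :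
    a ∈ maximalIdeal R ^ k ↔ π ^ k ∣ a := by
  rw [hπ.maximalIdeal_eq, Ideal.span_singleton_pow, Ideal.mem_span_singleton]

instance finite_quotient_maximalIdeal_pow [Finite (ResidueField R)] (k : ℕ) :
    Finite (R ⧸ maximalIdeal R ^ k) := by
  have : Finite (R ⧸ maximalIdeal R) := ‹Finite (ResidueField R)›
  exact Ideal.finite_quotient_pow (IsNoetherian.noetherian _) k

theorem card_quotient_maximalIdeal_pow (k : ℕ) :
    Nat.card (R ⧸ maximalIdeal R ^ k) = Nat.card (ResidueField R) ^ k := by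
  have := cardQuot_pow_of_prime (P := maximalIdeal R) (i := k)
    (IsDiscreteValuationRing.not_a_field R)
  rwa [Submodule.cardQuot_apply, Submodule.cardQuot_apply] at this

variable {M N : Type*} [AddCommGroup M] [Module R M] [AddCommGroup N] [Module R N]

/-- Multiplication by `π^{b - min k b}` identifies `R / 𝔭^{min k b}` with the part of `R / 𝔭^b`
killed by `π^k`. -/
theorem torsionCard_quotient {π : R} (hπ : Irreducible π) (k b : ℕ) :
    torsionCard π (R ⧸ maximalIdeal R ^ b) k = Nat.card (ResidueField R) ^ min k b := by
  rw [← card_quotient_maximalIdeal_pow (min k b), torsionCard]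
  let f : (R ⧸ maximalIdeal R ^ min k b) →ₗ[R] (R ⧸ maximalIdeal R ^ b) :=
    Submodule.mapQ _ _ (LinearMap.mulLeft R (π ^ (b - min k b))) fun a ha => by
      rw [mem_maximalIdeal_pow hπ] at ha
      rw [Submodule.mem_comap, mem_maximalIdeal_pow hπ, LinearMap.mulLeft_apply]
      rw [show b = (b - min k b) + min k b by omega, pow_add]
      convert mul_dvd_mul_left _ ha using 3
      omega
  have hf : ∀ a : R, f (Ideal.Quotient.mk _ a) = Ideal.Quotient.mk _ (π ^ (b - min k b) * a) :=
    fun a => rfl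
  have hmem : ∀ x, π ^ k • f x = 0 := by
    intro x
    obtain ⟨a, rfl⟩ := Ideal.Quotient.mk_surjective x
    rw [hf, ← Ideal.Quotient.mk_eq_mk, ← Submodule.Quotient.mk_smul, Submodule.Quotient.mk_eq_zero,
      mem_maximalIdeal_pow hπ, smul_eq_mul, ← mul_assoc, ← pow_add]
    exact Dvd.dvd.mul_right (pow_dvd_pow _ (by omega)) _
  refine (Nat.card_congr (Equiv.ofBijective (fun x => ⟨f x, hmem x⟩) ⟨?_, ?_⟩)).symm
  · intro x y hxy
    replace hxy : f x = f y := congrArg Subtype.val hxy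
    rw [← sub_eq_zero, ← map_sub] at hxy
    rw [← sub_eq_zero]
    obtain ⟨a, ha⟩ := Ideal.Quotient.mk_surjective (x - y)
    rw [← ha, hf, Ideal.Quotient.eq_zero_iff_mem, mem_maximalIdeal_pow hπ] at hxy
    rw [← ha, Ideal.Quotient.eq_zero_iff_mem, mem_maximalIdeal_pow hπ]
    have h2 : π ^ (b - min k b) * π ^ min k b ∣ π ^ (b - min k b) * a := by
      rw [← pow_add, show b - min k b + min k b = b by omega]; exact hxy
    exact (mul_dvd_mul_iff_left (pow_ne_zero _ hπ.ne_zero)).1 h2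
  · rintro ⟨x, hx⟩
    obtain ⟨a, rfl⟩ := Ideal.Quotient.mk_surjective x
    rw [← Ideal.Quotient.mk_eq_mk, ← Submodule.Quotient.mk_smul, Submodule.Quotient.mk_eq_zero,
      mem_maximalIdeal_pow hπ, smul_eq_mul] at hx
    have : π ^ (b - min k b) ∣ a := by
      rcases le_total b k with h | h
      · simp [h]
      · rw [min_eq_left h]
        rw [← mul_dvd_mul_iff_left (pow_ne_zero k hπ.ne_zero), ← pow_add,
          show k + (b - k) = b by omega]
        exact hx
    obtain ⟨c, rfl⟩ := this
    exact ⟨Ideal.Quotient.mk _ c, Subtype.ext (hf c)⟩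

theorem exists_linearMap_quotient {π : R} (hπ : Irreducible π) {k : ℕ} {x : N}
    (hx : π ^ k • x = 0) : ∃ f : (R ⧸ maximalIdeal R ^ k) →ₗ[R] N, f 1 = x := by
  refine ⟨Submodule.liftQ _ (LinearMap.toSpanSingleton R N x) ?_, one_smul R x⟩
  intro a ha
  rw [mem_maximalIdeal_pow hπ] at ha
  obtain ⟨c, rfl⟩ := ha
  rw [LinearMap.mem_ker, LinearMap.toSpanSingleton_apply, mul_comm, mul_smul, hx, smul_zero]

theorem pow_smul_eq_zero {π : R} (hπ : Irreducible π) {k l : ℕ} (h : l ≤ k)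
    (x : R ⧸ maximalIdeal R ^ l) : π ^ k • x = 0 := by
  obtain ⟨a, rfl⟩ := Ideal.Quotient.mk_surjective x
  rw [← Ideal.Quotient.mk_eq_mk, ← Submodule.Quotient.mk_smul, Submodule.Quotient.mk_eq_zero,
    mem_maximalIdeal_pow hπ]
  exact (pow_dvd_pow _ h).mul_right _

theorem card_hom_quotient {π : R} (hπ : Irreducible π) (k : ℕ) :
    Nat.card ((R ⧸ maximalIdeal R ^ k) →ₗ[R] N) = torsionCard π N k := by
  refine Nat.card_congr (Equiv.ofBijective (fun f => ⟨f 1, ?_⟩) ⟨?_, ?_⟩)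
  · rw [← map_smul, pow_smul_eq_zero hπ le_rfl, map_zero]
  · exact fun f g hfg => linearMap_quotient_ext (congrArg Subtype.val hfg)
  · rintro ⟨x, hx⟩
    obtain ⟨f, hf⟩ := exists_linearMap_quotient hπ hx
    exact ⟨f, Subtype.ext hf⟩

end DVRModules


/-! ### Partitions, conjugation, and the solution of the recursion for group orders. -/

section Partitions

open Finset

/-- `e 0 ≥ e 1 ≥ ⋯` is a partition with exactly `n` nonzero parts. -/
structure IsPartition (n : ℕ) (e : ℕ → ℕ) : Prop where
  antitone : Antitone e
  le_iff : ∀ i, n ≤ i ↔ e i = 0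

theorem YoungDiagram.isPartition (μ : YoungDiagram) : IsPartition (μ.colLen 0) μ.rowLen :=
  ⟨fun i j => μ.rowLen_anti i j, fun _ => YoungDiagram.rowLen_eq_zero_iff.symm⟩

theorem IsPartition.succ {n : ℕ} {e : ℕ → ℕ} (h : IsPartition (n + 1) e) :
    IsPartition n (fun i => e (i + 1)) :=
  ⟨fun _ _ hij => h.antitone (Nat.succ_le_succ hij), fun i => by rw [← h.le_iff]; simp⟩

theorem IsPartition.pos {n : ℕ} {e : ℕ → ℕ} (h : IsPartition (n + 1) e) : 1 ≤ e 0 :=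
  Nat.one_le_iff_ne_zero.2 fun h0 => by simpa using (h.le_iff 0).2 h0

/-- The partition obtained by adding a first part `l`. -/
def consPart (l : ℕ) (e : ℕ → ℕ) : ℕ → ℕ
  | 0 => l
  | i + 1 => e i

theorem IsPartition.cons {n l : ℕ} {e : ℕ → ℕ} (h : IsPartition n e) (hl : 1 ≤ l) (he : e 0 ≤ l) :
    IsPartition (n + 1) (consPart l e) := by
  refine ⟨antitone_nat_of_succ_le fun i => ?_, fun i => ?_⟩
  · cases i with
    | zero => exact he
    | succ i => exact h.antitone (Nat.le_succ i)
  · cases i with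
    | zero => simp [consPart]; omega
    | succ i => simpa [consPart] using h.le_iff i

theorem IsPartition.exists_youngDiagram {n : ℕ} {e : ℕ → ℕ} (h : IsPartition n e) :
    ∃ μ : YoungDiagram, μ.colLen 0 = n ∧ μ.rowLen = e := by
  let μ : YoungDiagram :=
    { cells := {c ∈ range n ×ˢ range (e 0) | c.2 < e c.1}
      isLowerSet := by
        rintro ⟨i, j⟩ ⟨k, l⟩ hle hm
        obtain ⟨h1, h2⟩ := Prod.mk_le_mk.1 hle
        have := h.antitone h1
        simp only [coe_filter, mem_product, mem_range, Set.mem_ofPred_eq] at hm ⊢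
        omega }
  have hμ : ∀ i j, (i, j) ∈ μ ↔ j < e i := by
    intro i j
    rw [← YoungDiagram.mem_cells]
    simp only [μ, mem_filter, mem_product, mem_range]
    refine ⟨fun hh => hh.2, fun hh => ⟨⟨?_, hh.trans_le (h.antitone (Nat.zero_le i))⟩, hh⟩⟩
    by_contra hn
    rw [(h.le_iff i).1 (not_lt.1 hn)] at hh
    omega
  have hr : μ.rowLen = e := funext fun i => eq_of_forall_lt_iff fun j => by
    rw [← YoungDiagram.mem_iff_lt_rowLen, hμ]
  refine ⟨μ, eq_of_forall_le_iff fun i => ?_, hr⟩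
  have := h.le_iff i
  rw [← hr, YoungDiagram.rowLen_eq_zero_iff] at this
  have h2 : ∀ i, n ≤ i ↔ μ.colLen 0 ≤ i := fun i => by
    rw [h.le_iff, ← hr, YoungDiagram.rowLen_eq_zero_iff]
  rw [le_antisymm ((h2 _).2 le_rfl) ((h2 _).1 le_rfl)]

theorem YoungDiagram.lt_colLen_iff {μ : YoungDiagram} {i j : ℕ} :
    i < μ.colLen j ↔ j < μ.rowLen i := by
  rw [← YoungDiagram.mem_iff_lt_colLen, ← YoungDiagram.mem_iff_lt_rowLen]

theorem sum_range_ite_lt (n m : ℕ) : ∑ i ∈ range n, (if i < m then 1 else 0) = min n m := by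
  rw [← card_filter, ← card_range (min n m)]
  congr 1
  ext i; simp

/-- The boxes in the first `k` columns are counted by rows and by columns. -/
theorem YoungDiagram.sum_min_rowLen (μ : YoungDiagram) (k : ℕ) :
    ∑ i ∈ range (μ.colLen 0), min k (μ.rowLen i) = ∑ j ∈ range k, μ.colLen j := by
  calc _ = ∑ i ∈ range (μ.colLen 0), ∑ j ∈ range k, (if i < μ.colLen j then 1 else 0) := by
        refine sum_congr rfl fun i _ => ?_
        simp only [YoungDiagram.lt_colLen_iff]
        rw [sum_range_ite_lt]
    _ = _ := by
        rw [sum_comm]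
        refine sum_congr rfl fun j _ => ?_
        rw [sum_range_ite_lt, min_eq_right (μ.colLen_anti 0 j (Nat.zero_le j))]

theorem YoungDiagram.sum_rowLen (μ : YoungDiagram) {k : ℕ} (hk : μ.rowLen 0 ≤ k) :
    ∑ i ∈ range (μ.colLen 0), μ.rowLen i = ∑ j ∈ range k, μ.colLen j := by
  rw [← μ.sum_min_rowLen k]
  refine sum_congr rfl fun i _ => ?_
  rw [min_eq_right ((μ.rowLen_anti 0 i (Nat.zero_le i)).trans hk)]

theorem YoungDiagram.card_eq_sum_rowLen (μ : YoungDiagram) :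
    μ.card = ∑ i ∈ range (μ.colLen 0), μ.rowLen i := by
  rw [YoungDiagram.card, card_eq_sum_card_fiberwise (f := Prod.fst) (t := range (μ.colLen 0))]
  · refine sum_congr rfl fun i _ => ?_
    rw [YoungDiagram.rowLen_eq_card]
    rfl
  · rintro ⟨i, j⟩ hc
    rw [mem_coe, YoungDiagram.mem_cells] at hc
    rw [coe_range, Set.mem_Iio, ← YoungDiagram.mem_iff_lt_colLen]
    exact μ.up_left_mem le_rfl (Nat.zero_le j) hc

/-- A double count of triples `(i, j, k)` with `k` less than both row lengths. The left side is the
exponent of `#Hom`, the right side the form that factors over columns. -/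
theorem YoungDiagram.sum_sum_min_rowLen (μ ν : YoungDiagram) :
    ∑ i ∈ range (μ.colLen 0), ∑ j ∈ range (ν.colLen 0), min (μ.rowLen i) (ν.rowLen j) =
      ∑ k ∈ range (μ.rowLen 0), μ.colLen k * ν.colLen k := by
  calc _ = ∑ i ∈ range (μ.colLen 0), ∑ k ∈ range (μ.rowLen 0),
          (if i < μ.colLen k then 1 else 0) * ν.colLen k := by
        refine sum_congr rfl fun i _ => ?_
        rw [ν.sum_min_rowLen]
        simp only [YoungDiagram.lt_colLen_iff, ite_mul, one_mul, zero_mul]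
        rw [← sum_filter]
        refine sum_congr ?_ fun _ _ => rfl
        ext k
        have := μ.rowLen_anti 0 i (Nat.zero_le i)
        simp only [mem_range, mem_filter]
        omega
    _ = _ := by
        rw [sum_comm]
        refine sum_congr rfl fun j _ => ?_
        rw [← sum_mul, sum_range_ite_lt, min_eq_right (μ.colLen_anti 0 j (Nat.zero_le j))]

/-- Successive differences in `k` recover the column lengths. Consequently the numbers of
`π^k`-torsion elements determine the type of a module. -/
theorem IsPartition.eq_of_sum_min {n n' : ℕ} {e e' : ℕ → ℕ} (h : IsPartition n e)
    (h' : IsPartition n' e')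
    (hs : ∀ k, ∑ i ∈ range n, min k (e i) = ∑ i ∈ range n', min k (e' i)) : n = n' ∧ e = e' := by
  obtain ⟨μ, rfl, rfl⟩ := h.exists_youngDiagram
  obtain ⟨μ', rfl, rfl⟩ := h'.exists_youngDiagram
  simp only [YoungDiagram.sum_min_rowLen] at hs
  have hc : ∀ j, μ.colLen j = μ'.colLen j := fun j => by
    have h1 := hs j
    have h2 := hs (j + 1)
    rw [sum_range_succ, sum_range_succ] at h2
    omega
  refine ⟨hc 0, funext fun i => eq_of_forall_lt_iff fun j => ?_⟩
  rw [← YoungDiagram.lt_colLen_iff, ← YoungDiagram.lt_colLen_iff, hc]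

/-- The number of parts equal to the first one. -/
def firstMult (n : ℕ) (e : ℕ → ℕ) : ℕ := #{i ∈ range n | e i = e 0}

/-- Truncating the parts at `e 0 - 1` removes one unit from each part equal to the first and nothing
else. -/
theorem sum_min_pred_add_firstMult {n : ℕ} {e : ℕ → ℕ} (h : IsPartition (n + 1) e) :
    ∑ i ∈ range (n + 1), min (e 0 - 1) (e i) + firstMult (n + 1) e = ∑ i ∈ range (n + 1), e i := by
  rw [firstMult, card_filter, ← sum_add_distrib]
  refine sum_congr rfl fun i _ => ?_
  have := h.antitone (Nat.zero_le i)
  have := h.pos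
  split_ifs <;> omega

/-- The solution of the recursion, over removing the first part of a partition, that is satisfied by
the orders of the automorphism groups. -/
theorem youngDiagram_product_of_recursion {κ s t : ℝ} (A : ℕ → (ℕ → ℕ) → ℝ) (h0 : ∀ e, A 0 e = 1)
    (h : ∀ n e, IsPartition (n + 1) e → A (n + 1) e =
      κ ^ e 0 * s ^ (2 * ∑ i ∈ range n, e (i + 1) + e 0) * (1 - t ^ firstMult (n + 1) e) *
        A n (fun i => e (i + 1))) (μ : YoungDiagram) :
    A (μ.colLen 0) μ.rowLen = κ ^ μ.card * ∏ j ∈ range (μ.rowLen 0),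
      (s ^ (μ.colLen j ^ 2) * qPoch 1 t (μ.colLen j - μ.colLen (j + 1))) := by
  obtain ⟨n, hn⟩ : ∃ n, μ.colLen 0 = n := ⟨_, rfl⟩
  induction n generalizing μ with
  | zero =>
    have hr : μ.rowLen 0 = 0 := YoungDiagram.rowLen_eq_zero_iff.2 hn.le
    rw [hn, h0, hr, YoungDiagram.card_eq_sum_rowLen, hn]
    simp
  | succ n ih =>
    have hp := μ.isPartition
    rw [hn] at hp
    -- `ρ` is `μ` without its first row, so every nonempty column loses one box.
    obtain ⟨ρ, hρ0, hρ⟩ := hp.succ.exists_youngDiagram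
    have hcol : ∀ j, ρ.colLen j = μ.colLen j - 1 := fun j => by
      refine eq_of_forall_lt_iff fun i => ?_
      rw [YoungDiagram.lt_colLen_iff, hρ, ← YoungDiagram.lt_colLen_iff]
      omega
    have hpos : ∀ j, j < μ.rowLen 0 → 0 < μ.colLen j := fun j hj => YoungDiagram.lt_colLen_iff.2 hj
    have hle : ρ.rowLen 0 ≤ μ.rowLen 0 := by
      rw [hρ]; exact μ.rowLen_anti 0 1 zero_le_one
    have hext : ∏ j ∈ range (ρ.rowLen 0),
        (s ^ (ρ.colLen j ^ 2) * qPoch 1 t (ρ.colLen j - ρ.colLen (j + 1))) =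
        ∏ j ∈ range (μ.rowLen 0),
        (s ^ (ρ.colLen j ^ 2) * qPoch 1 t (ρ.colLen j - ρ.colLen (j + 1))) := by
      refine prod_subset (range_mono hle) fun j _ hj => ?_
      rw [mem_range, not_lt] at hj
      rw [YoungDiagram.colLen_eq_zero_iff.2 hj]
      simp [qPoch]
    have hsum : ∑ i ∈ range n, μ.rowLen (i + 1) = ∑ j ∈ range (μ.rowLen 0), ρ.colLen j := by
      rw [← ρ.sum_rowLen hle, hρ0, hρ]
    have hcard : μ.card = μ.rowLen 0 + ρ.card := by
      rw [YoungDiagram.card_eq_sum_rowLen, YoungDiagram.card_eq_sum_rowLen, hn, sum_range_succ',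
        add_comm, hρ0, hρ]
    have hmult : firstMult (n + 1) μ.rowLen = μ.colLen (μ.rowLen 0 - 1) := by
      rw [firstMult, ← card_range (μ.colLen _)]
      congr 1
      ext i
      have := μ.rowLen_anti 0 i (Nat.zero_le i)
      have hpos := hp.pos
      have h1 := hp.le_iff i
      rw [mem_filter, mem_range, mem_range, YoungDiagram.lt_colLen_iff]
      omega
    have hA := h n _ hp
    rw [hsum, hmult, ← hρ] at hA
    have hB := ih ρ hρ0
    rw [hρ0, hext] at hB
    rw [hn, hA, hB, hcard, pow_add, pow_add, pow_mul]
    obtain ⟨r, hr⟩ : ∃ r, μ.rowLen 0 = r + 1 := ⟨μ.rowLen 0 - 1, by have := hp.pos; omega⟩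
    -- Differences of neighbouring columns are unchanged except at the last column, where the
    -- length, equal to the multiplicity of the first part, drops by one and accounts for the new
    -- factor.
    have hq : ∏ j ∈ range (μ.rowLen 0), qPoch 1 t (μ.colLen j - μ.colLen (j + 1)) =
        (1 - t ^ μ.colLen (μ.rowLen 0 - 1)) *
        ∏ j ∈ range (μ.rowLen 0), qPoch 1 t (ρ.colLen j - ρ.colLen (j + 1)) := by
      rw [hr, prod_range_succ, prod_range_succ]
      have hlast : μ.colLen (r + 1) = 0 := YoungDiagram.colLen_eq_zero_iff.2 hr.le
      rw [hcol (r + 1), hcol r, hlast]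
      obtain ⟨m, hm⟩ : ∃ m, μ.colLen r = m + 1 := ⟨μ.colLen r - 1, by have := hpos r (by omega); omega⟩
      have hrest : ∏ j ∈ range r, qPoch 1 t (μ.colLen j - μ.colLen (j + 1)) =
          ∏ j ∈ range r, qPoch 1 t (ρ.colLen j - ρ.colLen (j + 1)) := by
        refine prod_congr rfl fun j hj => ?_
        rw [mem_range] at hj
        have h1 := hpos j (by omega)
        have h2 := hpos (j + 1) (by omega)
        rw [hcol, hcol]
        congr 1
        omega
      rw [hrest]
      simp only [Nat.add_sub_cancel, hm, Nat.sub_zero, Nat.zero_sub, qPoch]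
      rw [prod_range_succ, one_mul]
      ring
    have hs : ∏ j ∈ range (μ.rowLen 0), s ^ (μ.colLen j ^ 2) =
        (s ^ 2) ^ (∑ j ∈ range (μ.rowLen 0), ρ.colLen j) * s ^ μ.rowLen 0 *
          ∏ j ∈ range (μ.rowLen 0), s ^ (ρ.colLen j ^ 2) := by
      rw [prod_pow_eq_pow_sum, prod_pow_eq_pow_sum, ← pow_mul, ← pow_add, ← pow_add]
      congr 1
      have hj : ∀ j ∈ range (μ.rowLen 0), μ.colLen j ^ 2 = 2 * ρ.colLen j + 1 + ρ.colLen j ^ 2 := by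
        intro j hj
        obtain ⟨m, hm⟩ : ∃ m, μ.colLen j = m + 1 :=
          ⟨μ.colLen j - 1, by have := hpos j (mem_range.1 hj); omega⟩
        rw [hcol, hm]
        simp only [Nat.add_sub_cancel]
        ring
      rw [sum_congr rfl hj, sum_add_distrib, sum_add_distrib, mul_sum]
      simp
    rw [prod_mul_distrib, prod_mul_distrib, hs, hq]
    ring

end Partitions


/-! ### Counting by fibres. -/

section Counting

/-- Orbit counting: if the fibres of a surjection `r : G → S` are torsors under `H`, then
`#G = #S * #H`. -/
theorem card_eq_mul_of_torsor {G S H : Type*} (r : G → S) (act : G → H → G)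
    (hr : Function.Surjective r) (hinj : ∀ g, Function.Injective (act g))
    (hract : ∀ g h, r (act g h) = r g) (htrans : ∀ g g', r g = r g' → ∃ h, act g h = g') :
    Nat.card G = Nat.card S * Nat.card H := by
  rw [← Nat.card_prod]
  choose f hf using hr
  refine (Nat.card_congr (Equiv.ofBijective (fun p : S × H => act (f p.1) p.2) ⟨?_, ?_⟩)).symm
  · rintro ⟨a, x⟩ ⟨b, y⟩ hab
    have h := congrArg r hab
    simp only [hract, hf] at h
    subst h
    exact congrArg _ (hinj _ hab)
  · intro g
    obtain ⟨h, hh⟩ := htrans (f (r g)) g (hf _)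
    exact ⟨(r g, h), hh⟩

theorem card_fiber_mul_card {G A : Type*} [AddCommGroup G] [AddCommGroup A] (f : G →+ A)
    (hf : Function.Surjective f) (a : A) :
    Nat.card {g // f g = a} * Nat.card A = Nat.card G := by
  rw [← Nat.card_prod]
  choose s hs using hf
  refine Nat.card_congr
    (Equiv.ofBijective (fun p : {g // f g = a} × A => p.1.1 - s a + s p.2) ⟨?_, ?_⟩)
  · rintro ⟨⟨g, hg⟩, b⟩ ⟨⟨g', hg'⟩, b'⟩ h
    have hb := congrArg f h
    simp only [map_add, map_sub, hg, hg', hs, sub_self, zero_add] at hb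
    subst hb
    simpa using h
  · intro g
    exact ⟨(⟨g - s (f g) + s a, by simp [hs]⟩, f g), by simp⟩

theorem card_subtype_add_card_subtype_not {X : Type*} [Finite X] (p : X → Prop) :
    Nat.card {x // p x} + Nat.card {x // ¬ p x} = Nat.card X := by
  classical
  rw [← Nat.card_sum]
  exact Nat.card_congr (Equiv.sumCompl p)

end Counting

/-! ### Automorphisms of a direct sum. -/

section AutSplit

variable {R : Type*} [CommRing R] {A N : Type*} [AddCommGroup A] [Module R A]
  [AddCommGroup N] [Module R N]

/-- A linear automorphism of `A × N` that fixes `A` and the projection onto `A` comes from `N`. -/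
theorem exists_linearEquiv_snd (k : (A × N) ≃ₗ[R] (A × N)) (h1 : ∀ a, k (a, 0) = (a, 0))
    (h2 : ∀ x, (k x).1 = x.1) : ∃ h : N ≃ₗ[R] N, ∀ a y, k (a, y) = (a, h y) := by
  have h3 : ∀ x, (k.symm x).1 = x.1 := fun x => by rw [← h2, k.apply_symm_apply]
  have h4 : ∀ y, k (0, y) = (0, (k (0, y)).2) := fun y => Prod.ext (h2 _) rfl
  have h5 : ∀ y, k.symm (0, y) = (0, (k.symm (0, y)).2) := fun y => Prod.ext (h3 _) rfl
  refine ⟨LinearEquiv.ofLinearMap (LinearMap.snd R A N ∘ₗ k ∘ₗ LinearMap.inr R A N)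
    (LinearMap.snd R A N ∘ₗ k.symm ∘ₗ LinearMap.inr R A N) ?_ ?_, ?_⟩
  · ext y
    change (k (0, (k.symm (0, y)).2)).2 = y
    rw [← h5, k.apply_symm_apply]
  · ext y
    change (k.symm (0, (k (0, y)).2)).2 = y
    rw [← h4, k.symm_apply_apply]
  · intro a y
    have : ((a, y) : A × N) = (a, 0) + (0, y) := by simp
    rw [this, map_add, h1, h4]
    simp

/-- An automorphism `g` is sent to the embedding of `A` and the retraction onto it that `g`
transports. Every pair `(i, f)` with `f ∘ i = id` arises, because by `hS` the complement `ker f` is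
a copy of `N`. The automorphisms over a given pair form a torsor under those of `N`. -/
theorem card_linearEquiv_prod
    (hS : ∀ (i : A →ₗ[R] A × N) (f : A × N →ₗ[R] A), f ∘ₗ i = LinearMap.id →
      Nonempty (N ≃ₗ[R] LinearMap.ker f)) :
    Nat.card ((A × N) ≃ₗ[R] (A × N)) =
      Nat.card {p : (A →ₗ[R] A × N) × (A × N →ₗ[R] A) // p.2 ∘ₗ p.1 = LinearMap.id} *
        Nat.card (N ≃ₗ[R] N) := by
  refine card_eq_mul_of_torsor
    (fun g => ⟨(g.toLinearMap ∘ₗ LinearMap.inl R A N, LinearMap.fst R A N ∘ₗ g.symm.toLinearMap), ?_⟩)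
    (fun g h => ((LinearEquiv.refl R A).prodCongr h).trans g) ?_ ?_ ?_ ?_
  · ext a
    simp
  · rintro ⟨⟨i, f⟩, hif⟩
    obtain ⟨e⟩ := hS i f hif
    have hif' : ∀ a, f (i a) = a := fun a => LinearMap.congr_fun hif a
    have hfe : ∀ y, f (e y) = 0 := fun y => (e y).2
    let g : (A × N) →ₗ[R] (A × N) :=
      LinearMap.coprod i ((LinearMap.ker f).subtype ∘ₗ e.toLinearMap)
    have hg : ∀ x, g x = i x.1 + e x.2 := fun x => rfl
    have hfg : ∀ x, f (g x) = x.1 := fun x => by rw [hg, map_add, hif', hfe, add_zero]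
    have hbij : Function.Bijective g := by
      constructor
      · rw [injective_iff_map_eq_zero]
        rintro ⟨a, y⟩ h0
        have h1 : a = 0 := by rw [show a = (a, y).1 from rfl, ← hfg (a, y), h0, map_zero]
        subst h1
        simpa [hg] using h0
      · intro x
        refine ⟨(f x, e.symm ⟨x - i (f x), ?_⟩), ?_⟩
        · rw [LinearMap.mem_ker, map_sub, hif', sub_self]
        · simp [hg]
    refine ⟨LinearEquiv.ofBijective g hbij, Subtype.ext (Prod.ext ?_ ?_)⟩
    · ext a : 1
      simp [hg]
    · refine LinearMap.ext fun x => ?_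
      change ((LinearEquiv.ofBijective g hbij).symm x).1 = f x
      rw [← hfg, ← LinearEquiv.ofBijective_apply (f := g) (hf := hbij), LinearEquiv.apply_symm_apply]
  · intro g h h' hh
    ext y
    have := g.injective (LinearEquiv.congr_fun hh (0, y))
    simpa using this
  · intro g h
    refine Subtype.ext (Prod.ext ?_ ?_)
    · ext a : 1
      simp
    · exact LinearMap.ext fun x => rfl
  · intro g g' h
    obtain ⟨h1, h2⟩ := Prod.ext_iff.1 (Subtype.ext_iff.1 h)
    have h1' : ∀ a, g (a, 0) = g' (a, 0) := fun a => LinearMap.congr_fun h1 a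
    have h2' : ∀ x, (g.symm x).1 = (g'.symm x).1 := fun x => LinearMap.congr_fun h2 x
    obtain ⟨h, hh⟩ := exists_linearEquiv_snd (g'.trans g.symm)
      (fun a => by rw [LinearEquiv.trans_apply, ← h1', g.symm_apply_apply])
      (fun x => by rw [LinearEquiv.trans_apply, h2', g'.symm_apply_apply])
    refine ⟨h, ?_⟩
    ext x : 1
    obtain ⟨a, y⟩ := x
    have := hh a y
    rw [LinearEquiv.trans_apply, LinearEquiv.symm_apply_eq] at this
    rw [this]; rfl

theorem card_linearEquiv_congr {M M' : Type*} [AddCommGroup M] [Module R M] [AddCommGroup M']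
    [Module R M'] (e : M ≃ₗ[R] M') : Nat.card (M ≃ₗ[R] M) = Nat.card (M' ≃ₗ[R] M') :=
  Nat.card_congr
    { toFun := fun g => (e.symm.trans g).trans e
      invFun := fun g => (e.trans g).trans e.symm
      left_inv := fun g => by ext; simp
      right_inv := fun g => by ext; simp }

theorem card_hom_congr {M M' N' : Type*} [AddCommGroup M] [Module R M] [AddCommGroup M']
    [Module R M'] [AddCommGroup N'] [Module R N'] (e : M ≃ₗ[R] M') (f : N ≃ₗ[R] N') :
    Nat.card (M →ₗ[R] N) = Nat.card (M' →ₗ[R] N') :=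
  Nat.card_congr (LinearEquiv.arrowCongr e f).toEquiv

end AutSplit

/-! ### Orders of the automorphism groups without pairing. -/

section CyclicPi

open IsLocalRing Finset

variable {R : Type*} [CommRing R] [IsDomain R] [IsDiscreteValuationRing R]

variable (R) in
/-- The module `⨁_{i < n} R / 𝔭 ^ (e i)`. -/
abbrev CyclicPi (n : ℕ) (e : ℕ → ℕ) : Type _ := ∀ i : Fin n, R ⧸ maximalIdeal R ^ e i

theorem torsionCard_cyclicPi {π : R} (hπ : Irreducible π) (n : ℕ) (e : ℕ → ℕ) (k : ℕ) :
    torsionCard π (CyclicPi R n e) k =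
      Nat.card (ResidueField R) ^ ∑ i ∈ range n, min k (e i) := by
  rw [torsionCard_pi]
  simp only [torsionCard_quotient hπ]
  rw [Finset.prod_pow_eq_pow_sum, Fin.sum_univ_eq_sum_range (fun i => min k (e i))]

theorem card_cyclicPi (n : ℕ) (e : ℕ → ℕ) :
    Nat.card (CyclicPi R n e) = Nat.card (ResidueField R) ^ ∑ i ∈ range n, e i := by
  rw [Nat.card_pi]
  simp only [card_quotient_maximalIdeal_pow]
  rw [Finset.prod_pow_eq_pow_sum, Fin.sum_univ_eq_sum_range]

theorem card_hom_cyclicPi (n : ℕ) (e : ℕ → ℕ) (n' : ℕ) (e' : ℕ → ℕ) :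
    Nat.card (CyclicPi R n e →ₗ[R] CyclicPi R n' e') =
      Nat.card (ResidueField R) ^ ∑ i ∈ range n, ∑ j ∈ range n', min (e i) (e' j) := by
  obtain ⟨π, hπ⟩ := IsDiscreteValuationRing.exists_irreducible R
  rw [card_hom_pi]
  simp only [card_hom_quotient hπ, torsionCard_cyclicPi hπ]
  rw [Finset.prod_pow_eq_pow_sum,
    Fin.sum_univ_eq_sum_range (fun i => ∑ j ∈ range n', min (e i) (e' j))]

theorem isUnit_of_pow_smul_ne_zero {π : R} (hπ : Irreducible π) {l : ℕ} {a : R}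
    (h : π ^ (l - 1) • (Ideal.Quotient.mk (maximalIdeal R ^ l) a) ≠ 0) : IsUnit a := by
  by_contra ha
  have h1 : π ∣ a := by
    rw [← Ideal.mem_span_singleton, ← hπ.maximalIdeal_eq]
    exact ha
  obtain ⟨b, rfl⟩ := h1
  apply h
  rw [← Ideal.Quotient.mk_eq_mk, ← Submodule.Quotient.mk_smul, Submodule.Quotient.mk_eq_zero,
    mem_maximalIdeal_pow hπ, smul_eq_mul, ← mul_assoc, ← pow_succ]
  exact (pow_dvd_pow _ (by omega)).mul_right _

theorem pow_pred_smul_one_ne_zero {π : R} (hπ : Irreducible π) {l : ℕ} (hl : 1 ≤ l) :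
    π ^ (l - 1) • (1 : R ⧸ maximalIdeal R ^ l) ≠ 0 := by
  intro h
  rw [← map_one (Ideal.Quotient.mk _), ← Ideal.Quotient.mk_eq_mk, ← Submodule.Quotient.mk_smul,
    Submodule.Quotient.mk_eq_zero, mem_maximalIdeal_pow hπ, smul_eq_mul, mul_one,
    pow_dvd_pow_iff hπ.ne_zero hπ.not_isUnit] at h
  omega

/-- The number of split embeddings of `R / 𝔭 ^ l` in a module of exponent `𝔭 ^ l`. -/
theorem card_split_embeddings [Finite (ResidueField R)] {π : R} (hπ : Irreducible π) {l : ℕ}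
    (hl : 1 ≤ l) {M : Type*}
    [AddCommGroup M] [Module R M] [Finite M] (h1 : ∀ x : M, π ^ l • x = 0)
    (h2 : ∀ x : M, π ^ (l - 1) • x ≠ 0 → ∃ f : M →ₗ[R] R ⧸ maximalIdeal R ^ l, f x = 1) :
    Nat.card {p : ((R ⧸ maximalIdeal R ^ l) →ₗ[R] M) × (M →ₗ[R] R ⧸ maximalIdeal R ^ l) //
        p.2 ∘ₗ p.1 = LinearMap.id} * Nat.card (ResidueField R) ^ l =
      Nat.card {x : M // ¬ π ^ (l - 1) • x = 0} *
        Nat.card (M →ₗ[R] R ⧸ maximalIdeal R ^ l) := by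
  set A := R ⧸ maximalIdeal R ^ l
  have hA : Finite (M →ₗ[R] A) := Finite.of_injective _ DFunLike.coe_injective
  have hx : ∀ (f : M →ₗ[R] A) x, f x = 1 → ¬ π ^ (l - 1) • x = 0 := fun f x hfx h0 =>
    pow_pred_smul_one_ne_zero hπ hl (by rw [← hfx, ← map_smul, h0, map_zero])
  -- A split embedding is a vector `x` of maximal order together with a functional taking the value
  -- `1` on it. Evaluation at such an `x` is surjective onto `R / 𝔭^l`, so the number of functionals
  -- does not depend on `x`.
  have hfib : ∀ x : {x : M // ¬ π ^ (l - 1) • x = 0},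
      Nat.card {f : M →ₗ[R] A // f x = 1} * Nat.card (ResidueField R) ^ l =
        Nat.card (M →ₗ[R] A) := by
    intro x
    obtain ⟨f, hf⟩ := h2 x x.2
    rw [← card_quotient_maximalIdeal_pow]
    refine card_fiber_mul_card
      ((LinearMap.applyₗ (R := R) (M₂ := A) (x : M)).toAddMonoidHom) (fun a => ?_) 1
    obtain ⟨b, rfl⟩ := Ideal.Quotient.mk_surjective a
    refine ⟨b • f, ?_⟩
    change b • f x = _
    rw [hf, ← map_one (Ideal.Quotient.mk _), ← Ideal.Quotient.mk_eq_mk, ← Ideal.Quotient.mk_eq_mk,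
      ← Submodule.Quotient.mk_smul, smul_eq_mul, mul_one]
  have hcard : Nat.card {p : (A →ₗ[R] M) × (M →ₗ[R] A) // p.2 ∘ₗ p.1 = LinearMap.id} =
      Nat.card (Σ x : {x : M // ¬ π ^ (l - 1) • x = 0}, {f : M →ₗ[R] A // f x = 1}) := by
    have h3 : ∀ p : {p : (A →ₗ[R] M) × (M →ₗ[R] A) // p.2 ∘ₗ p.1 = LinearMap.id},
        p.1.2 (p.1.1 1) = 1 := fun p => LinearMap.congr_fun p.2 1
    refine Nat.card_congr (Equiv.ofBijective
      (fun p => ⟨⟨p.1.1 1, hx p.1.2 _ (h3 p)⟩, ⟨p.1.2, h3 p⟩⟩) ⟨?_, ?_⟩)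
    · rintro ⟨⟨i, f⟩, hif⟩ ⟨⟨i', f'⟩, hif'⟩ h
      rw [Sigma.mk.injEq] at h
      obtain ⟨h4, h5⟩ := h
      have h6 : i = i' := linearMap_quotient_ext (congrArg Subtype.val h4)
      subst h6
      have h7 : f = f' := congrArg Subtype.val (eq_of_heq h5)
      subst h7
      rfl
    · rintro ⟨⟨x, hx⟩, ⟨f, hf⟩⟩
      obtain ⟨i, rfl⟩ := exists_linearMap_quotient hπ (h1 x)
      exact ⟨⟨(i, f), linearMap_quotient_ext hf⟩, rfl⟩
  have := Fintype.ofFinite {x : M // ¬ π ^ (l - 1) • x = 0}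
  rw [hcard, Nat.card_sigma, sum_mul]
  simp only [hfib]
  rw [sum_const, card_univ, smul_eq_mul, ← Nat.card_eq_fintype_card]

theorem IsPartition.pow_smul_eq_zero {π : R} (hπ : Irreducible π) {n : ℕ} {e : ℕ → ℕ}
    (h : IsPartition n e) (x : CyclicPi R n e) : π ^ e 0 • x = 0 :=
  funext fun i => _root_.pow_smul_eq_zero hπ (h.antitone (Nat.zero_le i)) (x i)

/-- Some coordinate of `x` already has maximal order. It is then a unit in a summand of full
exponent, and a multiple of the projection to this summand does it. -/
theorem IsPartition.exists_linearMap_eq_one {π : R} (hπ : Irreducible π) {n : ℕ} {e : ℕ → ℕ}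
    (h : IsPartition n e) {x : CyclicPi R n e} (hx : π ^ (e 0 - 1) • x ≠ 0) :
    ∃ f : CyclicPi R n e →ₗ[R] R ⧸ maximalIdeal R ^ e 0, f x = 1 := by
  obtain ⟨i, hi⟩ : ∃ i, π ^ (e 0 - 1) • x i ≠ 0 := by
    by_contra! hcon
    exact hx (funext hcon)
  have hei : e 0 ≤ e i := by
    by_contra! hlt
    exact hi (_root_.pow_smul_eq_zero hπ (by omega) _)
  obtain ⟨a, ha⟩ := Ideal.Quotient.mk_surjective (x i)
  have hei' : e 0 = e i := le_antisymm hei (h.antitone (Nat.zero_le i))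
  obtain ⟨b, hb⟩ := (isUnit_of_pow_smul_ne_zero (l := e i) (a := a) hπ
    (by rw [ha, show e i - 1 = e 0 - 1 by omega]; exact hi)).exists_left_inv
  refine ⟨b • (Submodule.factor (Ideal.pow_le_pow_right hei) ∘ₗ LinearMap.proj i), ?_⟩
  rw [LinearMap.smul_apply, LinearMap.comp_apply, LinearMap.proj_apply, ← ha]
  change Ideal.Quotient.mk _ (b * a) = 1
  rw [hb, map_one]

/-- Since `f` is onto, it sends some standard generator `j` to an element of maximal order, and the
`j`-th summand has full exponent. An element of `ker f` is determined by its other coordinates, and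
a count shows that forgetting the `j`-th one is bijective onto the sum of the other summands. -/
theorem IsPartition.nonempty_ker_equiv [Finite (ResidueField R)] {π : R} (hπ : Irreducible π)
    {n : ℕ} {e : ℕ → ℕ} (h : IsPartition (n + 1) e)
    (i : (R ⧸ maximalIdeal R ^ e 0) →ₗ[R] CyclicPi R (n + 1) e)
    (f : CyclicPi R (n + 1) e →ₗ[R] R ⧸ maximalIdeal R ^ e 0) (hif : f ∘ₗ i = LinearMap.id) :
    Nonempty (LinearMap.ker f ≃ₗ[R] CyclicPi R n fun i => e (i + 1)) := by
  have hif' : ∀ a, f (i a) = a := fun a => LinearMap.congr_fun hif a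
  let u : ∀ j : Fin (n + 1), R ⧸ maximalIdeal R ^ e 0 := fun j => f (LinearMap.single R _ j 1)
  have hu : ∀ j (b : R), f (LinearMap.single R _ j (Ideal.Quotient.mk _ b)) = b • u j :=
    fun j b => linearMap_quotient_apply
      (f ∘ₗ LinearMap.single R (fun i : Fin (n + 1) => R ⧸ maximalIdeal R ^ e i) j) b
  obtain ⟨j, hj⟩ : ∃ j, π ^ (e 0 - 1) • u j ≠ 0 := by
    by_contra! hcon
    apply pow_pred_smul_one_ne_zero hπ h.pos
    rw [← hif' 1]
    have hsum : i 1 = ∑ j, LinearMap.single R _ j (i 1 j) := by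
      simp only [LinearMap.coe_single]
      exact (Finset.univ_sum_single _).symm
    rw [hsum, map_sum, smul_sum]
    refine sum_eq_zero fun j _ => ?_
    obtain ⟨b, hb⟩ := Ideal.Quotient.mk_surjective (i 1 j)
    rw [← hb, hu, smul_comm, hcon, smul_zero]
  have hej : e j = e 0 := by
    refine le_antisymm (h.antitone (Nat.zero_le j)) ?_
    by_contra! hlt
    apply hj
    change _ • f _ = _
    rw [← map_smul, ← map_smul, _root_.pow_smul_eq_zero hπ (by omega), map_zero, map_zero]
  -- All parts between `0` and `j` equal `e 0`, so omitting the part with index `j` gives the same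
  -- partition as omitting the first one.
  have hsucc : ∀ k : Fin n, e (j.succAbove k) = e (k + 1) := by
    intro k
    rcases lt_or_ge k.castSucc j with hk | hk
    · rw [Fin.succAbove_of_castSucc_lt _ _ hk]
      have h1 := h.antitone (Nat.zero_le ((k : ℕ) + 1))
      have h2 := h.antitone (show (k : ℕ) + 1 ≤ j from hk)
      have h3 := h.antitone (Nat.zero_le (k : ℕ))
      have h4 := h.antitone (show (k : ℕ) ≤ k + 1 by omega)
      rw [Fin.val_castSucc]
      omega
    · rw [Fin.succAbove_of_le_castSucc _ _ hk]
      rfl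
  let g : LinearMap.ker f →ₗ[R] CyclicPi R n fun i => e (i + 1) :=
    LinearMap.pi fun k => (Submodule.quotEquivOfEq (maximalIdeal R ^ e (j.succAbove k))
      (maximalIdeal R ^ e (k + 1)) (by rw [hsucc])).toLinearMap ∘ₗ
        LinearMap.proj (j.succAbove k) ∘ₗ (LinearMap.ker f).subtype
  have hginj : Function.Injective g := by
    rw [injective_iff_map_eq_zero]
    rintro ⟨x, hx⟩ h0
    have h1 : ∀ k, x (j.succAbove k) = 0 := fun k => by
      have hk : Submodule.quotEquivOfEq (maximalIdeal R ^ e (j.succAbove k))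
        (maximalIdeal R ^ e (k + 1)) (by rw [hsucc]) (x (j.succAbove k)) = 0 := congrFun h0 k
      exact (LinearEquiv.map_eq_zero_iff _).1 hk
    have h2 : x = LinearMap.single R _ j (x j) := by
      funext m
      rcases eq_or_ne m j with rfl | hm
      · simp
      · obtain ⟨k, rfl⟩ := Fin.exists_succAbove_eq hm
        rw [h1]
        simp
    obtain ⟨b, hb⟩ := Ideal.Quotient.mk_surjective (x j)
    obtain ⟨w, hw⟩ := Ideal.Quotient.mk_surjective (u j)
    rw [LinearMap.mem_ker, h2, ← hb, hu, ← hw, ← Ideal.Quotient.mk_eq_mk,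
      ← Submodule.Quotient.mk_smul, Submodule.Quotient.mk_eq_zero, smul_eq_mul] at hx
    have hwu : IsUnit w := isUnit_of_pow_smul_ne_zero (l := e 0) hπ (by rw [hw]; exact hj)
    rw [mem_maximalIdeal_pow hπ, hwu.dvd_mul_right] at hx
    have h3 : x j = 0 := by
      rw [← hb, Ideal.Quotient.eq_zero_iff_mem, mem_maximalIdeal_pow hπ, hej]
      exact hx
    rw [h3, map_zero] at h2
    exact Subtype.ext h2
  have hcard : Nat.card (LinearMap.ker f) = Nat.card (CyclicPi R n fun i => e (i + 1)) := by
    have h1 := card_fiber_mul_card f.toAddMonoidHom (fun a => ⟨i a, hif' a⟩) 0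
    have h2 : Nat.card {x // f.toAddMonoidHom x = 0} = Nat.card (LinearMap.ker f) := rfl
    rw [h2, card_quotient_maximalIdeal_pow, card_cyclicPi, sum_range_succ', pow_add] at h1
    rw [card_cyclicPi]
    exact Nat.eq_of_mul_eq_mul_right (pow_pos Nat.card_pos _) h1
  have : Finite (LinearMap.ker f) := Finite.of_injective _ (Submodule.injective_subtype _)
  exact ⟨LinearEquiv.ofBijective g (hginj.bijective_of_nat_card_le hcard.ge)⟩

theorem card_not_torsion_cyclicPi [Finite (ResidueField R)] {π : R} (hπ : Irreducible π) (n : ℕ)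
    (e : ℕ → ℕ) (k : ℕ) :
    (Nat.card {x : CyclicPi R n e // ¬ π ^ k • x = 0} : ℝ) =
      (Nat.card (ResidueField R) : ℝ) ^ (∑ i ∈ range n, e i) -
        (Nat.card (ResidueField R) : ℝ) ^ (∑ i ∈ range n, min k (e i)) := by
  have h := card_subtype_add_card_subtype_not (fun x : CyclicPi R n e => π ^ k • x = 0)
  have h1 := torsionCard_cyclicPi hπ n e k
  rw [torsionCard] at h1
  rw [h1, card_cyclicPi] at h
  rw [eq_sub_iff_add_eq']
  exact_mod_cast h

/-- With `|e|` the sum of the parts and `m` the multiplicity of the first, there are `q^{|e|} (1 -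
q^{-m})` vectors of maximal order. Each admits `q^{|e| - e 0}` functionals with value `1`, and `2|e|
- e 0` is the exponent on the right. -/
theorem card_linearEquiv_cyclicPi_succ [Finite (ResidueField R)] {n : ℕ} {e : ℕ → ℕ}
    (h : IsPartition (n + 1) e) :
    (Nat.card (CyclicPi R (n + 1) e ≃ₗ[R] CyclicPi R (n + 1) e) : ℝ) =
      (Nat.card (ResidueField R) : ℝ) ^ (2 * ∑ i ∈ range n, e (i + 1) + e 0) *
        (1 - (Nat.card (ResidueField R) : ℝ)⁻¹ ^ firstMult (n + 1) e) *
        Nat.card ((CyclicPi R n fun i => e (i + 1)) ≃ₗ[R] (CyclicPi R n fun i => e (i + 1))) := by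
  obtain ⟨π, hπ⟩ := IsDiscreteValuationRing.exists_irreducible R
  set q := Nat.card (ResidueField R) with hq
  have hq0 : (q : ℝ) ≠ 0 := Nat.cast_ne_zero.2 Nat.card_pos.ne'
  let c : ((R ⧸ maximalIdeal R ^ e 0) × CyclicPi R n fun i => e (i + 1)) ≃ₗ[R]
    CyclicPi R (n + 1) e := Fin.consLinearEquiv R fun i : Fin (n + 1) => R ⧸ maximalIdeal R ^ e i
  have hS := card_split_embeddings hπ h.pos
    (M := (R ⧸ maximalIdeal R ^ e 0) × CyclicPi R n fun i => e (i + 1))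
    (fun x => c.injective (by rw [map_smul, h.pow_smul_eq_zero hπ, map_zero])) (fun x hx => by
      obtain ⟨f, hf⟩ := h.exists_linearMap_eq_one hπ (x := c x) (fun h0 => hx (c.injective (by
        rw [map_smul, h0, map_zero])))
      exact ⟨f ∘ₗ c.toLinearMap, hf⟩)
  have hG := card_linearEquiv_prod (R := R) (A := R ⧸ maximalIdeal R ^ e 0)
    (N := CyclicPi R n fun i => e (i + 1)) (fun i f hif => by
      obtain ⟨g⟩ := h.nonempty_ker_equiv hπ (c.toLinearMap ∘ₗ i) (f ∘ₗ c.symm.toLinearMap) (by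
        refine LinearMap.ext fun a => ?_
        simpa using LinearMap.congr_fun hif a)
      refine ⟨g.symm.trans (LinearEquiv.ofSubmodules c.symm _ _ ?_)⟩
      ext x
      simp [LinearMap.mem_ker])
  rw [card_hom_congr c (LinearEquiv.refl R _), card_hom_pi] at hS
  simp only [card_hom_quotient hπ, torsionCard_quotient hπ] at hS
  rw [← card_linearEquiv_congr c, hG]
  have hX : Nat.card {x : (R ⧸ maximalIdeal R ^ e 0) × CyclicPi R n fun i => e (i + 1) //
      ¬ π ^ (e 0 - 1) • x = 0} =
      Nat.card {x : CyclicPi R (n + 1) e // ¬ π ^ (e 0 - 1) • x = 0} :=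
    Nat.card_congr (c.toEquiv.subtypeEquiv fun x => by
      rw [LinearEquiv.coe_toEquiv, ← map_smul, LinearEquiv.map_eq_zero_iff])
  have hmin : ∏ i : Fin (n + 1), q ^ min (e i) (e 0) = q ^ ∑ i ∈ range (n + 1), e i := by
    rw [Finset.prod_pow_eq_pow_sum, ← Fin.sum_univ_eq_sum_range]
    congr 1
    exact sum_congr rfl fun i _ => min_eq_left (h.antitone (Nat.zero_le i))
  rw [hX, ← hq, hmin] at hS
  replace hS := congrArg (Nat.cast (R := ℝ)) hS
  push_cast at hS ⊢
  rw [card_not_torsion_cyclicPi hπ, ← hq] at hS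
  have hE := sum_min_pred_add_firstMult h
  set a := ∑ i ∈ range (n + 1), min (e 0 - 1) (e i)
  set m := firstMult (n + 1) e
  have hE' : ∑ i ∈ range (n + 1), e i = ∑ i ∈ range n, e (i + 1) + e 0 := sum_range_succ' _ _
  congr 1
  refine mul_right_cancel₀ (pow_ne_zero (e 0) hq0) (hS.trans ?_)
  calc _ = (q : ℝ) ^ (∑ i ∈ range n, e (i + 1) + e 0) *
        ((q : ℝ) ^ (a + m) - (q : ℝ) ^ (a + m) * (q : ℝ)⁻¹ ^ m) := by
        have h1 : (q : ℝ) ^ m * (q : ℝ)⁻¹ ^ m = 1 := by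
          rw [← mul_pow, mul_inv_cancel₀ hq0, one_pow]
        rw [← hE', ← hE, pow_add]
        linear_combination ((q : ℝ) ^ a) ^ 2 * (q : ℝ) ^ m * h1
    _ = _ := by
        rw [hE, hE']
        ring

end CyclicPi


/-! ### Modules with pairings: orthogonal splitting, classification and cancellation. -/

section Pairings

open Finset

universe u

variable {R W : Type*} [CommRing R]

/-- The linear maps that respect the pairings. -/
abbrev IsometricMap (R : Type*) {W M N : Type*} [CommRing R] [AddCommGroup M] [Module R M]
    [AddCommGroup N] [Module R N] (B : M → M → W) (B' : N → N → W) : Type _ :=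
  {f : M →ₗ[R] N // ∀ x y, B' (f x) (f y) = B x y}

/-- The linear automorphisms that respect the pairing. -/
abbrev IsometricAut (R : Type*) {W M : Type*} [CommRing R] [AddCommGroup M] [Module R M]
    (B : M → M → W) : Type _ :=
  {f : M ≃ₗ[R] M // ∀ x y, B (f x) (f y) = B x y}

/-- Two modules with pairings are isometric. -/
def AreIsometric (R : Type*) {W M N : Type*} [CommRing R] [AddCommGroup M] [Module R M]
    [AddCommGroup N] [Module R N] (B : M → M → W) (B' : N → N → W) : Prop :=
  ∃ f : M ≃ₗ[R] N, ∀ x y, B' (f x) (f y) = B x y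

theorem AreIsometric.symm {M N : Type*} [AddCommGroup M] [Module R M] [AddCommGroup N] [Module R N]
    {B : M → M → W} {B' : N → N → W} (h : AreIsometric R B B') : AreIsometric R B' B := by
  obtain ⟨f, hf⟩ := h
  exact ⟨f.symm, fun x y => by rw [← hf]; simp⟩

theorem AreIsometric.trans {M N P : Type*} [AddCommGroup M] [Module R M] [AddCommGroup N]
    [Module R N] [AddCommGroup P] [Module R P]
    {B : M → M → W} {B' : N → N → W} {B'' : P → P → W} (h : AreIsometric R B B')
    (h' : AreIsometric R B' B'') : AreIsometric R B B'' := by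
  obtain ⟨f, hf⟩ := h
  obtain ⟨g, hg⟩ := h'
  exact ⟨f.trans g, fun x y => by simp [hf, hg]⟩

theorem AreIsometric.card_isometricAut {M N : Type*} [AddCommGroup M] [Module R M] [AddCommGroup N]
    [Module R N] {B : M → M → W} {B' : N → N → W} (h : AreIsometric R B B') :
    Nat.card (IsometricAut R B) = Nat.card (IsometricAut R B') := by
  obtain ⟨f, hf⟩ := h
  have hf' : ∀ x y, B (f.symm x) (f.symm y) = B' x y := fun x y => by rw [← hf]; simp
  exact Nat.card_congr
    { toFun := fun g => ⟨(f.symm.trans g.1).trans f, fun x y => by simp [hf, g.2, hf']⟩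
      invFun := fun g => ⟨(f.trans g.1).trans f.symm, fun x y => by simp [hf, g.2, hf']⟩
      left_inv := fun g => by ext; simp
      right_inv := fun g => by ext; simp }

theorem AreIsometric.card_isometricMap {C M N : Type*} [AddCommGroup C] [Module R C]
    [AddCommGroup M] [Module R M] [AddCommGroup N]
    [Module R N] {BC : C → C → W} {B : M → M → W} {B' : N → N → W} (h : AreIsometric R B B') :
    Nat.card (IsometricMap R BC B) = Nat.card (IsometricMap R BC B') := by
  obtain ⟨f, hf⟩ := h
  have hf' : ∀ x y, B (f.symm x) (f.symm y) = B' x y := fun x y => by rw [← hf]; simp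
  exact Nat.card_congr
    { toFun := fun g => ⟨f.toLinearMap ∘ₗ g.1, fun x y => by simp [hf, g.2]⟩
      invFun := fun g => ⟨f.symm.toLinearMap ∘ₗ g.1, fun x y => by simp [g.2, hf']⟩
      left_inv := fun g => by ext; simp
      right_inv := fun g => by ext; simp }

variable [AddCommGroup W]

/-- The orthogonal sum of two pairings. -/
def prodPairing {M N : Type*} (B : M → M → W) (B' : N → N → W) (x y : M × N) : W :=
  B x.1 y.1 + B' x.2 y.2

theorem AreIsometric.prod {C M N : Type*} [AddCommGroup C] [Module R C] [AddCommGroup M]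
    [Module R M] [AddCommGroup N] [Module R N] (BC : C → C → W) {B : M → M → W} {B' : N → N → W}
    (h : AreIsometric R B B') : AreIsometric R (prodPairing BC B) (prodPairing BC B') := by
  obtain ⟨f, hf⟩ := h
  exact ⟨(LinearEquiv.refl R C).prodCongr f, fun x y => by simp [prodPairing, hf]⟩

/-- The orthogonal sum of the blocks `C (e i)`. -/
def piPairing {C : ℕ → Type*} (BC : ∀ l, C l → C l → W) (n : ℕ) (e : ℕ → ℕ)
    (x y : ∀ i : Fin n, C (e i)) : W :=
  ∑ i : Fin n, BC (e i) (x i) (y i)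

theorem areIsometric_piPairing_succ {C : ℕ → Type*} [∀ l, AddCommGroup (C l)]
    [∀ l, Module R (C l)] (BC : ∀ l, C l → C l → W) (n : ℕ) (e : ℕ → ℕ) :
    AreIsometric R (prodPairing (BC (e 0)) (piPairing BC n fun i => e (i + 1)))
      (piPairing BC (n + 1) e) := by
  refine ⟨Fin.consLinearEquiv R fun i : Fin (n + 1) => C (e i), fun x y => ?_⟩
  rw [piPairing, Fin.sum_univ_succ]
  rfl

theorem card_isometricAut_zero {C : ℕ → Type*}
    [∀ l, AddCommGroup (C l)] [∀ l, Module R (C l)] (BC : ∀ l, C l → C l → W) (e : ℕ → ℕ) :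
    Nat.card (IsometricAut R (piPairing BC 0 e)) = 1 := by
  have : Unique (IsometricAut R (piPairing BC 0 e)) :=
    ⟨⟨⟨LinearEquiv.refl _ _, fun _ _ => rfl⟩⟩,
      fun f => Subtype.ext (LinearEquiv.ext fun x => Subsingleton.elim _ _)⟩
  exact Nat.card_unique

variable [Module R W]

/-- A pairing with values in `W` that is `σ`-linear in the first and linear in the second variable,
satisfies the symmetry `B y x = τ (B x y)`, and takes values in `D` on the diagonal. -/
structure IsPairing (σ : R →+* R) (τ : W →+ W) (D : Set W) {M : Type*} [AddCommGroup M] [Module R M]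
    (B : M → M → W) : Prop where
  add_left : ∀ x y z, B (x + y) z = B x z + B y z
  add_right : ∀ x y z, B x (y + z) = B x y + B x z
  smul_left : ∀ (a : R) x y, B (a • x) y = σ a • B x y
  smul_right : ∀ (a : R) x y, B x (a • y) = a • B x y
  symm : ∀ x y, B y x = τ (B x y)
  diag : ∀ x, B x x ∈ D

/-- One side suffices: for an `IsPairing`, the symmetry makes the left and right radicals coincide.
-/
def IsNondegenerate {M : Type*} [AddCommGroup M] (B : M → M → W) : Prop :=
  ∀ x, (∀ y, B y x = 0) → x = 0

namespace IsPairing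

variable {σ : R →+* R} {τ : W →+ W} {D : Set W} {M : Type*} [AddCommGroup M] [Module R M]
  {B : M → M → W}

theorem zero_right (h : IsPairing σ τ D B) (x : M) : B x 0 = 0 := by
  simpa using h.smul_right 0 x 0

theorem zero_left (h : IsPairing σ τ D B) (x : M) : B 0 x = 0 := by
  simpa using h.smul_left 0 0 x

theorem eq_zero_symm (h : IsPairing σ τ D B) {x y : M} (hxy : B x y = 0) : B y x = 0 := by
  rw [h.symm, hxy, map_zero]

theorem restrict (h : IsPairing σ τ D B) (N : Submodule R M) :
    IsPairing σ τ D (fun x y : N => B x y) :=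
  ⟨fun _ _ _ => h.add_left _ _ _, fun _ _ _ => h.add_right _ _ _, fun _ _ _ => h.smul_left _ _ _,
    fun _ _ _ => h.smul_right _ _ _, fun _ _ => h.symm _ _, fun _ => h.diag _⟩

theorem of_isometric (h : IsPairing σ τ D B) {N : Type*} [AddCommGroup N] [Module R N]
    {B' : N → N → W} (f : N →ₗ[R] M) (hf : ∀ x y, B (f x) (f y) = B' x y) :
    IsPairing σ τ D B' := by
  refine ⟨fun x y z => ?_, fun x y z => ?_, fun a x y => ?_, fun a x y => ?_, fun x y => ?_,
    fun x => ?_⟩ <;> simp only [← hf, map_add, map_smul, h.add_left, h.add_right, h.smul_left,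
      h.smul_right, h.diag]
  exact h.symm _ _

/-- The orthogonal complement of the image of a map. -/
def perp (h : IsPairing σ τ D B) {C : Type*} [AddCommGroup C] [Module R C] (i : C →ₗ[R] M) :
    Submodule R M where
  carrier := {y | ∀ c, B (i c) y = 0}
  add_mem' := fun hx hy c => by rw [h.add_right, hx c, hy c, add_zero]
  zero_mem' := fun c => h.zero_right _
  smul_mem' := fun a x hx c => by rw [h.smul_right, hx c, smul_zero]

end IsPairing

/-- The modules `C l` with pairings have the same torsion as a power of `R / π ^ l`, represent all
their functionals, and embed isometrically in all modules with a pairing of exponent `π ^ l`. -/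
structure IsBlockFamily (π : R) (b : ℕ) (σ : R →+* R) (τ : W →+ W) (D : Set W) {C : ℕ → Type u}
    [∀ l, AddCommGroup (C l)] [∀ l, Module R (C l)] (BC : ∀ l, C l → C l → W) : Prop where
  pairing : ∀ l, IsPairing σ τ D (BC l)
  nondegenerate : ∀ l, IsNondegenerate (BC l)
  finite : ∀ l, Finite (C l)
  represent : ∀ l (f : C l → W), (∀ x y, f (x + y) = f x + f y) →
    (∀ (a : R) x, f (a • x) = σ a • f x) → ∃ c, ∀ c', f c' = BC l c' c
  one_lt : 1 < b
  pow_smul : ∀ l (x : C l), π ^ l • x = 0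
  torsion : ∀ l k, torsionCard π (C l) k = b ^ min k l
  embed : ∀ (M : Type u) [AddCommGroup M] [Module R M] [Finite M] (B : M → M → W),
    IsPairing σ τ D B → IsNondegenerate B → ∀ l, 1 ≤ l → (∀ x : M, π ^ l • x = 0) →
    (∃ x : M, π ^ (l - 1) • x ≠ 0) → Nonempty (IsometricMap R (BC l) B)

namespace IsBlockFamily

variable {π : R} {b : ℕ} {σ : R →+* R} {τ : W →+ W} {D : Set W} {C : ℕ → Type u}
    [∀ l, AddCommGroup (C l)] [∀ l, Module R (C l)] {BC : ∀ l, C l → C l → W}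

theorem pow_smul_of_le (h : IsBlockFamily π b σ τ D BC) {l k : ℕ} (hlk : l ≤ k) (x : C l) :
    π ^ k • x = 0 := by
  rw [← Nat.sub_add_cancel hlk, pow_add, mul_smul, h.pow_smul, smul_zero]

theorem torsionCard_pi (h : IsBlockFamily π b σ τ D BC) (n : ℕ) (e : ℕ → ℕ) (k : ℕ) :
    torsionCard π (∀ i : Fin n, C (e i)) k = b ^ ∑ i ∈ range n, min k (e i) := by
  rw [_root_.torsionCard_pi]
  simp only [h.torsion]
  rw [Finset.prod_pow_eq_pow_sum, Fin.sum_univ_eq_sum_range (fun i => min k (e i))]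

theorem card_pi (h : IsBlockFamily π b σ τ D BC) (n : ℕ) (e : ℕ → ℕ) :
    Nat.card (∀ i : Fin n, C (e i)) = b ^ ∑ i ∈ range n, e i := by
  have h1 : ∀ l, Nat.card (C l) = b ^ l := fun l => by
    rw [← min_self l, ← h.torsion l l, torsionCard, min_self]
    exact (Nat.card_congr (Equiv.subtypeUnivEquiv (h.pow_smul l))).symm
  rw [Nat.card_pi]
  simp only [h1]
  rw [Finset.prod_pow_eq_pow_sum, Fin.sum_univ_eq_sum_range]

/-- An isometric embedding of a block splits off an orthogonal summand. -/
theorem split (h : IsBlockFamily π b σ τ D BC) {M : Type*} [AddCommGroup M] [Module R M]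
    {B : M → M → W} (hB : IsPairing σ τ D B) (hn : IsNondegenerate B) {l : ℕ}
    (i : IsometricMap R (BC l) B) :
    IsNondegenerate (fun x y : hB.perp i.1 => B x y) ∧
    ∃ g : (C l × hB.perp i.1) ≃ₗ[R] M, (∀ c y, g (c, y) = i.1 c + y) ∧
      ∀ x y, B (g x) (g y) = prodPairing (BC l) (fun x y : hB.perp i.1 => B x y) x y := by
  obtain ⟨i, hi⟩ := i
  have hperp : ∀ (y : hB.perp i) c, B (i c) y = 0 := fun y c => y.2 c
  let g : (C l × hB.perp i) →ₗ[R] M := LinearMap.coprod i (hB.perp i).subtype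
  have hg : ∀ x, g x = i x.1 + x.2 := fun x => rfl
  have hbij : Function.Bijective g := by
    constructor
    · rw [injective_iff_map_eq_zero]
      rintro ⟨c, y⟩ h0
      rw [hg] at h0
      have hc : c = 0 := h.nondegenerate l c fun c' => by
        have := congrArg (B (i c')) h0
        simpa only [hB.add_right, hi, hperp, hB.zero_right, add_zero] using this
      subst hc
      simpa using h0
    · intro m
      obtain ⟨c, hc⟩ := h.represent l (fun c' => B (i c') m)
        (fun x y => by rw [map_add, hB.add_left]) (fun a x => by rw [map_smul, hB.smul_left])
      refine ⟨(c, ⟨m - i c, fun c' => ?_⟩), by simp [hg]⟩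
      rw [sub_eq_add_neg, ← neg_one_smul R (i c), hB.add_right, hB.smul_right, hc, hi]
      simp
  refine ⟨fun y hy => ?_, LinearEquiv.ofBijective g hbij, fun c y => rfl, fun x y => ?_⟩
  · refine Subtype.ext (hn _ fun m => ?_)
    obtain ⟨⟨c, y'⟩, rfl⟩ := hbij.2 m
    rw [hg, hB.add_left, hperp, zero_add]
    exact hy y'
  · change B (i x.1 + x.2) (i y.1 + y.2) = _
    rw [hB.add_left, hB.add_right, hB.add_right, hi, hperp, hB.eq_zero_symm (hperp x.2 y.1),
      add_zero, zero_add]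
    rfl

/-- Induction on the order of the module. If `π^l` is the exact exponent, a block `C l` embeds
isometrically and splits off. Its orthogonal complement is again nondegenerate, is smaller, and is
killed by `π^l`, so `l` may be put in front of its partition. -/
theorem classification (h : IsBlockFamily π b σ τ D BC) (M : Type u) [AddCommGroup M] [Module R M]
    [Finite M] (B : M → M → W) (hB : IsPairing σ τ D B) (hn : IsNondegenerate B)
    (hM : ∃ L, ∀ x : M, π ^ L • x = 0) :
    ∃ n e, IsPartition n e ∧ AreIsometric R B (piPairing BC n e) := by
  classical
  obtain ⟨m, hm⟩ : ∃ m, Nat.card M = m := ⟨_, rfl⟩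
  induction m using Nat.strong_induction_on generalizing M with
  | _ m ih =>
    obtain hl | hl := Nat.eq_zero_or_pos (Nat.find hM)
    · have h0 : ∀ x : M, x = 0 := fun x => by simpa [hl] using Nat.find_spec hM x
      refine ⟨0, fun _ => 0, ⟨antitone_const, fun i => by simp⟩, ⟨?_, fun x y => ?_⟩⟩
      · exact
          { toFun := 0, map_add' := by simp, map_smul' := by simp, invFun := 0
            left_inv := fun x => (h0 x).symm, right_inv := fun x => Subsingleton.elim _ _ }
      · rw [h0 x, hB.zero_left]
        rfl
    · set l := Nat.find hM
      have hl1 : ∀ x : M, π ^ l • x = 0 := Nat.find_spec hM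
      obtain ⟨i⟩ := h.embed M B hB hn l hl hl1 (by
        have := Nat.find_min hM (show l - 1 < l by omega)
        push Not at this
        exact this)
      obtain ⟨hn', g, hg, hgB⟩ := h.split hB hn i
      have hcard : Nat.card M = b ^ l * Nat.card (hB.perp i.1) := by
        rw [← Nat.card_congr g.toEquiv, Nat.card_prod]
        congr 1
        rw [← min_self l, ← h.torsion l l, torsionCard, min_self]
        exact (Nat.card_congr (Equiv.subtypeUnivEquiv (h.pow_smul l))).symm
      obtain ⟨n, e, he, f⟩ := ih (Nat.card (hB.perp i.1)) (by
        rw [← hm, hcard]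
        exact lt_mul_left Nat.card_pos (Nat.one_lt_pow (by omega) h.one_lt))
        (hB.perp i.1) (fun x y => B x y) (hB.restrict _) hn' ⟨l, fun x => Subtype.ext (hl1 x)⟩ rfl
      -- A block with `e 0 > l` would be killed by `π^l`; its torsion counts at `l` and at `e 0`
      -- would then agree, although they are different powers of `b`.
      have he0 : e 0 ≤ l := by
        by_contra! hlt
        have hn0 : 0 < n := by
          by_contra hn0
          have := (he.le_iff 0).1 (by omega)
          omega
        obtain ⟨f, -⟩ := f
        have h1 : ∀ x : C (e 0), π ^ l • x = 0 := fun x => by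
          have h2 : ∀ z : (∀ i : Fin n, C (e i)), π ^ l • z = 0 := fun z => f.symm.injective (by
            rw [map_smul, map_zero]
            exact Subtype.ext (hl1 _))
          have := congrFun (h2 (Pi.single (⟨0, hn0⟩ : Fin n) x)) ⟨0, hn0⟩
          rw [Pi.smul_apply, Pi.single_eq_same] at this
          exact this
        have h3 := h.torsion (e 0) l
        have h4 := h.torsion (e 0) (e 0)
        rw [torsionCard, Nat.card_congr (Equiv.subtypeUnivEquiv h1)] at h3
        rw [torsionCard, Nat.card_congr (Equiv.subtypeUnivEquiv (h.pow_smul _)), h3] at h4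
        have := Nat.pow_right_injective h.one_lt h4
        omega
      refine ⟨n + 1, consPart l e, he.cons hl he0, ?_⟩
      have h1 : AreIsometric R B (prodPairing (BC l) (fun x y : hB.perp i.1 => B x y)) :=
        AreIsometric.symm ⟨g, hgB⟩
      exact (h1.trans (f.prod (BC l))).trans (areIsometric_piPairing_succ BC n (consPart l e))

theorem eq_of_torsionCard_eq (h : IsBlockFamily π b σ τ D BC) {n n' : ℕ} {e e' : ℕ → ℕ}
    (he : IsPartition n e) (he' : IsPartition n' e')
    (hc : ∀ k, torsionCard π (∀ i : Fin n, C (e i)) k =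
      torsionCard π (∀ i : Fin n', C (e' i)) k) : n = n' ∧ e = e' := by
  refine he.eq_of_sum_min he' fun k => ?_
  have := hc k
  rw [h.torsionCard_pi, h.torsionCard_pi] at this
  exact Nat.pow_right_injective h.one_lt this

theorem pairing_pi (h : IsBlockFamily π b σ τ D BC) (n : ℕ) (e : ℕ → ℕ)
    (hD : ∀ x y, x ∈ D → y ∈ D → x + y ∈ D) (hD0 : 0 ∈ D) :
    IsPairing σ τ D (piPairing BC n e) := by
  refine ⟨fun x y z => ?_, fun x y z => ?_, fun a x y => ?_, fun a x y => ?_, fun x y => ?_,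
    fun x => ?_⟩
  · simp only [piPairing, Pi.add_apply, (h.pairing _).add_left, sum_add_distrib]
  · simp only [piPairing, Pi.add_apply, (h.pairing _).add_right, sum_add_distrib]
  · simp only [piPairing, Pi.smul_apply, (h.pairing _).smul_left, smul_sum]
  · simp only [piPairing, Pi.smul_apply, (h.pairing _).smul_right, smul_sum]
  · simp only [piPairing, map_sum]
    exact sum_congr rfl fun i _ => (h.pairing _).symm _ _
  · exact sum_induction _ (· ∈ D) hD hD0 fun i _ => (h.pairing _).diag _

theorem nondegenerate_pi (h : IsBlockFamily π b σ τ D BC) (n : ℕ) (e : ℕ → ℕ) :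
    IsNondegenerate (piPairing BC n e) := by
  intro x hx
  funext i
  refine h.nondegenerate _ _ fun c => ?_
  have := hx (Pi.single i c)
  rw [piPairing, sum_eq_single i] at this
  · simpa using this
  · intro j _ hj
    rw [Pi.single_eq_of_ne hj, (h.pairing _).zero_left]
  · simp

/-- An isometry is restricted to the summand `C l`. Every isometric embedding occurs, since by `hc`
its orthogonal complement is a copy of `N`. The isometries with a given restriction form a torsor
under those of `N`. -/
theorem card_isometricAut_prod (h : IsBlockFamily π b σ τ D BC) {l : ℕ} {N : Type*} [AddCommGroup N]
    [Module R N] {B : N → N → W}  (hB : IsPairing σ τ D (prodPairing (BC l) B))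
    (hn : IsNondegenerate (prodPairing (BC l) B))
    (hc : ∀ i : IsometricMap R (BC l) (prodPairing (BC l) B),
      AreIsometric R B (fun x y : hB.perp i.1 => prodPairing (BC l) B x y)) :
    Nat.card (IsometricAut R (prodPairing (BC l) B)) =
      Nat.card (IsometricMap R (BC l) (prodPairing (BC l) B)) * Nat.card (IsometricAut R B) := by
  have hB0 : ∀ y, B y 0 = 0 := fun y => by
    have := hB.zero_right (0, y)
    simpa [prodPairing, (h.pairing l).zero_right] using this
  have hB0' : ∀ y, B 0 y = 0 := fun y => by
    have := hB.zero_left (0, y)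
    simpa [prodPairing, (h.pairing l).zero_right] using this
  refine card_eq_mul_of_torsor
    (fun g => ⟨g.1.toLinearMap ∘ₗ LinearMap.inl R (C l) N, fun x y => ?_⟩)
    (fun g k => ⟨((LinearEquiv.refl R (C l)).prodCongr k.1).trans g.1, fun x y => ?_⟩) ?_ ?_ ?_ ?_
  · exact (g.2 _ _).trans (by simp [prodPairing, hB0])
  · exact (g.2 _ _).trans (by simp [prodPairing, k.2])
  · intro i
    obtain ⟨-, g, hg, hgB⟩ := h.split hB hn i
    obtain ⟨f, hf⟩ := hc i
    refine ⟨⟨((LinearEquiv.refl R (C l)).prodCongr f).trans g, fun x y => ?_⟩,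
      Subtype.ext (LinearMap.ext fun a => ?_)⟩
    · rw [LinearEquiv.trans_apply, LinearEquiv.trans_apply, hgB]
      exact congrArg _ (hf _ _)
    · change g (a, f 0) = _
      rw [hg, map_zero]
      simp
  · intro g k k' hk
    refine Subtype.ext (LinearEquiv.ext fun y => ?_)
    have := g.1.injective (LinearEquiv.congr_fun (congrArg Subtype.val hk) (0, y))
    simpa using this
  · intro g k
    refine Subtype.ext (LinearMap.ext fun a => ?_)
    simp
  · intro g g' hgg
    have h1 : ∀ a, g.1 (a, 0) = g'.1 (a, 0) := fun a =>
      LinearMap.congr_fun (congrArg Subtype.val hgg) a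
    set k := g'.1.trans g.1.symm with hk
    have hkB : ∀ x y, prodPairing (BC l) B (k x) (k y) = prodPairing (BC l) B x y := fun x y => by
      have hgk : ∀ x, g.1 (k x) = g'.1 x := fun x => g.1.apply_symm_apply _
      rw [← g.2, hgk, hgk, g'.2]
    have hk1 : ∀ a, k (a, 0) = (a, 0) := fun a => by
      rw [hk, LinearEquiv.trans_apply, ← h1, LinearEquiv.symm_apply_apply]
    -- The first component is determined by the pairings with the vectors `(c, 0)`, which `k` fixes.
    have hk2 : ∀ x, (k x).1 = x.1 := by
      intro x
      rw [← sub_eq_zero]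
      refine h.nondegenerate l _ fun c => ?_
      have h3 := hkB (c, 0) x
      rw [hk1] at h3
      simp only [prodPairing, hB0', add_zero] at h3
      rw [sub_eq_add_neg, ← neg_one_smul R x.1, (h.pairing l).add_right, (h.pairing l).smul_right,
        h3]
      simp
    obtain ⟨f, hf⟩ := exists_linearEquiv_snd k hk1 hk2
    refine ⟨⟨f, fun x y => ?_⟩, Subtype.ext (LinearEquiv.ext fun x => ?_)⟩
    · have := hkB (0, x) (0, y)
      simpa [hf, prodPairing, (h.pairing l).zero_right] using this
    · obtain ⟨a, y⟩ := x
      have := hf a y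
      rw [hk, LinearEquiv.trans_apply, LinearEquiv.symm_apply_eq] at this
      rw [this]; rfl

/-- The required Witt cancellation follows from the classification: the complement of an embedded
block is a sum of blocks, and torsion counts identify its partition as the one without the first
part. -/
theorem card_isometricAut_succ (h : IsBlockFamily π b σ τ D BC)
    (hD : ∀ x y, x ∈ D → y ∈ D → x + y ∈ D) (hD0 : 0 ∈ D) {n : ℕ} {e : ℕ → ℕ}
    (he : IsPartition (n + 1) e) :
    Nat.card (IsometricAut R (piPairing BC (n + 1) e)) =
      Nat.card (IsometricMap R (BC (e 0)) (piPairing BC (n + 1) e)) *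
        Nat.card (IsometricAut R (piPairing BC n fun i => e (i + 1))) := by
  have hi := areIsometric_piPairing_succ (R := R) BC n e
  have _ := fun l => h.finite l
  obtain ⟨c, hcB⟩ := id hi
  have hB := (h.pairing_pi (n + 1) e hD hD0).of_isometric c.toLinearMap hcB
  have hn : IsNondegenerate (prodPairing (BC (e 0)) (piPairing BC n fun i => e (i + 1))) :=
    fun x hx => c.injective (by
      rw [map_zero]
      refine h.nondegenerate_pi (n + 1) e _ fun y => ?_
      rw [← c.apply_symm_apply y, hcB]
      exact hx _)
  rw [← hi.card_isometricAut, ← hi.card_isometricMap]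
  refine h.card_isometricAut_prod hB hn fun i => ?_
  obtain ⟨hn', g, hg, hgB⟩ := h.split hB hn i
  have hkill : ∀ x : C (e 0) × (∀ i : Fin n, C (e (i + 1))), π ^ e 0 • x = 0 := fun x =>
    c.injective (funext fun j => by
      rw [map_smul, map_zero]
      exact h.pow_smul_of_le (he.antitone (Nat.zero_le (j : ℕ))) _)
  obtain ⟨n', e', he', f⟩ := h.classification (hB.perp i.1) _ (hB.restrict _) hn'
    ⟨e 0, fun x => Subtype.ext (hkill x)⟩
  obtain ⟨f', -⟩ := id f
  obtain ⟨rfl, rfl⟩ := h.eq_of_torsionCard_eq he.succ he' fun k => by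
    have h1 := torsionCard_congr π g k
    rw [torsionCard_prod, torsionCard_prod, h.torsion, torsionCard_congr π f' k] at h1
    exact (Nat.eq_of_mul_eq_mul_left (pow_pos (zero_lt_one.trans h.one_lt) _) h1).symm
  exact f.symm

end IsBlockFamily

end Pairings


/-! ### The quotient of `𝔬` by `𝔭^k` inside `F/𝔬`. -/

section DivPow

theorem coe_uniformizer_pow_ne_zero {F : Type*} [Field F] [ValuativeRel F] {π : 𝒪[F]}
    (hπ : Irreducible π) (k : ℕ) : (π : F) ^ k ≠ 0 :=
  pow_ne_zero _ fun h => hπ.ne_zero (Subtype.ext h)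

variable {F : Type*} [Field F] [ValuativeRel F] [TopologicalSpace F]
  [IsNonarchimedeanLocalField F] {π : 𝒪[F]} (hπ : Irreducible π)

theorem divPow_mk (k : ℕ) (a : 𝒪[F]) :
    divPow hπ k (Ideal.Quotient.mk _ a) =
      (1 : Submodule 𝒪[F] F).mkQ ((a : F) * ((π : F) ^ k)⁻¹) := rfl

theorem divPow_injective (k : ℕ) : Function.Injective (divPow hπ k) := by
  rw [injective_iff_map_eq_zero]
  intro x hx
  obtain ⟨a, rfl⟩ := Ideal.Quotient.mk_surjective x
  rw [divPow_mk, Submodule.mkQ_apply, Submodule.Quotient.mk_eq_zero, Submodule.mem_one] at hx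
  obtain ⟨b, hb⟩ := hx
  have hb' : (b : F) = (a : F) * ((π : F) ^ k)⁻¹ := hb
  rw [Ideal.Quotient.eq_zero_iff_mem, mem_maximalIdeal_pow hπ]
  refine ⟨b, Subtype.ext ?_⟩
  push_cast
  rw [hb']
  field_simp [coe_uniformizer_pow_ne_zero hπ k]

/-- Together with injectivity this identifies `𝔬/𝔭^k` with the `π^k`-torsion of `F/𝔬`. Pairings on
modules killed by `π^k` may thus be read in the ring `𝔬/𝔭^k`. -/
theorem exists_divPow_eq {k : ℕ} {w : FieldModInt F} (hw : π ^ k • w = 0) :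
    ∃ a, divPow hπ k a = w := by
  obtain ⟨z, rfl⟩ := Submodule.Quotient.mk_surjective _ w
  rw [← Submodule.Quotient.mk_smul, Submodule.Quotient.mk_eq_zero, Submodule.mem_one] at hw
  obtain ⟨b, hb⟩ := hw
  have hb' : (b : F) = (π : F) ^ k * z := by
    rw [← SubmonoidClass.coe_pow]; exact hb
  refine ⟨Ideal.Quotient.mk _ b, ?_⟩
  rw [divPow_mk, hb', Submodule.mkQ_apply]
  congr 1
  field_simp [coe_uniformizer_pow_ne_zero hπ k]

end DivPow

/-! ### Alternating modules: hyperbolic planes and their embeddings. -/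

section Alternating

open Finset IsLocalRing

universe u

variable {F : Type u} [Field F] [ValuativeRel F] [TopologicalSpace F]
  [IsNonarchimedeanLocalField F] {π : 𝒪[F]} (hπ : Irreducible π)

variable (F) in
/-- The module underlying the hyperbolic plane of exponent `𝔭 ^ l`. -/
abbrev HyperbolicPlane (l : ℕ) : Type u := (𝒪[F] ⧸ 𝓂[F] ^ l) × (𝒪[F] ⧸ 𝓂[F] ^ l)

/-- The pairing of the hyperbolic plane. -/
noncomputable def hyperbolicPairing (l : ℕ) (x y : HyperbolicPlane F l) : FieldModInt F :=
  divPow hπ l (x.2 * y.1 - x.1 * y.2)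

/-- Alternating pairings with values in `F / 𝔬`. -/
abbrev IsAlternatingPairing {M : Type*} [AddCommGroup M] [Module 𝒪[F] M]
    (B : M → M → FieldModInt F) : Prop :=
  IsPairing (RingHom.id 𝒪[F]) (-AddMonoidHom.id (FieldModInt F)) {0} B

theorem hyperbolicPairing_isAlternating (l : ℕ) : IsAlternatingPairing (hyperbolicPairing hπ l) := by
  refine ⟨fun x y z => ?_, fun x y z => ?_, fun a x y => ?_, fun a x y => ?_, fun x y => ?_,
    fun x => ?_⟩
  · rw [hyperbolicPairing, hyperbolicPairing, hyperbolicPairing, ← map_add]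
    congr 1
    simp only [Prod.snd_add, Prod.fst_add]
    ring
  · rw [hyperbolicPairing, hyperbolicPairing, hyperbolicPairing, ← map_add]
    congr 1
    simp only [Prod.snd_add, Prod.fst_add]
    ring
  · rw [hyperbolicPairing, hyperbolicPairing, RingHom.id_apply, ← map_smul, smul_sub,
      ← smul_mul_assoc, ← smul_mul_assoc]
    rfl
  · rw [hyperbolicPairing, hyperbolicPairing, ← map_smul, smul_sub,
      ← mul_smul_comm, ← mul_smul_comm]
    rfl
  · change _ = -hyperbolicPairing hπ l x y
    rw [hyperbolicPairing, hyperbolicPairing, ← map_neg]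
    congr 1
    ring
  · rw [Set.mem_singleton_iff, hyperbolicPairing, mul_comm, sub_self, map_zero]

include hπ in
/-- In a nondegenerate alternating module of exponent `𝔭 ^ l`, an element of maximal order takes
every value of order at most `𝔭 ^ l`. -/
theorem exists_additive_pairing {M : Type*} [AddCommGroup M] [Module 𝒪[F] M]
    {B : M → M → FieldModInt F} (hB : IsAlternatingPairing B) (hn : IsNondegenerate B) {l : ℕ}
    (hl : ∀ x : M, π ^ l • x = 0) {x : M} (hx : π ^ (l - 1) • x ≠ 0) :
    ∃ f : M →+ 𝒪[F] ⧸ 𝓂[F] ^ l, Function.Surjective f ∧ ∀ y, B y x = divPow hπ l (f y) := by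
  have h1 : ∀ y, ∃ a, divPow hπ l a = B y x := fun y => exists_divPow_eq hπ (by
    rw [← hB.smul_right, hl, hB.zero_right])
  choose f hf using h1
  refine ⟨AddMonoidHom.mk' f fun y z => divPow_injective hπ l ?_, fun a => ?_, fun y => (hf y).symm⟩
  · rw [map_add, hf, hf, hf, hB.add_left]
  -- Nondegeneracy at `π^{l-1} x ≠ 0` gives a `y` whose pairing with `x` is a unit of `𝔬/𝔭^l`.
  -- Multiples of `y` then realize every value.
  · obtain ⟨y, hy⟩ : ∃ y, B y (π ^ (l - 1) • x) ≠ 0 := by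
      by_contra! hcon
      exact hx (hn _ hcon)
    obtain ⟨b, hb⟩ := Ideal.Quotient.mk_surjective (f y)
    obtain ⟨c, rfl⟩ := Ideal.Quotient.mk_surjective a
    have hu : IsUnit b := isUnit_of_pow_smul_ne_zero (l := l) hπ (fun h0 => hy (by
      rw [hB.smul_right, ← hf, ← map_smul, ← hb]
      exact (congrArg _ h0).trans (map_zero _)))
    obtain ⟨v, hv⟩ := hu.exists_left_inv
    refine ⟨(c * v) • y, divPow_injective hπ l ?_⟩
    change divPow hπ l (f _) = _
    rw [hf, hB.smul_left, ← hf, ← hb, RingHom.id_apply, ← map_smul]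
    congr 1
    change Ideal.Quotient.mk _ (c * v * b) = _
    rw [mul_assoc, hv, mul_one]

/-- Isometric maps from a hyperbolic plane correspond to hyperbolic pairs. -/
theorem bijective_isometricMap_hyperbolic {M : Type*} [AddCommGroup M] [Module 𝒪[F] M]
    {B : M → M → FieldModInt F} (hB : IsAlternatingPairing B) {l : ℕ}
    (hl : ∀ x : M, π ^ l • x = 0) :
    Function.Bijective (fun i : IsometricMap 𝒪[F] (hyperbolicPairing hπ l) B =>
      (⟨(i.1 (1, 0), i.1 (0, 1)), by rw [i.2]; simp [hyperbolicPairing]⟩ :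
        {p : M × M // B p.2 p.1 = divPow hπ l 1})) := by
  constructor
  · rintro ⟨i, hi⟩ ⟨j, hj⟩ hij
    have h1 := congrArg Subtype.val hij
    rw [Prod.mk.injEq] at h1
    refine Subtype.ext (LinearMap.prod_ext ?_ ?_)
    · exact linearMap_quotient_ext h1.1
    · exact linearMap_quotient_ext h1.2
  · rintro ⟨⟨x, y⟩, hxy⟩
    obtain ⟨f, hf⟩ := exists_linearMap_quotient hπ (hl x)
    obtain ⟨g, hg⟩ := exists_linearMap_quotient hπ (hl y)
    refine ⟨⟨f.coprod g, fun c d => ?_⟩, ?_⟩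
    · obtain ⟨c₁, c₂⟩ := c
      obtain ⟨d₁, d₂⟩ := d
      obtain ⟨a₁, rfl⟩ := Ideal.Quotient.mk_surjective c₁
      obtain ⟨a₂, rfl⟩ := Ideal.Quotient.mk_surjective c₂
      obtain ⟨b₁, rfl⟩ := Ideal.Quotient.mk_surjective d₁
      obtain ⟨b₂, rfl⟩ := Ideal.Quotient.mk_surjective d₂
      have h1 : ∀ z, B z z = 0 := hB.diag
      have h2 : B x y = -divPow hπ l 1 := by rw [hB.symm y x, hxy]; rfl
      have h3 : ∀ a : 𝒪[F], divPow hπ l (Ideal.Quotient.mk _ a) = a • divPow hπ l 1 :=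
        fun a => linearMap_quotient_apply _ a
      rw [LinearMap.coprod_apply, LinearMap.coprod_apply, linearMap_quotient_apply f,
        linearMap_quotient_apply f, linearMap_quotient_apply g, linearMap_quotient_apply g, hf, hg]
      simp only [hB.add_left, hB.add_right, hB.smul_left, hB.smul_right, h1, hxy, h2,
        RingHom.id_apply, smul_zero]
      rw [hyperbolicPairing, ← map_mul, ← map_mul, ← map_sub, h3]
      module
    · refine Subtype.ext (Prod.ext ?_ ?_)
      · simpa using hf
      · simpa using hg

/-- A vector of maximal order can be completed to a hyperbolic pair, which gives the embedding. The
torsion base is `q²` since the plane consists of two cyclic modules. -/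
theorem isBlockFamily_hyperbolic : IsBlockFamily π (Nat.card 𝓀[F] ^ 2) (RingHom.id 𝒪[F])
    (-AddMonoidHom.id (FieldModInt F)) {0} (hyperbolicPairing hπ) where
  pairing := hyperbolicPairing_isAlternating hπ
  nondegenerate l x hx := by
    have h1 : x.1 = 0 := divPow_injective hπ l (by
      simpa [hyperbolicPairing] using hx (0, 1))
    have h2 : x.2 = 0 := divPow_injective hπ l (by
      simpa [hyperbolicPairing] using hx (1, 0))
    exact Prod.ext h1 h2
  finite l := inferInstanceAs (Finite ((𝒪[F] ⧸ maximalIdeal 𝒪[F] ^ l) × (𝒪[F] ⧸ maximalIdeal 𝒪[F] ^ l)))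
  represent l f hf hf' := by
    let g : HyperbolicPlane F l →ₗ[𝒪[F]] FieldModInt F := ⟨⟨f, hf⟩, hf'⟩
    have hk : ∀ x : HyperbolicPlane F l, π ^ l • g x = 0 := fun x => by
      rw [← map_smul, show π ^ l • x = 0 from
        Prod.ext (pow_smul_eq_zero hπ le_rfl x.1) (pow_smul_eq_zero hπ le_rfl x.2), map_zero]
    obtain ⟨a, ha⟩ := exists_divPow_eq hπ (hk (1, 0))
    obtain ⟨b, hb⟩ := exists_divPow_eq hπ (hk (0, 1))
    refine ⟨(b, -a), fun c => ?_⟩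
    have h1 : g = (divPow hπ l ∘ₗ LinearMap.mulRight 𝒪[F] a).coprod
        (divPow hπ l ∘ₗ LinearMap.mulRight 𝒪[F] b) := by
      refine LinearMap.prod_ext (linearMap_quotient_ext ?_) (linearMap_quotient_ext ?_)
      · simp [← ha]
      · simp [← hb]
    change g c = _
    rw [h1, hyperbolicPairing, LinearMap.coprod_apply]
    simp only [LinearMap.comp_apply, LinearMap.mulRight_apply]
    rw [← map_add]
    congr 1
    ring
  one_lt := Nat.one_lt_pow two_ne_zero Finite.one_lt_card
  pow_smul l x := Prod.ext (pow_smul_eq_zero hπ le_rfl x.1) (pow_smul_eq_zero hπ le_rfl x.2)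
  torsion l k := by
    rw [torsionCard_prod, torsionCard_quotient hπ, ← pow_two, ← pow_mul, ← pow_mul, mul_comm]
  embed M _ _ _ B hB hn l _ hl' hx := by
    obtain ⟨x, hx⟩ := hx
    obtain ⟨f, hf, hfB⟩ := exists_additive_pairing hπ hB hn hl' hx
    obtain ⟨y, hy⟩ := hf 1
    obtain ⟨i, -⟩ := (bijective_isometricMap_hyperbolic hπ hB hl').2 ⟨(x, y), by rw [hfB, hy]⟩
    exact ⟨i⟩

/-- A hyperbolic pair consists of a vector of maximal order and a partner in one fibre of the
surjection that it induces onto `𝔬/𝔭^l`. -/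
theorem card_isometricMap_hyperbolic {M : Type*} [AddCommGroup M] [Module 𝒪[F] M] [Finite M]
    {B : M → M → FieldModInt F} (hB : IsAlternatingPairing B) (hn : IsNondegenerate B) {l : ℕ}
    (hl : 1 ≤ l) (hl' : ∀ x : M, π ^ l • x = 0) :
    Nat.card (IsometricMap 𝒪[F] (hyperbolicPairing hπ l) B) * Nat.card 𝓀[F] ^ l =
      Nat.card {x : M // ¬ π ^ (l - 1) • x = 0} * Nat.card M := by
  rw [Nat.card_congr (Equiv.ofBijective _ (bijective_isometricMap_hyperbolic hπ hB hl'))]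
  have hfib : ∀ x : {x : M // ¬ π ^ (l - 1) • x = 0},
      Nat.card {y : M // B y x = divPow hπ l 1} * Nat.card 𝓀[F] ^ l = Nat.card M := by
    rintro ⟨x, hx⟩
    obtain ⟨f, hf, hfB⟩ := exists_additive_pairing hπ hB hn hl' hx
    have := card_fiber_mul_card f hf 1
    rw [card_quotient_maximalIdeal_pow] at this
    rw [← this]
    congr 1
    refine Nat.card_congr (Equiv.subtypeEquivRight fun y => ?_)
    rw [hfB, (divPow_injective hπ l).eq_iff]
  have hx : ∀ x y : M, B y x = divPow hπ l 1 → ¬ π ^ (l - 1) • x = 0 := fun x y hxy h0 =>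
    pow_pred_smul_one_ne_zero hπ hl (divPow_injective hπ l (by
      rw [map_smul, ← hxy, ← hB.smul_right, h0, hB.zero_right, map_zero]))
  have hcard : Nat.card {p : M × M // B p.2 p.1 = divPow hπ l 1} =
      Nat.card (Σ x : {x : M // ¬ π ^ (l - 1) • x = 0}, {y : M // B y x = divPow hπ l 1}) :=
    Nat.card_congr
      { toFun := fun p => ⟨⟨p.1.1, hx _ _ p.2⟩, ⟨p.1.2, p.2⟩⟩
        invFun := fun p => ⟨(p.1.1, p.2.1), p.2.2⟩
        left_inv := fun _ => rfl
        right_inv := fun _ => rfl }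
  have := Fintype.ofFinite {x : M // ¬ π ^ (l - 1) • x = 0}
  rw [hcard, Nat.card_sigma, sum_mul]
  simp only [hfib]
  rw [sum_const, card_univ, smul_eq_mul, ← Nat.card_eq_fintype_card]

theorem IsBlockFamily.card_not_torsion {R W : Type*} [CommRing R] [AddCommGroup W] [Module R W]
    {π : R} {b : ℕ} {σ : R →+* R} {τ : W →+ W} {D : Set W} {C : ℕ → Type u}
    [∀ l, AddCommGroup (C l)] [∀ l, Module R (C l)] {BC : ∀ l, C l → C l → W}
    (h : IsBlockFamily π b σ τ D BC) (n : ℕ) (e : ℕ → ℕ) (k : ℕ) :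
    (Nat.card {x : ∀ i : Fin n, C (e i) // ¬ π ^ k • x = 0} : ℝ) =
      (b : ℝ) ^ (∑ i ∈ range n, e i) - (b : ℝ) ^ (∑ i ∈ range n, min k (e i)) := by
  have _ := fun l => h.finite l
  have h2 := card_subtype_add_card_subtype_not (fun x : ∀ i : Fin n, C (e i) => π ^ k • x = 0)
  have h1 := h.torsionCard_pi n e k
  rw [torsionCard] at h1
  rw [h1, h.card_pi] at h2
  rw [eq_sub_iff_add_eq']
  exact_mod_cast h2

/-- With `Q = q²`, the count is as for modules without pairing, except that the fibre condition
costs `q^l` and not `Q^l`. The quotient `q^{e 0}` is the origin of `κ = q`. -/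
theorem card_isometricAut_alternating_succ {n : ℕ} {e : ℕ → ℕ} (he : IsPartition (n + 1) e) :
    (Nat.card (IsometricAut 𝒪[F] (piPairing (hyperbolicPairing hπ) (n + 1) e)) : ℝ) =
      (Nat.card 𝓀[F] : ℝ) ^ e 0 *
        ((Nat.card 𝓀[F] : ℝ) ^ 2) ^ (2 * ∑ i ∈ range n, e (i + 1) + e 0) *
        (1 - ((Nat.card 𝓀[F] : ℝ) ^ 2)⁻¹ ^ firstMult (n + 1) e) *
        Nat.card (IsometricAut 𝒪[F] (piPairing (hyperbolicPairing hπ) n fun i => e (i + 1))) := by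
  have h := isBlockFamily_hyperbolic hπ
  set q := Nat.card 𝓀[F] with hq
  have hq0 : (q : ℝ) ≠ 0 := Nat.cast_ne_zero.2 Nat.card_pos.ne'
  have hD : ∀ x y : FieldModInt F, x ∈ ({0} : Set (FieldModInt F)) → y ∈ ({0} : Set _) →
      x + y ∈ ({0} : Set (FieldModInt F)) := by
    rintro _ _ rfl rfl
    simp
  have _ := fun l => h.finite l
  have hS := card_isometricMap_hyperbolic hπ (h.pairing_pi (n + 1) e hD rfl)
    (h.nondegenerate_pi (n + 1) e) he.pos
    (fun x => funext fun i => h.pow_smul_of_le (he.antitone (Nat.zero_le (i : ℕ))) (x i))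
  rw [h.card_isometricAut_succ hD rfl he]
  rw [h.card_pi, ← hq] at hS
  replace hS := congrArg (Nat.cast (R := ℝ)) hS
  push_cast at hS ⊢
  rw [h.card_not_torsion] at hS
  push_cast at hS
  have hE := sum_min_pred_add_firstMult he
  set a := ∑ i ∈ range (n + 1), min (e 0 - 1) (e i)
  set m := firstMult (n + 1) e
  have hE' : ∑ i ∈ range (n + 1), e i = ∑ i ∈ range n, e (i + 1) + e 0 := sum_range_succ' _ _
  congr 1
  refine mul_right_cancel₀ (pow_ne_zero (e 0) hq0) (hS.trans ?_)
  calc _ = ((q : ℝ) ^ 2) ^ (∑ i ∈ range n, e (i + 1) + e 0) *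
        (((q : ℝ) ^ 2) ^ (a + m) - ((q : ℝ) ^ 2) ^ (a + m) * ((q : ℝ) ^ 2)⁻¹ ^ m) := by
        have h1 : ((q : ℝ) ^ 2) ^ m * ((q : ℝ) ^ 2)⁻¹ ^ m = 1 := by
          rw [← mul_pow, mul_inv_cancel₀ (pow_ne_zero 2 hq0), one_pow]
        rw [← hE', ← hE, pow_add]
        linear_combination (((q : ℝ) ^ 2) ^ a) ^ 2 * ((q : ℝ) ^ 2) ^ m * h1
    _ = _ := by
        rw [hE, hE']
        ring

end Alternating


/-! ### Traces and norms for an involution of a local ring. -/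

section LocalRingInvolution

variable {A : Type*} [CommRing A] {σ : A →+* A}

/-- Additive form of Hilbert 90: in an ideal stable under the involution, the fixed elements are
"half" of all elements. -/
theorem card_fixed_sq (hσ : ∀ x, σ (σ x) = x) {y : A} (hy : IsUnit (y - σ y)) (I : Ideal A)
    (hI : ∀ x ∈ I, σ x ∈ I) :
    Nat.card {x // x ∈ I ∧ σ x = x} ^ 2 = Nat.card I := by
  obtain ⟨v, hv⟩ := hy.exists_right_inv
  have hd : σ (y - σ y) = -(y - σ y) := by rw [map_sub, hσ]; ring
  have hv' : σ v = -v := by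
    have h1 := congrArg σ hv
    rw [map_mul, hd, map_one] at h1
    calc σ v = ((y - σ y) * v) * σ v := by rw [hv, one_mul]
      _ = -v * (-(y - σ y) * σ v) := by ring
      _ = -v := by rw [h1, mul_one]
  let K : AddSubgroup A := (I.toAddSubgroup) ⊓ (σ.toAddMonoidHom.eqLocus (AddMonoidHom.id A))
  have hK : ∀ x, x ∈ K ↔ x ∈ I ∧ σ x = x := fun x => Iff.rfl
  -- The trace. It is onto the fixed elements because `y v` has trace `1`, where `v` is the inverse
  -- of `y - σ y` and satisfies `σ v = -v`.
  let f : I →+ K := AddMonoidHom.mk' (fun x => ⟨x + σ x, (hK _).2 ⟨I.add_mem x.2 (hI _ x.2), by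
    rw [map_add, hσ, add_comm]⟩⟩) fun a b => Subtype.ext (by
      change ((a : A) + b) + σ (a + b) = (a + σ a) + (b + σ b)
      rw [map_add]; ring)
  have hf : ∀ x, (f x : A) = x + σ x := fun x => rfl
  have hsurj : Function.Surjective f := by
    rintro ⟨k, hk⟩
    obtain ⟨hkI, hk⟩ := (hK k).1 hk
    refine ⟨⟨y * v * k, I.mul_mem_left _ hkI⟩, Subtype.ext ?_⟩
    rw [hf]
    simp only [map_mul, hv', hk]
    linear_combination k * hv
  rw [pow_two, ← card_fiber_mul_card f hsurj 0]
  congr 1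
  -- Multiplication by the unit `y - σ y`, which `σ` negates, maps the fixed elements onto the
  -- elements of trace zero.
  refine Nat.card_congr
    { toFun := fun x => ⟨⟨(y - σ y) * x, I.mul_mem_left _ x.2.1⟩, Subtype.ext ?_⟩
      invFun := fun x => ⟨v * x.1, I.mul_mem_left _ x.1.2, ?_⟩
      left_inv := fun x => Subtype.ext ?_
      right_inv := fun x => Subtype.ext (Subtype.ext ?_) }
  · rw [hf]
    simp only [map_mul, hd, x.2.2]
    rw [ZeroMemClass.coe_zero]
    ring
  · have h1 : (x.1 : A) + σ x.1 = 0 := congrArg Subtype.val x.2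
    rw [map_mul, hv']
    linear_combination (-v) * h1
  · change v * ((y - σ y) * x) = x
    linear_combination (x : A) * hv
  · change (y - σ y) * (v * x.1) = x.1
    linear_combination (x.1 : A) * hv

variable [IsLocalRing A]

/-- Hilbert 90. -/
theorem exists_unit_of_norm_eq_one (hσ : ∀ x, σ (σ x) = x) {y : A} (hy : IsUnit (y - σ y)) {u : A}
    (hu : u * σ u = 1) : ∃ w, IsUnit w ∧ u * σ w = w := by
  -- Every `z + u σ z` solves the equation, so only a unit is needed. The choices `z = 1` and `z =
  -- y` cannot both fail, as `y - σ y = (y + u σ y) - (1 + u) σ y` is a unit.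
  have h : ∀ z, u * σ (z + u * σ z) = z + u * σ z := fun z => by
    rw [map_add, map_mul, hσ]
    linear_combination z * hu
  by_cases h1 : IsUnit (1 + u)
  · refine ⟨1 + u * σ 1, by simpa using h1, h 1⟩
  · refine ⟨y + u * σ y, ?_, h y⟩
    by_contra h2
    have h3 : y - σ y ∈ IsLocalRing.maximalIdeal A := by
      have := (IsLocalRing.maximalIdeal A).sub_mem ((IsLocalRing.mem_maximalIdeal _).2 h2)
        ((IsLocalRing.maximalIdeal A).mul_mem_right (σ y) ((IsLocalRing.mem_maximalIdeal _).2 h1))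
      convert this using 1
      ring
    exact (IsLocalRing.mem_maximalIdeal _).1 h3 hy

/-- A Herbrand quotient argument. The kernel of the norm is the range of `u ↦ u / σ u` by Hilbert
90, and the kernel of the latter is the group of fixed units. Comparing orders, the range of the
norm is as large as the fixed units, in which it lies. -/
theorem norm_units_range [Finite A] (hσ : ∀ x, σ (σ x) = x) {y : A} (hy : IsUnit (y - σ y)) :
    let N : Aˣ →* Aˣ := MonoidHom.id Aˣ * Units.map (σ : A →* A)
    (∀ c, c ∈ N.range ↔ σ c = c) ∧
      Nat.card N.ker * Nat.card {x : A // σ x = x ∧ IsUnit x} = Nat.card Aˣ := by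
  intro N
  have hN : ∀ u, (N u : A) = u * σ u := fun u => rfl
  let P : Aˣ →* Aˣ := MonoidHom.id Aˣ / Units.map (σ : A →* A)
  have hP : ∀ u w, P u = w ↔ (w : A) * σ u = u := fun u w => by
    change u / Units.map (σ : A →* A) u = w ↔ _
    rw [div_eq_iff_eq_mul, Units.ext_iff, eq_comm]
    rfl
  have hker : N.ker = P.range := by
    ext u
    rw [MonoidHom.mem_ker, MonoidHom.mem_range, Units.ext_iff, hN, Units.val_one]
    constructor
    · intro h
      obtain ⟨w, hw, hw'⟩ := exists_unit_of_norm_eq_one hσ hy h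
      exact ⟨hw.unit, (hP _ _).2 hw'⟩
    · rintro ⟨w, hw⟩
      rw [hP] at hw
      have hw' := congrArg σ hw
      rw [map_mul, hσ] at hw'
      refine w.isUnit.mul_left_cancel ?_
      linear_combination hw + (u : A) * hw'
  let K : Subgroup Aˣ := P.ker
  have hK : ∀ c : Aˣ, c ∈ K ↔ σ c = c := fun c => by
    rw [MonoidHom.mem_ker, hP, Units.val_one, one_mul]
  have hKc : Nat.card K = Nat.card {x : A // σ x = x ∧ IsUnit x} :=
    Nat.card_congr
      { toFun := fun u => ⟨u.1, (hK _).1 u.2, u.1.isUnit⟩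
        invFun := fun x => ⟨x.2.2.unit, (hK _).2 x.2.1⟩
        left_inv := fun u => Subtype.ext (Units.ext rfl)
        right_inv := fun x => rfl }
  have h1 := P.ker.card_mul_index
  rw [Subgroup.index_ker, ← hker] at h1
  have h2 := N.ker.card_mul_index
  rw [Subgroup.index_ker] at h2
  have hle : N.range ≤ K := by
    rintro _ ⟨u, rfl⟩
    rw [hK, hN, map_mul, hσ, mul_comm]
  have heq : N.range = K := by
    refine Subgroup.eq_of_le_of_card_ge hle (le_of_eq ?_)
    refine Nat.eq_of_mul_eq_mul_right (Nat.card_pos (α := N.ker)) ?_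
    rw [h1, mul_comm, h2]
  exact ⟨fun c => by rw [heq, hK], by rw [← hKc, mul_comm, h1]⟩

/-- The norm is surjective onto the fixed units. -/
theorem exists_mul_conj_eq [Finite A] (hσ : ∀ x, σ (σ x) = x) {y : A} (hy : IsUnit (y - σ y)) {c : A}
    (hc : IsUnit c) (hc' : σ c = c) : ∃ a, IsUnit a ∧ a * σ a = c := by
  obtain ⟨u, hu⟩ := ((norm_units_range hσ hy).1 hc.unit).2 hc'
  exact ⟨u, u.isUnit, congrArg Units.val hu⟩

theorem card_norm_fiber [Finite A] (hσ : ∀ x, σ (σ x) = x) {y : A} (hy : IsUnit (y - σ y)) {c : A}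
    (hc : IsUnit c) (hc' : σ c = c) :
    Nat.card {a // a * σ a = c} * Nat.card {x : A // σ x = x ∧ IsUnit x} =
      Nat.card {x : A // IsUnit x} := by
  obtain ⟨a, ha, rfl⟩ := exists_mul_conj_eq hσ hy hc hc'
  have hunits : Nat.card {x : A // IsUnit x} = Nat.card Aˣ :=
    Nat.card_congr ⟨fun x => x.2.unit, fun u => ⟨u, u.isUnit⟩, fun x => rfl, fun u => Units.ext rfl⟩
  rw [hunits, ← (norm_units_range hσ hy).2]
  congr 1
  have hker : ∀ u : Aˣ, u ∈ (MonoidHom.id Aˣ * Units.map (σ : A →* A)).ker ↔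
      (u : A) * σ u = 1 := fun u => by
    rw [MonoidHom.mem_ker, Units.ext_iff]
    rfl
  have hmem : ∀ u : (MonoidHom.id Aˣ * Units.map (σ : A →* A)).ker,
      a * u.1 * σ (a * u.1) = a * σ a := fun u => by
    rw [map_mul]
    linear_combination (a * σ a) * (hker _).1 u.2
  refine (Nat.card_congr (Equiv.ofBijective (fun u => ⟨a * u.1, hmem u⟩) ⟨?_, ?_⟩)).symm
  · intro u w huw
    exact Subtype.ext (Units.ext (ha.mul_left_cancel (congrArg Subtype.val huw)))
  · rintro ⟨b, hb⟩
    have hbu : IsUnit b := isUnit_of_mul_isUnit_left (hb ▸ hc)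
    refine ⟨⟨ha.unit⁻¹ * hbu.unit, (hker _).2 ?_⟩, Subtype.ext ?_⟩
    · refine hc.mul_left_cancel ?_
      have h1 : (ha.unit : A) * ((ha.unit⁻¹ : Aˣ) : A) = 1 := Units.mul_inv _
      have h2 := congrArg σ h1
      rw [map_mul, map_one] at h2
      change a * _ = 1 at h1
      change σ a * _ = 1 at h2
      rw [Units.val_mul, map_mul, mul_one]
      change a * σ a * (_ * b * (_ * σ b)) = _
      linear_combination (b * σ b) * (σ a * σ (((ha.unit⁻¹ : Aˣ) : A)) * h1 + h2) + hb
    · change a * (((ha.unit⁻¹ * hbu.unit : Aˣ)) : A) = b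
      rw [Units.val_mul, ← mul_assoc]
      change (ha.unit : A) * _ * _ = _
      rw [Units.mul_inv, one_mul]
      rfl

theorem not_isUnit_add_iff {a c : A} (hc : ¬ IsUnit c) : ¬ IsUnit (a + c) ↔ ¬ IsUnit a := by
  rw [← mem_nonunits_iff, ← mem_nonunits_iff, ← IsLocalRing.mem_maximalIdeal,
    ← IsLocalRing.mem_maximalIdeal]
  exact Ideal.add_mem_iff_left _ ((IsLocalRing.mem_maximalIdeal _).2 hc)

theorem card_norm_add_nonunit {c : A} (hc : ¬ IsUnit c) :
    Nat.card {a // ¬ IsUnit (a * σ a + c)} = Nat.card {a : A // ¬ IsUnit a} := by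
  refine Nat.card_congr (Equiv.subtypeEquivRight fun a => ?_)
  rw [not_isUnit_add_iff hc, IsUnit.mul_iff]
  refine not_congr ⟨fun h => h.1, fun h => ⟨h, h.map σ⟩⟩

/-- If `b` is a fixed nonunit, then `b - c` is a fixed unit. The elements `a` with `a σ a + c = b`
thus form a norm fibre over a unit, and all these fibres have the same size. -/
theorem card_norm_add_unit [Finite A] (hσ : ∀ x, σ (σ x) = x) {y : A} (hy : IsUnit (y - σ y))
    {c : A} (hc : IsUnit c) (hc' : σ c = c) :
    Nat.card {a // ¬ IsUnit (a * σ a + c)} * Nat.card {x : A // σ x = x ∧ IsUnit x} =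
      Nat.card {x : A // σ x = x ∧ ¬ IsUnit x} * Nat.card {x : A // IsUnit x} := by
  have h1 : Nat.card {a // ¬ IsUnit (a * σ a + c)} =
      Nat.card (Σ b : {x : A // σ x = x ∧ ¬ IsUnit x}, {a // a * σ a = b - c}) :=
    Nat.card_congr
      { toFun := fun a => ⟨⟨a * σ a + c, by rw [map_add, map_mul, hσ, hc', mul_comm], a.2⟩,
          ⟨a.1, by simp⟩⟩
        invFun := fun p => ⟨p.2.1, by rw [p.2.2, sub_add_cancel]; exact p.1.2.2⟩
        left_inv := fun a => rfl
        right_inv := fun p => by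
          obtain ⟨⟨b, hb⟩, ⟨a, ha⟩⟩ := p
          have : a * σ a + c = b := by rw [ha]; ring
          subst this
          rfl }
  have := Fintype.ofFinite {x : A // σ x = x ∧ ¬ IsUnit x}
  rw [h1, Nat.card_sigma, Finset.sum_mul]
  have h2 : ∀ b : {x : A // σ x = x ∧ ¬ IsUnit x},
      Nat.card {a // a * σ a = b - c} * Nat.card {x : A // σ x = x ∧ IsUnit x} =
      Nat.card {x : A // IsUnit x} := fun b => by
    refine card_norm_fiber hσ hy ?_ (by rw [map_sub, b.2.1, hc'])
    by_contra h3
    rw [sub_eq_neg_add, not_isUnit_add_iff b.2.2] at h3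
    exact h3 hc.neg
  simp only [h2]
  rw [Finset.sum_const, Finset.card_univ, smul_eq_mul, ← Nat.card_eq_fintype_card]

end LocalRingInvolution


/-! ### Nontrivial action on the residue field. -/

section ResidueAction

open IsLocalRing

variable {R : Type*} [CommRing R] [IsDomain R] [IsDiscreteValuationRing R]

/-- An endomorphism of a discrete valuation ring with finite residue field that fixes a uniformizer
and acts trivially on the residue field is the identity. -/
theorem eq_self_of_trivial_residue_action [Finite (ResidueField R)] {π : R} (hπ : Irreducible π)
    {s : R →+* R} (hs : s π = π) (h : ∀ x, ¬ IsUnit (x - s x)) (x : R) : s x = x := by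
  have h1 : ∀ x, π ∣ s x - x := fun x => by
    rw [← Ideal.mem_span_singleton, ← hπ.maximalIdeal_eq, mem_maximalIdeal, mem_nonunits_iff,
      ← IsUnit.neg_iff, neg_sub]
    exact h x
  have hker : ∀ a : R, residue R a = 0 ↔ π ∣ a := fun a => by
    rw [residue_eq_zero_iff, hπ.maximalIdeal_eq, Ideal.mem_span_singleton]
  have key : ∀ n x, π ^ (n + 1) ∣ s x - x := by
    intro n
    induction n with
    | zero => simpa using h1
    | succ n ih =>
      intro x
      have := Fintype.ofFinite (ResidueField R)
      set Q := Fintype.card (ResidueField R)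
      have hQ : ∀ z : ResidueField R, z ^ Q = z := FiniteField.pow_card
      obtain ⟨b, hb⟩ : π ∣ x - x ^ Q := by
        rw [← hker, map_sub, map_pow, hQ, sub_self]
      have hx : x = x ^ Q + π * b := by rw [← hb]; ring
      have hsx : s x = s x ^ Q + π * s b := by
        have := congrArg s hx
        rwa [map_add, map_mul, map_pow, hs] at this
      -- From `x = x^Q + π b`. The geometric sum is congruent to `Q x^{Q-1}`, which is zero in the
      -- residue field, so both terms gain one power of `π` over the induction hypothesis.
      have h2 : s x - x = (∑ i ∈ Finset.range Q, s x ^ i * x ^ (Q - 1 - i)) * (s x - x) +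
          π * (s b - b) := by
        rw [(Commute.all (s x) x).geom_sum₂_mul]
        calc s x - x = (s x ^ Q + π * s b) - (x ^ Q + π * b) := by rw [← hsx, ← hx]
          _ = _ := by ring
      rw [h2, pow_succ']
      refine dvd_add (mul_dvd_mul ?_ (ih x)) (mul_dvd_mul_left π (ih b))
      rw [← hker, map_sum]
      have h3 : residue R (s x) = residue R x := by
        rw [← sub_eq_zero, ← map_sub, hker]
        exact h1 x
      simp only [map_mul, map_pow, h3]
      have h4 : ∀ i ∈ Finset.range Q, residue R x ^ i * residue R x ^ (Q - 1 - i) =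
          residue R x ^ (Q - 1) := fun i hi => by
        rw [← pow_add]
        congr 1
        have := Finset.mem_range.1 hi
        omega
      rw [Finset.sum_congr rfl h4, Finset.sum_const, Finset.card_range, nsmul_eq_mul,
        FiniteField.cast_card_eq_zero, zero_mul]
  by_contra hne
  have h0 : s x - x ≠ 0 := sub_ne_zero.2 hne
  obtain ⟨m, u, hu⟩ := IsDiscreteValuationRing.eq_unit_mul_pow_irreducible h0 hπ
  have h2 := key m x
  rw [hu, Units.dvd_mul_left, pow_dvd_pow_iff hπ.ne_zero hπ.not_isUnit] at h2
  omega

theorem not_isUnit_quotient_iff {π : R} (hπ : Irreducible π) {l : ℕ} (hl : 1 ≤ l)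
    (a : R ⧸ maximalIdeal R ^ l) : ¬ IsUnit a ↔ π ^ (l - 1) • a = 0 := by
  refine ⟨fun h => ?_, fun h hu => ?_⟩
  · obtain ⟨b, rfl⟩ := Ideal.Quotient.mk_surjective a
    by_contra h0
    exact h ((isUnit_of_pow_smul_ne_zero hπ h0).map _)
  · obtain ⟨b, hb⟩ := hu.exists_left_inv
    apply pow_pred_smul_one_ne_zero hπ hl
    rw [← hb, ← mul_smul_comm, h, mul_zero]

theorem card_nonunits_quotient {l : ℕ} (hl : 1 ≤ l) :
    Nat.card {a : R ⧸ maximalIdeal R ^ l // ¬ IsUnit a} = Nat.card (ResidueField R) ^ (l - 1) := by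
  obtain ⟨π, hπ⟩ := IsDiscreteValuationRing.exists_irreducible R
  have := torsionCard_quotient hπ (l - 1) l
  rw [torsionCard, min_eq_left (by omega)] at this
  rw [← this]
  exact Nat.card_congr (Equiv.subtypeEquivRight (not_isUnit_quotient_iff hπ hl))

theorem isLocalRing_quotient {l : ℕ} (hl : 1 ≤ l) : IsLocalRing (R ⧸ maximalIdeal R ^ l) := by
  have : Nontrivial (R ⧸ maximalIdeal R ^ l) := by
    refine Ideal.Quotient.nontrivial_iff.2 fun h => ?_
    have h1 := Ideal.pow_le_self (I := maximalIdeal R) (n := l) (by omega)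
    rw [h, top_le_iff] at h1
    exact Ideal.IsPrime.ne_top inferInstance h1
  exact IsLocalRing.of_surjective' (Ideal.Quotient.mk _) Ideal.Quotient.mk_surjective

end ResidueAction

/-! ### The conjugation on `𝔬`, on its quotients and on `F/𝔬`. -/

section Conjugation

variable {F : Type*} [Field F] [ValuativeRel F] [TopologicalSpace F]
  [IsNonarchimedeanLocalField F] {π : 𝒪[F]} (hπ : Irreducible π) {σ : F ≃+* F}

theorem conjInt_conjInt (hσ : ∀ x, σ (σ x) = x) (x : 𝒪[F]) : conjInt σ (conjInt σ x) = x :=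
  Subtype.ext (hσ x)

theorem conjQuot_mk (k : ℕ) (a : 𝒪[F]) :
    conjQuot σ k (Ideal.Quotient.mk _ a) = Ideal.Quotient.mk _ (conjInt σ a) := rfl

theorem conjQuot_conjQuot (hσ : ∀ x, σ (σ x) = x) (k : ℕ) (x : 𝒪[F] ⧸ 𝓂[F] ^ k) :
    conjQuot σ k (conjQuot σ k x) = x := by
  obtain ⟨a, rfl⟩ := Ideal.Quotient.mk_surjective x
  rw [conjQuot_mk, conjQuot_mk, conjInt_conjInt hσ]

theorem conjQuot_smul (k : ℕ) (a : 𝒪[F]) (x : 𝒪[F] ⧸ 𝓂[F] ^ k) :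
    conjQuot σ k (a • x) = conjInt σ a • conjQuot σ k x := by
  obtain ⟨b, rfl⟩ := Ideal.Quotient.mk_surjective x
  exact (congrArg (Ideal.Quotient.mk (𝓂[F] ^ k)) (map_mul (conjInt σ) a b))

theorem conjFieldModInt_divPow (hσπ : σ (π : F) = π) (k : ℕ) (x : 𝒪[F] ⧸ 𝓂[F] ^ k) :
    conjFieldModInt σ (divPow hπ k x) = divPow hπ k (conjQuot σ k x) := by
  obtain ⟨a, rfl⟩ := Ideal.Quotient.mk_surjective x
  rw [conjQuot_mk, divPow_mk, divPow_mk]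
  change (1 : Submodule 𝒪[F] F).mkQ (σ ((a : F) * ((π : F) ^ k)⁻¹)) = _
  rw [map_mul, map_inv₀, map_pow, hσπ]
  rfl

-- This is how the extension being unramified enters: an involution that fixes a uniformizer and
-- acts trivially on the residue field would be the identity. The resulting unit `y - y^*` replaces
-- division by `2`, so residue characteristic two needs no separate treatment.
include hπ in
theorem exists_isUnit_sub_conj (hσ' : σ ≠ RingEquiv.refl F) (hσπ : σ (π : F) = π) :
    ∃ y : 𝒪[F], IsUnit (y - conjInt σ y) := by
  by_contra! hcon
  have h := eq_self_of_trivial_residue_action hπ (s := conjInt σ) (Subtype.ext hσπ) hcon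
  have h1 : ∀ x : 𝒪[F], σ (x : F) = x := fun x => congrArg Subtype.val (h x)
  refine hσ' (RingEquiv.ext fun z => ?_)
  rw [RingEquiv.refl_apply]
  rcases mem_integer_or_inv z with hz | hz
  · exact h1 ⟨z, hz⟩
  · have := h1 ⟨z⁻¹, hz⟩
    simp only [map_inv₀] at this
    exact inv_injective this

end Conjugation

/-! ### Hermitian modules: lines and vectors of unit norm. -/

section Hermitian

open Finset IsLocalRing

universe u

variable {F : Type u} [Field F] [ValuativeRel F] [TopologicalSpace F]
  [IsNonarchimedeanLocalField F] {π : 𝒪[F]} (hπ : Irreducible π) {σ : F ≃+* F}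

variable (F) in
/-- The module underlying the Hermitian line of exponent `𝔭 ^ l`. -/
abbrev HermitianLine (l : ℕ) : Type u := 𝒪[F] ⧸ 𝓂[F] ^ l

variable (σ) in
/-- The pairing of the Hermitian line. -/
noncomputable def linePairing (l : ℕ) (x y : HermitianLine F l) : FieldModInt F :=
  divPow hπ l (conjQuot σ l x * y)

variable (σ) in
/-- Hermitian pairings with values in `F / 𝔬`. -/
abbrev IsHermitianPairing {M : Type*} [AddCommGroup M] [Module 𝒪[F] M]
    (B : M → M → FieldModInt F) : Prop :=
  IsPairing (conjInt σ) (conjFieldModInt σ).toAddMonoidHom Set.univ B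

theorem linePairing_isHermitian (hσ : ∀ x, σ (σ x) = x) (hσπ : σ (π : F) = π) (l : ℕ) :
    IsHermitianPairing σ (linePairing hπ σ l) := by
  refine ⟨fun x y z => ?_, fun x y z => ?_, fun a x y => ?_, fun a x y => ?_, fun x y => ?_,
    fun x => Set.mem_univ _⟩
  · rw [linePairing, map_add, add_mul, map_add]
    rfl
  · rw [linePairing, mul_add, map_add]
    rfl
  · rw [linePairing, linePairing, conjQuot_smul, smul_mul_assoc, map_smul]
  · rw [linePairing, linePairing, ← map_smul, mul_smul_comm]
  · change _ = conjFieldModInt σ (divPow hπ l _)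
    rw [conjFieldModInt_divPow hπ hσπ, map_mul, conjQuot_conjQuot hσ, mul_comm]
    rfl

section Norms

variable {M : Type*} [AddCommGroup M] [Module 𝒪[F] M] {B : M → M → FieldModInt F}

theorem IsPairing.exists_norm (hB : IsHermitianPairing σ B) (hσπ : σ (π : F) = π) {l : ℕ}
    (hl : ∀ x : M, π ^ l • x = 0) (x : M) :
    ∃ c, B x x = divPow hπ l c ∧ conjQuot σ l c = c := by
  obtain ⟨c, hc⟩ := exists_divPow_eq hπ (w := B x x) (k := l)
    (by rw [← hB.smul_right, hl, hB.zero_right])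
  refine ⟨c, hc.symm, divPow_injective hπ l ?_⟩
  rw [← conjFieldModInt_divPow hπ hσπ, hc]
  exact (hB.symm x x).symm

/-- Polarization. If `π^k` killed all norms, then `π^k B` would be antisymmetric. Replacing `x` by
`y₀ x` multiplies one term by `σ y₀` and the other by `y₀`, whence `(σ y₀ - y₀) π^k B = 0` and `π^k
B = 0`. -/
theorem IsPairing.exists_norm_ne_zero (hB : IsHermitianPairing σ B) (hn : IsNondegenerate B)
    {y₀ : 𝒪[F]} (hy₀ : IsUnit (y₀ - conjInt σ y₀)) {k : ℕ}
    (hx : ∃ x : M, π ^ k • x ≠ 0) : ∃ x, π ^ k • B x x ≠ 0 := by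
  by_contra! hcon
  obtain ⟨y, hy⟩ := hx
  refine hy (hn _ fun x => ?_)
  have h1 : ∀ x y, π ^ k • B x y + π ^ k • B y x = 0 := fun x y => by
    have h2 := hcon (x + y)
    rw [hB.add_left, hB.add_right, hB.add_right, smul_add, smul_add, smul_add, hcon, hcon,
      zero_add, add_zero] at h2
    exact h2
  have h2 := h1 (y₀ • x) y
  rw [hB.smul_left, hB.smul_right, smul_comm (π ^ k), smul_comm (π ^ k),
    eq_neg_of_add_eq_zero_right (h1 x y), smul_neg, ← sub_eq_add_neg, ← sub_smul] at h2
  rw [hB.smul_right]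
  obtain ⟨v, hv⟩ := hy₀.exists_left_inv
  rw [← one_smul 𝒪[F] (π ^ k • B x y), ← hv, mul_smul, ← neg_sub, neg_smul, h2, neg_zero, smul_zero]

theorem IsPairing.norm_smul (hB : IsHermitianPairing σ B) (a : 𝒪[F]) (x : M) {l : ℕ}
    {c : 𝒪[F] ⧸ 𝓂[F] ^ l} (hx : B x x = divPow hπ l c) :
    B (a • x) (a • x) = divPow hπ l (Ideal.Quotient.mk _ a * conjQuot σ l (Ideal.Quotient.mk _ a) * c) := by
  obtain ⟨b, rfl⟩ := Ideal.Quotient.mk_surjective c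
  rw [hB.smul_left, hB.smul_right, hx, ← map_smul, ← map_smul]
  congr 1
  change Ideal.Quotient.mk _ (conjInt σ a * (a * b)) = Ideal.Quotient.mk _ (a * conjInt σ a * b)
  congr 1
  ring

theorem bijective_isometricMap_line (hB : IsHermitianPairing σ B) {l : ℕ}
    (hl : ∀ x : M, π ^ l • x = 0) :
    Function.Bijective (fun i : IsometricMap 𝒪[F] (linePairing hπ σ l) B =>
      (⟨i.1 1, by rw [i.2]; simp [linePairing]⟩ : {x : M // B x x = divPow hπ l 1})) := by
  constructor
  · rintro ⟨i, hi⟩ ⟨j, hj⟩ hij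
    exact Subtype.ext (linearMap_quotient_ext (congrArg Subtype.val hij))
  · rintro ⟨x, hx⟩
    obtain ⟨f, hf⟩ := exists_linearMap_quotient hπ (hl x)
    refine ⟨⟨f, fun c d => ?_⟩, Subtype.ext hf⟩
    obtain ⟨a, rfl⟩ := Ideal.Quotient.mk_surjective c
    obtain ⟨b, rfl⟩ := Ideal.Quotient.mk_surjective d
    rw [linearMap_quotient_apply, linearMap_quotient_apply, hf, hB.smul_left, hB.smul_right, hx,
      smul_smul, ← linearMap_quotient_apply, map_mul]
    rfl

end Norms

/-- For the embedding, take a vector whose norm `c` is a unit and scale it by an `a` with `a a^* =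
c⁻¹`, which exists because norms exhaust the fixed units. -/
theorem isBlockFamily_line (hσ : ∀ x, σ (σ x) = x) (hσ' : σ ≠ RingEquiv.refl F)
    (hσπ : σ (π : F) = π) : IsBlockFamily π (Nat.card 𝓀[F]) (conjInt σ)
      (conjFieldModInt σ).toAddMonoidHom Set.univ (linePairing hπ σ) where
  pairing := linePairing_isHermitian hπ hσ hσπ
  nondegenerate l x hx := divPow_injective hπ l (by simpa [linePairing] using hx 1)
  finite l := inferInstanceAs (Finite (𝒪[F] ⧸ maximalIdeal 𝒪[F] ^ l))
  represent l f hf hf' := by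
    have hw : π ^ l • f 1 = 0 := by
      have h1 : conjInt σ π = π := Subtype.ext hσπ
      have h2 := hf' (π ^ l) 1
      rw [map_pow, h1, show π ^ l • (1 : HermitianLine F l) = 0 from
        pow_smul_eq_zero hπ le_rfl _] at h2
      rw [← h2]
      simpa using hf' 0 0
    obtain ⟨c, hc⟩ := exists_divPow_eq hπ hw
    refine ⟨c, fun x => ?_⟩
    obtain ⟨a, rfl⟩ := Ideal.Quotient.mk_surjective x
    have h1 : Ideal.Quotient.mk (𝓂[F] ^ l) a = a • (1 : HermitianLine F l) := by
      rw [Algebra.smul_def, mul_one]; rfl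
    rw [h1, hf', ← hc, ← map_smul, linePairing, conjQuot_smul, map_one, smul_one_mul]
  one_lt := Finite.one_lt_card
  pow_smul l x := pow_smul_eq_zero hπ le_rfl x
  torsion l k := torsionCard_quotient hπ k l
  embed M _ _ _ B hB hn l hl hl' hx := by
    obtain ⟨y, hy⟩ := exists_isUnit_sub_conj hπ hσ' hσπ
    obtain ⟨x, hx⟩ := hB.exists_norm_ne_zero hn hy hx
    obtain ⟨c, hc, hcσ⟩ := hB.exists_norm hπ hσπ hl' x
    have := isLocalRing_quotient (R := 𝒪[F]) hl
    have hcu : IsUnit c := by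
      by_contra h0
      rw [not_isUnit_quotient_iff hπ hl] at h0
      rw [hc, ← map_smul] at hx
      exact hx ((congrArg _ h0).trans (map_zero _))
    obtain ⟨d, hd⟩ := hcu.exists_left_inv
    have hdσ : conjQuot σ l d = d := by
      have h1 := congrArg (conjQuot σ l) hd
      rw [map_mul, hcσ, map_one] at h1
      exact hcu.mul_right_cancel (h1.trans hd.symm)
    have hyl : IsUnit (Ideal.Quotient.mk (𝓂[F] ^ l) y - conjQuot σ l (Ideal.Quotient.mk _ y)) := by
      rw [conjQuot_mk, ← map_sub]
      exact hy.map _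
    obtain ⟨a, ha, had⟩ := exists_mul_conj_eq (conjQuot_conjQuot hσ l) hyl
      (IsUnit.of_mul_eq_one c hd) hdσ
    obtain ⟨a, rfl⟩ := Ideal.Quotient.mk_surjective a
    obtain ⟨i, -⟩ := (bijective_isometricMap_line hπ hB hl').2 ⟨a • x, by
      rw [hB.norm_smul hπ a x hc, had, hd]⟩
    exact ⟨i⟩

end Hermitian


/-! ### Counting pairs with two kinds of fibres. -/

section CountingFibers

theorem card_subtype_prod {X Y : Type*} [Finite X] [Finite Y] (P : X × Y → Prop) (g : Y → Prop)
    {α β : ℝ} (hα : ∀ y, g y → (Nat.card {x // P (x, y)} : ℝ) = α)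
    (hβ : ∀ y, ¬ g y → (Nat.card {x // P (x, y)} : ℝ) = β) :
    (Nat.card {p // P p} : ℝ) =
      Nat.card {y // g y} * α + (Nat.card Y - Nat.card {y // g y}) * β := by
  classical
  have := Fintype.ofFinite Y
  have h1 : Nat.card {p // P p} = Nat.card (Σ y, {x // P (x, y)}) :=
    Nat.card_congr
      { toFun := fun p => ⟨p.1.2, p.1.1, p.2⟩
        invFun := fun p => ⟨(p.2.1, p.1), p.2.2⟩
        left_inv := fun _ => rfl
        right_inv := fun _ => rfl }
  have h2 := card_subtype_add_card_subtype_not g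
  rw [h1, Nat.card_sigma, Nat.cast_sum, ← Finset.sum_filter_add_sum_filter_not Finset.univ g,
    Finset.sum_congr rfl (fun y hy => hα y (Finset.mem_filter.1 hy).2),
    Finset.sum_congr rfl (fun y hy => hβ y (Finset.mem_filter.1 hy).2), Finset.sum_const,
    Finset.sum_const, nsmul_eq_mul, nsmul_eq_mul, ← h2, Nat.card_eq_fintype_card,
    Nat.card_eq_fintype_card, Fintype.card_subtype, Fintype.card_subtype]
  push_cast
  ring

end CountingFibers

/-! ### Counting vectors by their norms, and Hermitian automorphism groups. -/

section HermitianCounts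

open Finset IsLocalRing

universe u

variable {F : Type u} [Field F] [ValuativeRel F] [TopologicalSpace F]
  [IsNonarchimedeanLocalField F] {π : 𝒪[F]} (hπ : Irreducible π) {σ : F ≃+* F}

/-- The fixed elements of `𝔬 / 𝔭 ^ l`, by whether they are units or not. -/
theorem card_fixed_quotient (hσ : ∀ x, σ (σ x) = x) {y : 𝒪[F]} (hy : IsUnit (y - conjInt σ y))
    {q : ℕ} (hq : q ^ 2 = Nat.card 𝓀[F]) {l : ℕ} (hl : 1 ≤ l) :
    Nat.card {x : 𝒪[F] ⧸ 𝓂[F] ^ l // conjQuot σ l x = x ∧ ¬ IsUnit x} = q ^ (l - 1) ∧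
    (Nat.card {x : 𝒪[F] ⧸ 𝓂[F] ^ l // conjQuot σ l x = x ∧ IsUnit x} : ℝ) =
      (q : ℝ) ^ l - (q : ℝ) ^ (l - 1) := by
  have := isLocalRing_quotient (R := 𝒪[F]) hl
  have hfin := finite_quotient_maximalIdeal_pow (R := 𝒪[F]) l
  have hyl : IsUnit (Ideal.Quotient.mk (𝓂[F] ^ l) y - conjQuot σ l (Ideal.Quotient.mk _ y)) := by
    rw [conjQuot_mk, ← map_sub]
    exact hy.map _
  have h1 := card_fixed_sq (conjQuot_conjQuot hσ l) hyl ⊤ (fun _ _ => Submodule.mem_top)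
  have h2 := card_fixed_sq (conjQuot_conjQuot hσ l) hyl
    (maximalIdeal (𝒪[F] ⧸ 𝓂[F] ^ l)) (fun x hx => by
      rw [mem_maximalIdeal, mem_nonunits_iff] at hx ⊢
      refine fun h => hx ?_
      have := h.map (conjQuot σ l)
      rwa [conjQuot_conjQuot hσ] at this)
  have h3 : Nat.card (maximalIdeal (𝒪[F] ⧸ 𝓂[F] ^ l)) =
      Nat.card {a : 𝒪[F] ⧸ 𝓂[F] ^ l // ¬ IsUnit a} :=
    Nat.card_congr (Equiv.subtypeEquivRight fun x => by rw [mem_maximalIdeal, mem_nonunits_iff])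
  have h4 : Nat.card (⊤ : Ideal (𝒪[F] ⧸ 𝓂[F] ^ l)) = Nat.card (𝒪[F] ⧸ 𝓂[F] ^ l) :=
    Nat.card_congr (Equiv.subtypeUnivEquiv fun _ => Submodule.mem_top)
  rw [h3, card_nonunits_quotient hl, ← hq, ← pow_mul, mul_comm, pow_mul] at h2
  rw [h4, card_quotient_maximalIdeal_pow, ← hq, ← pow_mul, mul_comm, pow_mul] at h1
  replace h1 := Nat.pow_left_injective two_ne_zero h1
  replace h2 := Nat.pow_left_injective two_ne_zero h2
  have h5 : Nat.card {x : 𝒪[F] ⧸ 𝓂[F] ^ l // conjQuot σ l x = x ∧ ¬ IsUnit x} = q ^ (l - 1) := by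
    rw [← h2]
    refine Nat.card_congr (Equiv.subtypeEquivRight fun x => ?_)
    rw [mem_maximalIdeal, mem_nonunits_iff, and_comm]
  refine ⟨h5, ?_⟩
  have h6 := card_subtype_add_card_subtype_not
    (fun x : {x : 𝒪[F] ⧸ 𝓂[F] ^ l // x ∈ (⊤ : Ideal _) ∧ conjQuot σ l x = x} => IsUnit x.1)
  rw [h1, Nat.card_congr (Equiv.subtypeSubtypeEquivSubtypeInter _ (fun x => IsUnit x)),
    Nat.card_congr (Equiv.subtypeSubtypeEquivSubtypeInter _ (fun x => ¬ IsUnit x))] at h6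
  simp only [Submodule.mem_top, true_and] at h6
  rw [h5] at h6
  rw [eq_sub_iff_add_eq]
  exact_mod_cast h6

theorem two_le_of_sq_eq_card {q : ℕ} (hq : q ^ 2 = Nat.card 𝓀[F]) : 2 ≤ q := by
  have : 1 < Nat.card 𝓀[F] := Finite.one_lt_card
  rw [← hq] at this
  by_contra! h
  interval_cases q <;> simp at this

/-- The number of `a` in `𝔬 / 𝔭 ^ l` such that `a a^* + c` is not a unit. -/
theorem card_norm_add_quotient (hσ : ∀ x, σ (σ x) = x) {y : 𝒪[F]}
    (hy : IsUnit (y - conjInt σ y)) {q : ℕ} (hq : q ^ 2 = Nat.card 𝓀[F]) {l : ℕ} (hl : 1 ≤ l)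
    {c : 𝒪[F] ⧸ 𝓂[F] ^ l} (hc : conjQuot σ l c = c) :
    (¬ IsUnit c → (Nat.card {a // ¬ IsUnit (a * conjQuot σ l a + c)} : ℝ) = (q : ℝ) ^ (2 * (l - 1))) ∧
    (IsUnit c → (Nat.card {a // ¬ IsUnit (a * conjQuot σ l a + c)} : ℝ) =
      (q + 1) * (q : ℝ) ^ (2 * (l - 1))) := by
  have := isLocalRing_quotient (R := 𝒪[F]) hl
  have hfin := finite_quotient_maximalIdeal_pow (R := 𝒪[F]) l
  have hyl : IsUnit (Ideal.Quotient.mk (𝓂[F] ^ l) y - conjQuot σ l (Ideal.Quotient.mk _ y)) := by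
    rw [conjQuot_mk, ← map_sub]
    exact hy.map _
  have hnu : Nat.card {a : 𝒪[F] ⧸ 𝓂[F] ^ l // ¬ IsUnit a} = q ^ (2 * (l - 1)) := by
    rw [card_nonunits_quotient hl, ← hq, ← pow_mul]
  refine ⟨fun h => ?_, fun h => ?_⟩
  · rw [card_norm_add_nonunit h, hnu]
    push_cast
    rfl
  · obtain ⟨h1, h2⟩ := card_fixed_quotient hσ hy hq hl
    have h3 := card_norm_add_unit (conjQuot_conjQuot hσ l) hyl h hc
    have h4 := card_subtype_add_card_subtype_not (fun a : 𝒪[F] ⧸ 𝓂[F] ^ l => IsUnit a)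
    rw [hnu, card_quotient_maximalIdeal_pow, ← hq, ← pow_mul] at h4
    replace h3 := congrArg (Nat.cast (R := ℝ)) h3
    replace h4 := congrArg (Nat.cast (R := ℝ)) h4
    push_cast at h3 h4
    rw [h2, h1, eq_sub_of_add_eq h4] at h3
    have hq2 : (2 : ℝ) ≤ q := by exact_mod_cast two_le_of_sq_eq_card hq
    obtain ⟨k, rfl⟩ : ∃ k, l = k + 1 := ⟨l - 1, by omega⟩
    simp only [Nat.add_sub_cancel] at h3 ⊢
    have h5 : (q : ℝ) ^ (k + 1) - (q : ℝ) ^ k ≠ 0 := by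
      rw [pow_succ, ← mul_sub_one]
      have := pow_pos (show (0 : ℝ) < q by linarith) k
      have : (0 : ℝ) < q - 1 := by linarith
      positivity
    refine mul_right_cancel₀ h5 (h3.trans ?_)
    push_cast
    ring

/-- The number of vectors whose norm does not have maximal order. -/
theorem card_isotropic (hσ : ∀ x, σ (σ x) = x) (hσ' : σ ≠ RingEquiv.refl F)
    (hσπ : σ (π : F) = π) {q : ℕ} (hq : q ^ 2 = Nat.card 𝓀[F]) {l : ℕ} (hl : 1 ≤ l) (n : ℕ)
    (e : ℕ → ℕ) (he : ∀ i, e i ≤ l) :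
    (Nat.card {x // π ^ (l - 1) • piPairing (linePairing hπ σ) n e x x = 0} : ℝ) =
      ((q : ℝ) ^ 2) ^ (∑ i ∈ range n, e i) *
        ((q : ℝ)⁻¹ + (1 - (q : ℝ)⁻¹) * (-(q : ℝ)⁻¹) ^ #{i ∈ range n | e i = l}) := by
  obtain ⟨y₀, hy₀⟩ := exists_isUnit_sub_conj hπ hσ' hσπ
  have h := isBlockFamily_line hπ hσ hσ' hσπ
  have _ := fun l => h.finite l
  have hq0 : (q : ℝ) ≠ 0 := by
    have := two_le_of_sq_eq_card hq
    positivity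
  induction n generalizing e with
  | zero =>
    have : Nat.card {x : ∀ i : Fin 0, HermitianLine F (e i) //
        π ^ (l - 1) • piPairing (linePairing hπ σ) 0 e x x = 0} = 1 := by
      rw [Nat.card_eq_one_iff_unique]
      refine ⟨⟨fun x y => Subtype.ext (Subsingleton.elim _ _)⟩, ⟨⟨fun i => i.elim0, ?_⟩⟩⟩
      simp [piPairing]
    rw [this]
    simp
  | succ n ih =>
    obtain ⟨c, hc⟩ := areIsometric_piPairing_succ (R := 𝒪[F]) (linePairing hπ σ) n e
    set N := ∀ i : Fin n, HermitianLine F (e (i + 1))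
    set B := piPairing (linePairing hπ σ) n fun i => e (i + 1) with hB
    have hBp : IsHermitianPairing σ B :=
      h.pairing_pi n (fun i => e (i + 1)) (fun _ _ _ _ => Set.mem_univ _) (Set.mem_univ _)
    have hN : ∀ x : N, π ^ l • x = 0 := fun x => funext fun i =>
      h.pow_smul_of_le (he (i + 1)) (x i)
    have hprod := Nat.card_congr (c.toEquiv.subtypeEquiv
      (p := fun x => π ^ (l - 1) • (linePairing hπ σ (e 0) x.1 x.1 + B x.2 x.2) = 0)
      (q := fun x => π ^ (l - 1) • piPairing (linePairing hπ σ) (n + 1) e x x = 0) fun x => by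
        rw [LinearEquiv.coe_toEquiv, hc]
        rfl)
    have hNc : (Nat.card N : ℝ) = ((q : ℝ) ^ 2) ^ ∑ i ∈ range n, e (i + 1) := by
      rw [h.card_pi n fun i => e (i + 1), ← hq]
      push_cast
      rfl
    have hih := ih (fun i => e (i + 1)) fun i => he (i + 1)
    rw [← hB] at hih
    have hmult : #{i ∈ range (n + 1) | e i = l} =
        #{i ∈ range n | e (i + 1) = l} + if e 0 = l then 1 else 0 := by
      rw [card_filter, card_filter, sum_range_succ']
    rw [← hprod, sum_range_succ', hmult]
    rcases (he 0).lt_or_eq with h0 | h0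
    · have hline : ∀ x : HermitianLine F (e 0), π ^ (l - 1) • linePairing hπ σ (e 0) x x = 0 := by
        intro x
        rw [linePairing, ← map_smul, show π ^ (l - 1) • (conjQuot σ (e 0) x * x) = 0 from
          pow_smul_eq_zero hπ (by omega) _, map_zero]
      rw [card_subtype_prod _ (fun y : N => π ^ (l - 1) • B y y = 0)
        (α := ((q : ℝ) ^ 2) ^ e 0) (β := 0), hih, if_neg h0.ne]
      · rw [pow_add]
        ring
      · intro y hy
        rw [Nat.card_congr (Equiv.subtypeUnivEquiv fun x => by rw [smul_add, hline, hy, add_zero]),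
          card_quotient_maximalIdeal_pow, ← hq]
        push_cast
        rfl
      · intro y hy
        rw [Nat.cast_eq_zero, Nat.card_eq_zero]
        left
        exact ⟨fun x => hy (by simpa [smul_add, hline] using x.2)⟩
    -- A summand of full exponent changes the proportion `ρ` of vectors of nonunit norm to `q⁻² ρ +
    -- (q+1) q⁻² (1 - ρ)`. This affine map has fixed point `q⁻¹` and slope `-q⁻¹`, which explains
    -- the formula.
    · have hnorm : ∀ y : N, ∃ c, B y y = divPow hπ l c ∧ conjQuot σ l c = c :=
        hBp.exists_norm hπ hσπ hN
      have hcount : ∀ (y : N) (c : 𝒪[F] ⧸ 𝓂[F] ^ l), B y y = divPow hπ l c →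
          Nat.card {x : HermitianLine F (e 0) //
            π ^ (l - 1) • (linePairing hπ σ (e 0) x x + B y y) = 0} =
          Nat.card {a // ¬ IsUnit (a * conjQuot σ l a + c)} := by
        intro y c hyc
        subst h0
        refine Nat.card_congr (Equiv.subtypeEquivRight fun x => ?_)
        rw [not_isUnit_quotient_iff hπ hl, hyc, linePairing, ← map_add, ← map_smul,
          ← (divPow_injective hπ (e 0)).eq_iff, map_zero, mul_comm]
      have hunit : ∀ (y : N) (c : 𝒪[F] ⧸ 𝓂[F] ^ l), B y y = divPow hπ l c →
          (π ^ (l - 1) • B y y = 0 ↔ ¬ IsUnit c) := by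
        intro y c hyc
        rw [not_isUnit_quotient_iff hπ hl, hyc, ← map_smul,
          ← (divPow_injective hπ l).eq_iff, map_zero]
      rw [card_subtype_prod _ (fun y : N => π ^ (l - 1) • B y y = 0)
        (α := (q : ℝ) ^ (2 * (l - 1))) (β := (q + 1) * (q : ℝ) ^ (2 * (l - 1))), hih, hNc,
        if_pos h0, h0]
      · obtain ⟨k, rfl⟩ : ∃ k, l = k + 1 := ⟨l - 1, by omega⟩
        rw [Nat.add_sub_cancel, pow_succ (-(q : ℝ)⁻¹)]
        generalize (-(q : ℝ)⁻¹) ^ _ = ρ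
        field_simp
        ring
      · intro y hy
        obtain ⟨c, hyc, hcσ⟩ := hnorm y
        rw [hcount y c hyc]
        exact (card_norm_add_quotient hσ hy₀ hq hl hcσ).1 ((hunit y c hyc).1 hy)
      · intro y hy
        obtain ⟨c, hyc, hcσ⟩ := hnorm y
        rw [hcount y c hyc]
        rw [hunit y c hyc, not_not] at hy
        exact (card_norm_add_quotient hσ hy₀ hq hl hcσ).2 hy

/-- Every vector of unit norm has a norm that is a fixed unit `c`. Scaling by an `a` with `a a^* =
c` identifies the vectors of norm `1` with those of norm `c`, so all fixed units occur equally
often. -/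
theorem card_isometricMap_line (hσ : ∀ x, σ (σ x) = x) (hσ' : σ ≠ RingEquiv.refl F)
    (hσπ : σ (π : F) = π) {M : Type*} [AddCommGroup M] [Module 𝒪[F] M] [Finite M]
    {B : M → M → FieldModInt F} (hB : IsHermitianPairing σ B) {l : ℕ}
    (hl : 1 ≤ l) (hl' : ∀ x : M, π ^ l • x = 0) :
    Nat.card (IsometricMap 𝒪[F] (linePairing hπ σ l) B) *
      Nat.card {x : 𝒪[F] ⧸ 𝓂[F] ^ l // conjQuot σ l x = x ∧ IsUnit x} =
      Nat.card {x : M // ¬ π ^ (l - 1) • B x x = 0} := by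
  have := isLocalRing_quotient (R := 𝒪[F]) hl
  have hfin := finite_quotient_maximalIdeal_pow (R := 𝒪[F]) l
  obtain ⟨y, hy⟩ := exists_isUnit_sub_conj hπ hσ' hσπ
  have hyl : IsUnit (Ideal.Quotient.mk (𝓂[F] ^ l) y - conjQuot σ l (Ideal.Quotient.mk _ y)) := by
    rw [conjQuot_mk, ← map_sub]
    exact hy.map _
  rw [Nat.card_congr (Equiv.ofBijective _ (bijective_isometricMap_line hπ hB hl'))]
  have hunit : ∀ (x : M) (c : 𝒪[F] ⧸ 𝓂[F] ^ l), B x x = divPow hπ l c →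
      (¬ π ^ (l - 1) • B x x = 0 ↔ IsUnit c) := by
    intro x c hxc
    rw [← not_iff_not (b := IsUnit c), not_isUnit_quotient_iff hπ hl, hxc, ← map_smul,
      ← (divPow_injective hπ l).eq_iff, map_zero, not_not]
  have hscale : ∀ c : {x : 𝒪[F] ⧸ 𝓂[F] ^ l // conjQuot σ l x = x ∧ IsUnit x},
      Nat.card {x : M // B x x = divPow hπ l c} = Nat.card {x : M // B x x = divPow hπ l 1} := by
    rintro ⟨c, hcσ, hc⟩
    obtain ⟨a, ha, hac⟩ := exists_mul_conj_eq (conjQuot_conjQuot hσ l) hyl hc hcσ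
    obtain ⟨a, rfl⟩ := Ideal.Quotient.mk_surjective a
    obtain ⟨b, hb⟩ := ha.exists_left_inv
    obtain ⟨b, rfl⟩ := Ideal.Quotient.mk_surjective b
    have hba : ∀ x : M, b • a • x = x := fun x => by
      have h1 : b * a - 1 ∈ 𝓂[F] ^ l := by
        rw [← Ideal.Quotient.eq_zero_iff_mem, map_sub, map_mul, hb, map_one, sub_self]
      obtain ⟨r, hr⟩ := (mem_maximalIdeal_pow hπ l _).1 h1
      rw [smul_smul, eq_add_of_sub_eq hr, add_smul, mul_comm, mul_smul, hl', smul_zero, zero_add,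
        one_smul]
    have hb' : Ideal.Quotient.mk (𝓂[F] ^ l) b * conjQuot σ l (Ideal.Quotient.mk _ b) * c = 1 := by
      have h2 := congrArg (conjQuot σ l) hb
      rw [map_mul, map_one] at h2
      rw [← hac]
      linear_combination (conjQuot σ l (Ideal.Quotient.mk _ b) *
        conjQuot σ l (Ideal.Quotient.mk _ a)) * hb + h2
    exact Nat.card_congr
      { toFun := fun x => ⟨b • x.1, by rw [hB.norm_smul hπ b x.1 x.2, hb']⟩
        invFun := fun x => ⟨a • x.1, by rw [hB.norm_smul hπ a x.1 x.2, hac, mul_one]⟩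
        left_inv := fun x => Subtype.ext ((smul_comm a b x.1).trans (hba _))
        right_inv := fun x => Subtype.ext (hba _) }
  have hsig : Nat.card {x : M // ¬ π ^ (l - 1) • B x x = 0} =
      Nat.card (Σ c : {x : 𝒪[F] ⧸ 𝓂[F] ^ l // conjQuot σ l x = x ∧ IsUnit x},
        {x : M // B x x = divPow hπ l c}) := by
    refine (Nat.card_congr (Equiv.ofBijective
      (fun p => ⟨p.2.1, (hunit _ _ p.2.2).2 p.1.2.2⟩) ⟨?_, ?_⟩)).symm
    · rintro ⟨⟨c, hc⟩, ⟨x, hx⟩⟩ ⟨⟨d, hd⟩, ⟨x', hx'⟩⟩ h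
      obtain rfl : x = x' := congrArg Subtype.val h
      obtain rfl : c = d := divPow_injective hπ l (hx.symm.trans hx')
      rfl
    · rintro ⟨x, hx⟩
      obtain ⟨c, hc, hcσ⟩ := hB.exists_norm hπ hσπ hl' x
      exact ⟨⟨⟨c, hcσ, (hunit x c hc).1 hx⟩, ⟨x, hc⟩⟩, rfl⟩
  have := Fintype.ofFinite {x : 𝒪[F] ⧸ 𝓂[F] ^ l // conjQuot σ l x = x ∧ IsUnit x}
  rw [hsig, Nat.card_sigma]
  simp only [hscale]
  rw [sum_const, card_univ, smul_eq_mul, ← Nat.card_eq_fintype_card, mul_comm]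

/-- There are `q^{2|e|} (1 - q⁻¹) (1 - (-q⁻¹)^m)` vectors of unit norm, with `m` the multiplicity of
the first part, and `q^{e 0} (1 - q⁻¹)` fixed units. The power of `q` in the quotient is written
with base `-q` to match `t = -q⁻¹`; the remaining sign is the origin of `κ = -1`. -/
theorem card_isometricAut_hermitian_succ (hσ : ∀ x, σ (σ x) = x) (hσ' : σ ≠ RingEquiv.refl F)
    (hσπ : σ (π : F) = π) {q : ℕ} (hq : q ^ 2 = Nat.card 𝓀[F]) {n : ℕ} {e : ℕ → ℕ}
    (he : IsPartition (n + 1) e) :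
    (Nat.card (IsometricAut 𝒪[F] (piPairing (linePairing hπ σ) (n + 1) e)) : ℝ) =
      (-1) ^ e 0 * (-(q : ℝ)) ^ (2 * ∑ i ∈ range n, e (i + 1) + e 0) *
        (1 - (-(q : ℝ)⁻¹) ^ firstMult (n + 1) e) *
        Nat.card (IsometricAut 𝒪[F] (piPairing (linePairing hπ σ) n fun i => e (i + 1))) := by
  have h := isBlockFamily_line hπ hσ hσ' hσπ
  have _ := fun l => h.finite l
  obtain ⟨y, hy⟩ := exists_isUnit_sub_conj hπ hσ' hσπ
  have hq2 : (2 : ℝ) ≤ q := by exact_mod_cast two_le_of_sq_eq_card hq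
  have hD : ∀ x y : FieldModInt F, x ∈ Set.univ → y ∈ Set.univ → x + y ∈ Set.univ :=
    fun _ _ _ _ => Set.mem_univ _
  have hS := card_isometricMap_line hπ hσ hσ' hσπ (h.pairing_pi (n + 1) e hD (Set.mem_univ _)) he.pos
    (fun x => funext fun i => h.pow_smul_of_le (he.antitone (Nat.zero_le (i : ℕ))) (x i))
  have hZ := card_isotropic hπ hσ hσ' hσπ hq he.pos (n + 1) e fun i => he.antitone (Nat.zero_le i)
  have hT := card_subtype_add_card_subtype_not
    (fun x => π ^ (e 0 - 1) • piPairing (linePairing hπ σ) (n + 1) e x x = 0)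
  rw [h.card_pi] at hT
  rw [h.card_isometricAut_succ hD (Set.mem_univ _) he]
  replace hT := congrArg (Nat.cast (R := ℝ)) hT
  replace hS := congrArg (Nat.cast (R := ℝ)) hS
  push_cast at hS hT ⊢
  rw [(card_fixed_quotient hσ hy hq he.pos).2, eq_sub_of_add_eq' hT, hZ, ← hq] at hS
  push_cast at hS
  congr 1
  have hE' : ∑ i ∈ range (n + 1), e i = ∑ i ∈ range n, e (i + 1) + e 0 := sum_range_succ' _ _
  rw [hE'] at hS
  rw [firstMult]
  obtain ⟨k, hk⟩ : ∃ k, e 0 = k + 1 := ⟨e 0 - 1, by have := he.pos; omega⟩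
  rw [hk] at hS ⊢
  simp only [Nat.add_sub_cancel] at hS
  have h5 : (q : ℝ) ^ (k + 1) - (q : ℝ) ^ k ≠ 0 := by
    rw [pow_succ, ← mul_sub_one]
    have := pow_pos (show (0 : ℝ) < q by linarith) k
    have : (0 : ℝ) < q - 1 := by linarith
    positivity
  refine mul_right_cancel₀ h5 (hS.trans ?_)
  have hsign : (-1 : ℝ) ^ (k + 1) * (-(q : ℝ)) ^ (2 * ∑ i ∈ range n, e (i + 1) + (k + 1)) =
      (q : ℝ) ^ (2 * ∑ i ∈ range n, e (i + 1) + (k + 1)) := by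
    rw [pow_add (-(q : ℝ)), pow_add (q : ℝ), pow_mul, neg_sq, ← pow_mul, mul_left_comm, ← mul_pow]
    simp
  rw [hsign]
  have hq0 : (q : ℝ) ≠ 0 := by linarith
  field_simp
  ring

end HermitianCounts


/-! ### From sums over diagrams to expectations. -/

section Moments

open Finset MeasureTheory

instance : Countable YoungDiagram :=
  Function.Injective.countable (f := YoungDiagram.cells) fun _ _ h => YoungDiagram.ext h

/-- The expectation of a function that is constant on the parts of a countable partition of a
probability space. -/
theorem integrable_and_integral_of_hasSum {ι Ω : Type*} [Countable ι] [MeasurableSpace Ω]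
    (P : Measure Ω) [IsProbabilityMeasure P] {S : ι → Set Ω} (hS : ∀ i, MeasurableSet (S i))
    (hd : Pairwise (Function.onFun Disjoint S)) {p g : ι → ℝ} (hp : ∀ i, 0 ≤ p i) (hp1 : HasSum p 1)
    (hP : ∀ i, P (S i) = ENNReal.ofReal (p i)) {f : Ω → ℝ} (hf : ∀ i, ∀ ω ∈ S i, f ω = g i)
    (hg : ∀ i, 0 ≤ g i) {E : ℝ} (hE : HasSum (fun i => p i * g i) E) :
    Integrable f P ∧ ∫ ω, f ω ∂P = E := by
  -- The probabilities sum to one, so the parts cover the space up to a null set. Nothing need be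
  -- assumed about `f` elsewhere.
  have hU : P (⋃ i, S i) = 1 := by
    rw [measure_iUnion hd hS]
    simp only [hP]
    rw [← ENNReal.ofReal_tsum_of_nonneg hp hp1.summable, hp1.tsum_eq, ENNReal.ofReal_one]
  have hae : (⋃ i, S i : Set Ω) =ᵐ[P] Set.univ := by
    rw [Filter.eventuallyEq_univ, mem_ae_iff, prob_compl_eq_zero_iff (MeasurableSet.iUnion hS)]
    exact hU
  have hint : ∀ i, IntegrableOn f (S i) P := fun i =>
    (integrableOn_const (C := g i) (measure_ne_top P _)).congr_fun (fun ω hω => (hf i ω hω).symm)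
      (hS i)
  have hval : ∀ i, ∫ ω in S i, f ω ∂P = p i * g i := fun i => by
    rw [setIntegral_congr_fun (hS i) (hf i), setIntegral_const, smul_eq_mul, measureReal_def, hP,
      ENNReal.toReal_ofReal (hp i)]
  have hnorm : ∀ i, ∫ ω in S i, ‖f ω‖ ∂P = p i * g i := fun i => by
    rw [← hval i]
    refine setIntegral_congr_fun (hS i) fun ω hω => ?_
    simp only [hf i ω hω, Real.norm_of_nonneg (hg i)]
  have hI : IntegrableOn f (⋃ i, S i) P :=
    integrableOn_iUnion_of_summable_integral_norm hint (by
      simp only [hnorm]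
      exact hE.summable)
  have hsum := hasSum_integral_iUnion hS hd hI
  simp only [hval] at hsum
  refine ⟨?_, ?_⟩
  · rwa [IntegrableOn, Measure.restrict_congr_set hae, Measure.restrict_univ] at hI
  · have h1 := hE.unique hsum
    rw [Measure.restrict_congr_set hae, Measure.restrict_univ] at h1
    exact h1.symm

/-- Here `t^{b²}` becomes `1/s^{b²}`, and the product over columns separates into the power of
`|μ|`, the order of the automorphism group without its `κ`-factor, and the number of homomorphisms.
-/
theorem youngWeight_eq {s t : ℝ} (hst : s * t = 1) (z : ℝ) (c : ℕ → ℕ) (μ : YoungDiagram) :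
    youngWeight s z t c μ = z ^ μ.card / (∏ j ∈ range (μ.rowLen 0),
      (s ^ (μ.colLen j ^ 2) * qPoch 1 t (μ.colLen j - μ.colLen (j + 1)))) *
        s ^ ∑ j ∈ range (μ.rowLen 0), μ.colLen j * c j := by
  have ht : t = s⁻¹ := eq_inv_of_mul_eq_one_right hst
  rw [μ.card_eq_sum_rowLen, μ.sum_rowLen le_rfl, ← prod_pow_eq_pow_sum, ← prod_pow_eq_pow_sum,
    ← prod_div_distrib, ← prod_mul_distrib, youngWeight]
  refine prod_congr rfl fun j _ => ?_
  rw [invPoch, if_pos (μ.colLen_anti j (j + 1) (Nat.le_succ j)), div_mul_eq_div_div]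
  nth_rewrite 1 [ht]
  rw [inv_pow, ← div_eq_mul_inv]
  ring

/-- The total mass and the moments of the distribution on partitions with weights
`y ^ |μ| / A μ`. -/
theorem hasSum_weights {s t z κ y : ℝ} (hst : s * t = 1) (ht : |t| < 1) (hz : |z * t| < 1)
    (hκ : κ ≠ 0) (hy : y = z * κ) (hy0 : 0 ≤ y) (A : YoungDiagram → ℕ)
    (hA : ∀ μ, (A μ : ℝ) = κ ^ μ.card * ∏ j ∈ range (μ.rowLen 0),
      (s ^ (μ.colLen j ^ 2) * qPoch 1 t (μ.colLen j - μ.colLen (j + 1)))) (ν : YoungDiagram)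
    (H : YoungDiagram → ℕ)
    (hH : ∀ μ, (H μ : ℝ) = s ^ ∑ j ∈ range (μ.rowLen 0), μ.colLen j * ν.colLen j) :
    let p : YoungDiagram → ℝ := fun μ => y ^ μ.card / A μ * ∏' j : ℕ, (1 - z * t ^ (j + 1))
    (∀ μ, 0 ≤ p μ) ∧ HasSum p 1 ∧ HasSum (fun μ => p μ * H μ)
      (∑ j ∈ range (ν.colLen 0 + 1), z ^ j * columnCoeff s z ν.colLen (ν.rowLen 0) j) := by
  intro p
  have hw : ∀ (c : ℕ → ℕ) μ, youngWeight s z t c μ = y ^ μ.card / A μ *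
      s ^ ∑ j ∈ range (μ.rowLen 0), μ.colLen j * c j := fun c μ => by
    rw [youngWeight_eq hst, hA, hy, mul_pow, mul_comm (z ^ _), mul_div_mul_left]
    exact pow_ne_zero _ hκ
  have hpos : ∀ μ, 0 ≤ y ^ μ.card / A μ := fun μ => by positivity
  have hw0 : ∀ μ, youngWeight s z t (fun _ => 0) μ = y ^ μ.card / A μ := fun μ => by simp [hw]
  have hwν : ∀ μ, youngWeight s z t ν.colLen μ = y ^ μ.card / A μ * H μ := fun μ => by rw [hw, hH]
  refine ⟨fun μ => mul_nonneg (hpos μ) (tendsto_qPoch ht hz).2.le, ?_, ?_⟩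
  -- The total mass is the moment with `c = 0`, where only the coefficient `j = 0` remains and
  -- equals `1`.
  · have := hasSum_youngWeight hst ht hz 0 (c := fun _ => 0) antitone_const (fun _ _ => rfl)
      (fun μ => by rw [hw0]; exact hpos μ)
    simp only [hw0] at this
    simpa [columnCoeff] using this
  · have := hasSum_youngWeight hst ht hz (ν.rowLen 0) (c := ν.colLen)
      (fun i j hij => ν.colLen_anti i j hij)
      (fun i hi => YoungDiagram.colLen_eq_zero_iff.2 hi)
      (fun μ => by rw [hwν]; exact mul_nonneg (hpos μ) (Nat.cast_nonneg _))
    simp only [hwν] at this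
    convert this using 2 with μ
    exact mul_right_comm _ _ _

end Moments

/-! ### Uniqueness of types, and group orders in terms of columns. -/

section Types

open Finset IsLocalRing

universe u

variable {F : Type u} [Field F] [ValuativeRel F] [TopologicalSpace F]
  [IsNonarchimedeanLocalField F]

theorem YoungDiagram.eq_of_torsionCard_eq {π : 𝒪[F]} (hπ : Irreducible π) {μ μ' : YoungDiagram}
    (h : ∀ k, torsionCard π (CyclicSum F μ) k = torsionCard π (CyclicSum F μ') k) : μ = μ' := by
  have h1 := μ.isPartition.eq_of_sum_min μ'.isPartition fun k => by
    have h2 := h k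
    rw [torsionCard_cyclicPi hπ, torsionCard_cyclicPi hπ] at h2
    exact Nat.pow_right_injective (Finite.one_lt_card (α := 𝓀[F])) h2
  refine YoungDiagram.ext_colLen fun j => eq_of_forall_lt_iff fun i => ?_
  rw [YoungDiagram.lt_colLen_iff, YoungDiagram.lt_colLen_iff, h1.2]

theorem HasType.unique {M : Type*} [AddCommGroup M] [Module 𝒪[F] M] {μ μ' : YoungDiagram}
    (h : HasType F M μ) (h' : HasType F M μ') : μ = μ' := by
  obtain ⟨π, hπ⟩ := IsDiscreteValuationRing.exists_irreducible 𝒪[F]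
  obtain ⟨f⟩ := h
  obtain ⟨f'⟩ := h'
  exact YoungDiagram.eq_of_torsionCard_eq hπ fun k => by
    rw [← torsionCard_congr π f, torsionCard_congr π f']

variable (F) in
/-- The doubled module is the direct sum of two copies. -/
def doubledCyclicSumEquiv (μ : YoungDiagram) :
    DoubledCyclicSum F μ ≃ₗ[𝒪[F]] CyclicSum F μ × CyclicSum F μ where
  toFun x := (fun i => (x i).1, fun i => (x i).2)
  invFun x := fun i => (x.1 i, x.2 i)
  map_add' _ _ := rfl
  map_smul' _ _ := rfl
  left_inv _ := rfl
  right_inv _ := rfl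

theorem HasAlternatingType.unique {π : 𝒪[F]} {hπ : Irreducible π} {M : Type*} [AddCommGroup M]
    [Module 𝒪[F] M] {B : M →ₗ[𝒪[F]] M →ₗ[𝒪[F]] FieldModInt F} {μ μ' : YoungDiagram}
    (h : HasAlternatingType hπ B μ) (h' : HasAlternatingType hπ B μ') : μ = μ' := by
  obtain ⟨f, -⟩ := h
  obtain ⟨f', -⟩ := h'
  exact YoungDiagram.eq_of_torsionCard_eq hπ fun k => by
    -- The torsion counts of the doubled modules are the squares of those of `CyclicSum`, so
    -- equality passes to the latter.
    have h1 := torsionCard_congr π ((f.trans (doubledCyclicSumEquiv F μ)).symm.trans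
      (f'.trans (doubledCyclicSumEquiv F μ'))) k
    rw [torsionCard_prod, torsionCard_prod] at h1
    exact Nat.mul_self_inj.1 h1

theorem HasHermitianType.hasType {π : 𝒪[F]} {hπ : Irreducible π} {σ : F ≃+* F} {M : Type*}
    [AddCommGroup M] [Module 𝒪[F] M] {B : M →ₛₗ[conjInt σ] M →ₗ[𝒪[F]] FieldModInt F}
    {μ : YoungDiagram} (h : HasHermitianType hπ σ B μ) : HasType F M μ :=
  let ⟨f, _⟩ := h
  ⟨f⟩

theorem card_hom_cyclicSum (μ ν : YoungDiagram) :
    Nat.card (CyclicSum F μ →ₗ[𝒪[F]] CyclicSum F ν) =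
      Nat.card 𝓀[F] ^ ∑ j ∈ range (μ.rowLen 0), μ.colLen j * ν.colLen j := by
  rw [← YoungDiagram.sum_sum_min_rowLen]
  exact card_hom_cyclicPi _ _ _ _

theorem card_hom_doubledCyclicSum (μ ν : YoungDiagram) :
    Nat.card (DoubledCyclicSum F μ →ₗ[𝒪[F]] CyclicSum F ν) =
      (Nat.card 𝓀[F] ^ 2) ^ ∑ j ∈ range (μ.rowLen 0), μ.colLen j * ν.colLen j := by
  rw [card_hom_congr (doubledCyclicSumEquiv F μ) (LinearEquiv.refl _ _),
    ← Nat.card_congr (LinearMap.coprodEquiv 𝒪[F] (M := CyclicSum F μ) (M₂ := CyclicSum F μ)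
      (M₃ := CyclicSum F ν)).toEquiv, Nat.card_prod, card_hom_cyclicSum, ← pow_two, ← pow_mul,
    ← pow_mul, mul_comm]

theorem card_doubledCyclicSum (μ : YoungDiagram) :
    Nat.card (DoubledCyclicSum F μ) = (Nat.card 𝓀[F] ^ 2) ^ μ.card := by
  rw [Nat.card_congr (doubledCyclicSumEquiv F μ).toEquiv, Nat.card_prod,
    show Nat.card (CyclicSum F μ) = _ from card_cyclicPi (R := 𝒪[F]) _ _,
    ← YoungDiagram.card_eq_sum_rowLen, ← pow_two, ← pow_mul, ← pow_mul, mul_comm]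

/-- This is the reason for `ν²` in the Hermitian case: the residue field has order `q² = (-q)²`, and
the factor `2` in the exponent of `-q` is absorbed by doubling the columns of `ν`. -/
theorem colLen_doubleRows (ν : YoungDiagram) (j : ℕ) :
    (doubleRows ν).colLen j = 2 * ν.colLen j := by
  refine eq_of_forall_lt_iff fun i => ?_
  rw [YoungDiagram.lt_colLen_iff, rowLen_doubleRows, ← YoungDiagram.lt_colLen_iff]
  omega

theorem card_linearEquiv_cyclicSum (μ : YoungDiagram) :
    (Nat.card (CyclicSum F μ ≃ₗ[𝒪[F]] CyclicSum F μ) : ℝ) =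
      1 ^ μ.card * ∏ j ∈ range (μ.rowLen 0), ((Nat.card 𝓀[F] : ℝ) ^ (μ.colLen j ^ 2) *
        qPoch 1 (Nat.card 𝓀[F] : ℝ)⁻¹ (μ.colLen j - μ.colLen (j + 1))) := by
  refine youngDiagram_product_of_recursion
    (fun n e => (Nat.card (CyclicPi 𝒪[F] n e ≃ₗ[𝒪[F]] CyclicPi 𝒪[F] n e) : ℝ)) (fun e => ?_)
    (fun n e he => ?_) μ
  · have : Unique (CyclicPi 𝒪[F] 0 e ≃ₗ[𝒪[F]] CyclicPi 𝒪[F] 0 e) :=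
      ⟨⟨LinearEquiv.refl _ _⟩, fun f => LinearEquiv.ext fun x => Subsingleton.elim _ _⟩
    rw [Nat.card_unique, Nat.cast_one]
  · rw [one_pow, one_mul]
    exact card_linearEquiv_cyclicPi_succ he

theorem card_alternatingAut {π : 𝒪[F]} (hπ : Irreducible π) (μ : YoungDiagram) :
    (Nat.card {e : DoubledCyclicSum F μ ≃ₗ[𝒪[F]] DoubledCyclicSum F μ //
        ∀ x y, stdAlternating hπ μ (e x) (e y) = stdAlternating hπ μ x y} : ℝ) =
      (Nat.card 𝓀[F] : ℝ) ^ μ.card * ∏ j ∈ range (μ.rowLen 0),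
        (((Nat.card 𝓀[F] : ℝ) ^ 2) ^ (μ.colLen j ^ 2) *
          qPoch 1 ((Nat.card 𝓀[F] : ℝ) ^ 2)⁻¹ (μ.colLen j - μ.colLen (j + 1))) :=
  youngDiagram_product_of_recursion
    (fun n e => (Nat.card (IsometricAut 𝒪[F] (piPairing (hyperbolicPairing hπ) n e)) : ℝ))
    (fun e => (congrArg _ (card_isometricAut_zero (R := 𝒪[F]) (hyperbolicPairing hπ) e)).trans Nat.cast_one)
    (fun _ _ he => card_isometricAut_alternating_succ hπ he) μ

theorem card_hermitianAut {π : 𝒪[F]} (hπ : Irreducible π) {σ : F ≃+* F} (hσ : ∀ x, σ (σ x) = x)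
    (hσ' : σ ≠ RingEquiv.refl F) (hσπ : σ (π : F) = π) {q : ℕ} (hq : q ^ 2 = Nat.card 𝓀[F])
    (μ : YoungDiagram) :
    (Nat.card {e : CyclicSum F μ ≃ₗ[𝒪[F]] CyclicSum F μ //
        ∀ x y, stdHermitian hπ σ μ (e x) (e y) = stdHermitian hπ σ μ x y} : ℝ) =
      (-1) ^ μ.card * ∏ j ∈ range (μ.rowLen 0), ((-(q : ℝ)) ^ (μ.colLen j ^ 2) *
        qPoch 1 (-(q : ℝ)⁻¹) (μ.colLen j - μ.colLen (j + 1))) :=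
  youngDiagram_product_of_recursion
    (fun n e => (Nat.card (IsometricAut 𝒪[F] (piPairing (linePairing hπ σ) n e)) : ℝ))
    (fun e => (congrArg _ (card_isometricAut_zero (R := 𝒪[F]) (linePairing hπ σ) e)).trans Nat.cast_one)
    (fun _ _ he => card_isometricAut_hermitian_succ hπ hσ hσ' hσπ hq he) μ

end Types



/-! ### The common form of the three cases. -/

section Expectation

open Finset MeasureTheory

/-- The distribution on partitions with weights `y ^ |μ| / A μ`, and the expectation of a random
variable that takes the value `H μ` on a set `S μ` of probability given by that weight. -/
theorem expectation_eq_hallLittlewood {s t z κ y : ℝ} (hst : s * t = 1) (ht : |t| < 1)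
    (hz : |z * t| < 1) (hκ : κ ≠ 0) (hy : y = z * κ) (hy0 : 0 ≤ y) (A : YoungDiagram → ℕ)
    (hA : ∀ μ, (A μ : ℝ) = κ ^ μ.card * ∏ j ∈ range (μ.rowLen 0),
      (s ^ (μ.colLen j ^ 2) * qPoch 1 t (μ.colLen j - μ.colLen (j + 1)))) (ν : YoungDiagram)
    (H : YoungDiagram → ℕ)
    (hH : ∀ μ, (H μ : ℝ) = s ^ ∑ j ∈ range (μ.rowLen 0), μ.colLen j * ν.colLen j)
    {p : YoungDiagram → ℝ}
    (hp : ∀ μ, p μ = y ^ μ.card / A μ * ∏' j : ℕ, (1 - z * t ^ (j + 1))) {a b : ℕ → ℝ}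
    (ha : ∀ k, a k = t ^ k) (hb : ∀ k, b k = z * t ^ k) :
    (∀ μ, 0 ≤ p μ) ∧ HasSum p 1 ∧
      ∀ {Ω : Type*} [MeasurableSpace Ω] (P : Measure Ω) [IsProbabilityMeasure P]
        (S : YoungDiagram → Set Ω) (f : Ω → ℝ), (∀ μ, MeasurableSet (S μ)) →
        (∀ μ, P (S μ) = ENNReal.ofReal (p μ)) → (∀ μ, ∀ ω ∈ S μ, f ω = H μ) →
        (∀ μ μ' ω, ω ∈ S μ → ω ∈ S μ' → μ = μ') →
        Integrable f P ∧ ∃ A C : ℝ, HasHallLittlewoodValue ν t (interleave a b) A ∧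
          HasHallLittlewoodValue ν t a C ∧ C ≠ 0 ∧ ∫ ω, f ω ∂P = A / C := by
  obtain rfl : a = fun k => t ^ k := funext ha
  obtain rfl : b = fun k => z * t ^ k := funext hb
  obtain rfl : p = _ := funext hp
  obtain ⟨h1, h2, h3⟩ := hasSum_weights hst ht hz hκ hy hy0 A hA ν H hH
  refine ⟨h1, h2, fun {Ω} _ P _ S f hS hP hf hd => ?_⟩
  obtain ⟨h4, h5⟩ := integrable_and_integral_of_hasSum P hS
    (fun μ μ' hne => Set.disjoint_left.2 fun ω h h' => hne (hd μ μ' ω h h')) h1 h2 hP hf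
    (fun μ => Nat.cast_nonneg _) h3
  obtain ⟨A, C, h6, h7, h8, h9⟩ := hasHallLittlewoodValue_geometric hst ht z ν
  exact ⟨h4, A, C, h6, h7, h8, by rw [h5, h9]⟩

end Expectation



/-! ### Specialization of the parameters. -/

theorem abs_mul_inv_rpow_lt_one {q : ℝ} (hq : 1 < q) {v : ℝ} (hv : v < 1) : |q ^ v * q⁻¹| < 1 := by
  have h0 : 0 < q := zero_lt_one.trans hq
  rw [← Real.rpow_neg_one, ← Real.rpow_add h0, abs_of_pos (Real.rpow_pos_of_pos h0 _)]
  exact Real.rpow_lt_one_of_one_lt_of_neg hq (by linarith)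

theorem theorem1p2 {F : Type*} [Field F] [ValuativeRel F] [TopologicalSpace F]
    [IsNonarchimedeanLocalField F] {π : 𝒪[F]} (hπ : Irreducible π) (ν : YoungDiagram)
    {N : Type*} [AddCommGroup N] [Module 𝒪[F] N] (hN : HasType F N ν) :
    -- no pairing
    (∀ (q : ℕ), q = Nat.card 𝓀[F] → ∀ u : ℝ, -1 < u →
      (∀ μ, 0 ≤ cohenLenstraProb F u μ) ∧ HasSum (cohenLenstraProb F u) 1 ∧
      ∀ {Ω : Type*} [MeasurableSpace Ω] (P : MeasureTheory.Measure Ω)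
        [MeasureTheory.IsProbabilityMeasure P]
        (M : Ω → Type*) [∀ ω, AddCommGroup (M ω)] [∀ ω, Module 𝒪[F] (M ω)] [∀ ω, Finite (M ω)],
        (∀ μ, MeasurableSet {ω | HasType F (M ω) μ}) →
        (∀ μ, P {ω | HasType F (M ω) μ} = ENNReal.ofReal (cohenLenstraProb F u μ)) →
        MeasureTheory.Integrable (fun ω => (Nat.card (M ω →ₗ[𝒪[F]] N) : ℝ)) P ∧
        ∃ A C : ℝ,
          HasHallLittlewoodValue ν (q : ℝ)⁻¹
            (interleave (fun k => (q : ℝ) ^ (-(k : ℝ))) (fun k => (q : ℝ) ^ (-u - k))) A ∧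
          HasHallLittlewoodValue ν (q : ℝ)⁻¹ (fun k => (q : ℝ) ^ (-(k : ℝ))) C ∧
          C ≠ 0 ∧ ∫ ω, (Nat.card (M ω →ₗ[𝒪[F]] N) : ℝ) ∂P = A / C) ∧
    -- alternating pairing
    (∀ (q : ℕ), q = Nat.card 𝓀[F] → ∀ u : ℝ, -1 / 2 < u →
      (∀ μ, 0 ≤ alternatingProb hπ u μ) ∧ HasSum (alternatingProb hπ u) 1 ∧
      ∀ {Ω : Type*} [MeasurableSpace Ω] (P : MeasureTheory.Measure Ω)
        [MeasureTheory.IsProbabilityMeasure P]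
        (M : Ω → Type*) [∀ ω, AddCommGroup (M ω)] [∀ ω, Module 𝒪[F] (M ω)] [∀ ω, Finite (M ω)]
        (B : ∀ ω, M ω →ₗ[𝒪[F]] M ω →ₗ[𝒪[F]] FieldModInt F),
        (∀ ω, IsAlternatingModule (B ω)) →
        (∀ μ, MeasurableSet {ω | HasAlternatingType hπ (B ω) μ}) →
        (∀ μ, P {ω | HasAlternatingType hπ (B ω) μ} = ENNReal.ofReal (alternatingProb hπ u μ)) →
        MeasureTheory.Integrable (fun ω => (Nat.card (M ω →ₗ[𝒪[F]] N) : ℝ)) P ∧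
        ∃ A C : ℝ,
          HasHallLittlewoodValue ν ((q : ℝ) ^ 2)⁻¹
            (interleave (fun k => (q : ℝ) ^ (-2 * (k : ℝ)))
              (fun k => (q : ℝ) ^ (1 - 2 * u - 2 * k))) A ∧
          HasHallLittlewoodValue ν ((q : ℝ) ^ 2)⁻¹ (fun k => (q : ℝ) ^ (-2 * (k : ℝ))) C ∧
          C ≠ 0 ∧ ∫ ω, (Nat.card (M ω →ₗ[𝒪[F]] N) : ℝ) ∂P = A / C) ∧
    -- Hermitian pairing: `σ` is an involution of `F`, and `F` is unramified over its fixed field,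
    -- that is, the uniformizer `π` can be (and is) chosen in the fixed field
    (∀ (σ : F ≃+* F), (∀ x, σ (σ x) = x) → σ ≠ RingEquiv.refl F → σ (π : F) = π →
      ∀ (q : ℕ), q ^ 2 = Nat.card 𝓀[F] → ∀ u : ℝ, -1 < u →
      (∀ μ, 0 ≤ hermitianProb hπ σ q u μ) ∧ HasSum (hermitianProb hπ σ q u) 1 ∧
      ∀ {Ω : Type*} [MeasurableSpace Ω] (P : MeasureTheory.Measure Ω)
        [MeasureTheory.IsProbabilityMeasure P]
        (M : Ω → Type*) [∀ ω, AddCommGroup (M ω)] [∀ ω, Module 𝒪[F] (M ω)] [∀ ω, Finite (M ω)]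
        (B : ∀ ω, M ω →ₛₗ[conjInt σ] M ω →ₗ[𝒪[F]] FieldModInt F),
        (∀ ω, IsHermitianModule σ (B ω)) →
        (∀ μ, MeasurableSet {ω | HasHermitianType hπ σ (B ω) μ}) →
        (∀ μ, P {ω | HasHermitianType hπ σ (B ω) μ} =
          ENNReal.ofReal (hermitianProb hπ σ q u μ)) →
        MeasureTheory.Integrable (fun ω => (Nat.card (M ω →ₗ[𝒪[F]] N) : ℝ)) P ∧
        ∃ A C : ℝ,
          HasHallLittlewoodValue (doubleRows ν) (-(q : ℝ)⁻¹)
            (interleave (fun k => (-1) ^ k * (q : ℝ) ^ (-(k : ℝ)))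
              (fun k => (-1) ^ (k + 1) * (q : ℝ) ^ (-u - k))) A ∧
          HasHallLittlewoodValue (doubleRows ν) (-(q : ℝ)⁻¹)
            (fun k => (-1) ^ k * (q : ℝ) ^ (-(k : ℝ))) C ∧
          C ≠ 0 ∧ ∫ ω, (Nat.card (M ω →ₗ[𝒪[F]] N) : ℝ) ∂P = A / C) := by
  refine ⟨?_, ?_, ?_⟩
  · intro q hq u hu
    have hq1 : (1 : ℝ) < q := by
      rw [hq]; exact_mod_cast Finite.one_lt_card (α := 𝓀[F])
    have hq0 : (0 : ℝ) < q := zero_lt_one.trans hq1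
    -- Here `|z t| = q^{-u-1}`, so the condition `|z t| < 1` is `u > -1`.
    obtain ⟨h1, h2, h3⟩ := expectation_eq_hallLittlewood (s := q) (t := (q : ℝ)⁻¹)
      (z := (q : ℝ) ^ (-u)) (κ := 1) (y := (q : ℝ) ^ (-u)) (mul_inv_cancel₀ hq0.ne')
      (by rw [abs_of_pos (inv_pos.2 hq0)]; exact inv_lt_one_of_one_lt₀ hq1)
      (abs_mul_inv_rpow_lt_one hq1 (by linarith)) one_ne_zero (mul_one _).symm
      (Real.rpow_nonneg hq0.le _) _ (fun μ => by rw [hq]; exact card_linearEquiv_cyclicSum μ) ν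
      (fun μ => Nat.card (CyclicSum F μ →ₗ[𝒪[F]] CyclicSum F ν))
      (fun μ => by rw [card_hom_cyclicSum, hq]; push_cast; rfl)
      (p := cohenLenstraProb F u) (fun μ => by
        rw [cohenLenstraProb, ← hq, Real.rpow_mul_natCast hq0.le]
        congr 1
        refine tprod_congr fun j => ?_
        rw [Real.rpow_sub hq0, inv_pow, div_eq_mul_inv]
        congr 3
        exact_mod_cast Real.rpow_natCast (q : ℝ) (j + 1))
      (a := fun k => (q : ℝ) ^ (-(k : ℝ))) (b := fun k => (q : ℝ) ^ (-u - k))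
      (fun k => by simp only [Real.rpow_neg hq0.le, Real.rpow_natCast, inv_pow])
      (fun k => by simp only [Real.rpow_sub hq0, Real.rpow_natCast, inv_pow, div_eq_mul_inv])
    refine ⟨h1, h2, fun {Ω} _ P _ M _ _ _ hM hP => ?_⟩
    refine h3 P _ _ hM hP (fun μ ω hω => ?_) fun μ μ' ω h h' => HasType.unique h h'
    obtain ⟨f⟩ := hω
    obtain ⟨g⟩ := hN
    rw [card_hom_congr f g]
  · intro q hq u hu
    have hq1 : (1 : ℝ) < q := by
      rw [hq]; exact_mod_cast Finite.one_lt_card (α := 𝓀[F])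
    have hq0 : (0 : ℝ) < q := zero_lt_one.trans hq1
    have hpow : ∀ k : ℕ, (((q : ℝ) ^ 2)⁻¹) ^ k = (q : ℝ) ^ (-2 * (k : ℝ)) := fun k => by
      rw [Real.rpow_mul hq0.le, Real.rpow_natCast, Real.rpow_neg hq0.le]
      norm_num
    -- The factor `#M_μ = q^{2|μ|}` joins `q^{-2u|μ|}` to give `y = q^{2-2u}`, and `y = z κ` with `κ
    -- = q` forces `z = q^{1-2u}`. Then `z t = q^{-1-2u}`, which is less than one exactly for `u >
    -- -1/2`.
    obtain ⟨h1, h2, h3⟩ := expectation_eq_hallLittlewood (s := (q : ℝ) ^ 2) (t := ((q : ℝ) ^ 2)⁻¹)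
      (z := (q : ℝ) ^ (1 - 2 * u)) (κ := q) (y := (q : ℝ) ^ (2 - 2 * u))
      (mul_inv_cancel₀ (pow_pos hq0 2).ne')
      (by rw [abs_of_pos (inv_pos.2 (pow_pos hq0 2))]
          exact inv_lt_one_of_one_lt₀ (one_lt_pow₀ hq1 two_ne_zero))
      (by
        rw [← pow_one ((q : ℝ) ^ 2)⁻¹, hpow, ← Real.rpow_add hq0,
          abs_of_pos (Real.rpow_pos_of_pos hq0 _)]
        exact Real.rpow_lt_one_of_one_lt_of_neg hq1 (by push_cast; linarith)) hq0.ne'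
      (by rw [← Real.rpow_add_one hq0.ne']; congr 1; ring)
      (Real.rpow_nonneg hq0.le _) _ (fun μ => by rw [hq]; exact card_alternatingAut hπ μ) ν
      (fun μ => Nat.card (DoubledCyclicSum F μ →ₗ[𝒪[F]] CyclicSum F ν))
      (fun μ => by rw [card_hom_doubledCyclicSum, hq]; push_cast; rfl)
      (p := alternatingProb hπ u) (fun μ => by
        rw [alternatingProb, card_doubledCyclicSum, ← hq, Real.rpow_mul_natCast hq0.le]
        push_cast
        rw [← mul_pow, ← Real.rpow_natCast (q : ℝ) 2, ← Real.rpow_add hq0]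
        congr 1
        · congr 3
          push_cast
          ring
        · refine tprod_congr fun j => ?_
          rw [Real.rpow_natCast, hpow, ← Real.rpow_add hq0]
          congr 2
          push_cast
          ring)
      (a := fun k => (q : ℝ) ^ (-2 * (k : ℝ))) (b := fun k => (q : ℝ) ^ (1 - 2 * u - 2 * k))
      (fun k => (hpow k).symm)
      (fun k => by
        rw [hpow, ← Real.rpow_add hq0]
        congr 1
        ring)
    refine ⟨h1, h2, fun {Ω} _ P _ M _ _ _ B _ hM hP => ?_⟩
    refine h3 P _ _ hM hP (fun μ ω hω => ?_) fun μ μ' ω h h' => HasAlternatingType.unique h h'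
    obtain ⟨f, -⟩ := hω
    obtain ⟨g⟩ := hN
    rw [card_hom_congr f g]
  · intro σ hσ hσ' hσπ q hq u hu
    have hq1 : (1 : ℝ) < q := by exact_mod_cast two_le_of_sq_eq_card hq
    have hq0 : (0 : ℝ) < q := zero_lt_one.trans hq1
    have hpow : ∀ k : ℕ, (-(q : ℝ)⁻¹) ^ k = (-1) ^ k * (q : ℝ) ^ (-(k : ℝ)) := fun k => by
      rw [neg_pow, Real.rpow_neg hq0.le, Real.rpow_natCast, inv_pow]
    have hpow' : ∀ k : ℕ, -(q : ℝ) ^ (-u) * (-(q : ℝ)⁻¹) ^ k =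
        (-1) ^ (k + 1) * (q : ℝ) ^ (-u - k) := fun k => by
      rw [hpow, sub_eq_add_neg, Real.rpow_add hq0]
      ring
    -- Since `κ = -1`, the positive weight `y = q^{-u}` requires the negative `z = -q^{-u}`, while
    -- `z t = q^{-u-1}` is positive. The signs of `z` and of the powers of `t` produce the
    -- alternating signs of the statement.
    obtain ⟨h1, h2, h3⟩ := expectation_eq_hallLittlewood (s := -(q : ℝ)) (t := -(q : ℝ)⁻¹)
      (z := -(q : ℝ) ^ (-u)) (κ := -1) (y := (q : ℝ) ^ (-u))
      (by rw [neg_mul_neg, mul_inv_cancel₀ hq0.ne'])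
      (by rw [abs_neg, abs_of_pos (inv_pos.2 hq0)]; exact inv_lt_one_of_one_lt₀ hq1)
      (by rw [neg_mul_neg]; exact abs_mul_inv_rpow_lt_one hq1 (by linarith))
      (neg_ne_zero.2 one_ne_zero) (by ring)
      (Real.rpow_nonneg hq0.le _) _ (fun μ => card_hermitianAut hπ hσ hσ' hσπ hq μ) (doubleRows ν)
      (fun μ => Nat.card (CyclicSum F μ →ₗ[𝒪[F]] CyclicSum F ν))
      (fun μ => by
        rw [card_hom_cyclicSum, ← hq]
        simp only [colLen_doubleRows, mul_left_comm _ 2, ← Finset.mul_sum]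
        rw [pow_mul, neg_sq]
        push_cast
        rfl)
      (p := hermitianProb hπ σ q u) (fun μ => by
        rw [hermitianProb, Real.rpow_mul_natCast hq0.le]
        congr 1
        refine tprod_congr fun j => ?_
        rw [hpow', pow_succ, pow_succ]
        push_cast
        ring)
      (a := fun k => (-1) ^ k * (q : ℝ) ^ (-(k : ℝ)))
      (b := fun k => (-1) ^ (k + 1) * (q : ℝ) ^ (-u - k))
      (fun k => (hpow k).symm) (fun k => (hpow' k).symm)
    refine ⟨h1, h2, fun {Ω} _ P _ M _ _ _ B _ hM hP => ?_⟩
    refine h3 P _ _ hM hP (fun μ ω hω => ?_) fun μ μ' ω h h' =>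
      HasType.unique (HasHermitianType.hasType h) (HasHermitianType.hasType h')
    obtain ⟨f, -⟩ := hω
    obtain ⟨g⟩ := hN
    rw [card_hom_congr f g]
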